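/- Let $\mathbb F_q$ be a field with $q$ elements, $A=\mathbb F_q[T]$, $k=\mathbb F_q(T)$, and let $A_+\subset A$ be the set of monic polynomials. Let $|\cdot|_\infty$ be the absolute value of $k$ with $|T|_\infty=q$ that is given by $|x|_\infty=q^{\deg x}$ for $x\ne0$, let $k_\infty=\mathbb F_q(\!(1/T)\!)$ be the completion of $k$, $\mathbb C_\infty$ the completion of an algebraic closure of $k_\infty$, and $\bar k$ the algebraic closure of $k$ in $\mathbb C_\infty$. Put $\Pi(z)=\prod_{a\in A_+}(1+z/a)^{-1}$. Fix $f\in A_+$ of positive degree. Let $\mathcal A_f$ be the free abelian group on symbols $[x]$, $x\in f^{-1}A$, with $[x]=[x']$ whenever $x\equiv x'\bmod A$, and let $\Pi:\mathcal A_f\to\mathbb C_\infty^\times$ be the homomorphism with $\Pi([x])=\Pi(x)$ for all $x\in f^{-1}A$ with $|x|_\infty<1$; its values are the $\Pi$-monomials of level $f$. For $a\in A$ prime to $f$ let $\mathbf a\mapsto a\star\mathbf a$ be the automorphism of $\mathcal A_f$ with $a\star[x]=[ax]$. For $x\in k_\infty$ and an integer $N\ge0$ put $\langle x\rangle_N=1$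 if $\inf_{a\in A}|x-a-T^{-N-1}|_\infty<|T|_\infty^{-N-1}$ and $\langle x\rangle_N=0$ otherwise; extend this to homomorphisms $\langle\cdot\rangle_N:\mathcal A_f\to\mathbb Z$ by $\langle[x]\rangle_N=\langle x\rangle_N$, and put $\langle\mathbf a\rangle=\sum_{N\ge0}\langle\mathbf a\rangle_N$. Write $\mathbf a\sim_f\mathbf b$ if $\langle a\star\mathbf a\rangle=\langle a\star\mathbf b\rangle$ for all $a\in A$ with $(a,f)=1$ and $\deg a<\deg f$. Put $$\nu_f=1+\frac{q-2}{q-1}\cdot\#(A/f)^\times$$ and let $E_f$ be the subfield of $\mathbb C_\infty$ generated over $\bar k$ by $\{\Pi(a/f)\mid a\in A,\ \deg a<\deg f\}$. Then: (1) The transcendence degree of $E_f/\bar k$ is (finite and) at most $\nu_f$. (2) The transcendence degree of $E_f/\bar k$ is strictly less than $\nu_f$ if and only if for some integer $N\ge2$ there exist $\mathbf a_1,\dots,\mathbf a_N\in\mathcal A_f$ and nonzero $c_1,\dots,c_N\in\bar k$ such that $\mathbf a_i\not\sim_f\mathbf a_j$ for all $1\le i<j\le N$ and $c_1\Pi(\mathbf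 a_1)+\cdots+c_N\Pi(\mathbf a_N)=0$. (3) Consequently the following two assertions are equivalent: (a) the transcendence degree of $E_f/\bar k$ equals $\nu_f$; (b) for all $N$ and all $\mathbf a_1,\dots,\mathbf a_N\in\mathcal A_f$, the $\Pi$-monomials $\Pi(\mathbf a_1),\dots,\Pi(\mathbf a_N)$ are $\bar k$-linearly independent if and only if $\mathbf a_i\not\sim_f\mathbf a_j$ for all $1\le i<j\le N$. -/

import Mathlib

open Polynomial

noncomputable section

namespace GeomGamma

/-! ### The fields `k ⊆ k_∞ ⊆ C_∞` and `k̄`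

`F` is the finite field `𝔽_q`, `q = Fintype.card F`; `A = F[X]` (the variable `T` is `X`) and
`k = RatFunc F`. -/

section Fields

variable (F : Type*) [Field F] [Fintype F]

/-- The absolute value `|r|_∞ = q ^ deg r` on `k = 𝔽_q(T)`, so that `|T|_∞ = q`. -/
def inftyAbs : AbsoluteValue (RatFunc F) ℝ where
  toFun r := open Classical in if r = 0 then 0 else (Fintype.card F : ℝ) ^ r.intDegree
  map_mul' x y := by
    have hq : (Fintype.card F : ℝ) ≠ 0 := by exact_mod_cast Fintype.card_ne_zero
    by_cases hx : x = 0
    · simp [hx]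
    by_cases hy : y = 0
    · simp [hy]
    simp [hx, hy, RatFunc.intDegree_mul hx hy, zpow_add₀ hq]
  nonneg' x := by
    split_ifs <;> positivity
  eq_zero' x := by
    have hq : (Fintype.card F : ℝ) ≠ 0 := by exact_mod_cast Fintype.card_ne_zero
    by_cases hx : x = 0
    · simp [hx]
    · simp [hx, zpow_ne_zero _ hq]
  add_le' x y := by
    have hq : (1 : ℝ) ≤ Fintype.card F := by exact_mod_cast Fintype.card_pos
    rcases eq_or_ne x 0 with rfl | hx
    · rw [zero_add, if_pos rfl, zero_add]
    rcases eq_or_ne y 0 with rfl | hy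
    · rw [add_zero, if_pos rfl, add_zero]
    by_cases hxy : x + y = 0
    · simp only [hxy, if_true]
      split_ifs <;> positivity
    simp only [hx, hy, hxy, if_false]
    refine (zpow_le_zpow_right₀ hq (RatFunc.intDegree_add_le hy hxy)).trans ?_
    rcases le_total x.intDegree y.intDegree with h | h
    · rw [max_eq_right h]
      exact le_add_of_nonneg_left (by positivity)
    · rw [max_eq_left h]
      exact le_add_of_nonneg_right (by positivity)

theorem inftyAbs_of_ne_zero {r : RatFunc F} (hr : r ≠ 0) :
    inftyAbs F r = (Fintype.card F : ℝ) ^ r.intDegree := by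
  exact if_neg hr

theorem inftyAbs_X : inftyAbs F RatFunc.X = Fintype.card F := by
  rw [inftyAbs_of_ne_zero F RatFunc.X_ne_zero, RatFunc.intDegree_X, zpow_one]

theorem inftyAbs_add_le_max (x y : RatFunc F) :
    inftyAbs F (x + y) ≤ max (inftyAbs F x) (inftyAbs F y) := by
  have hq : (1 : ℝ) ≤ Fintype.card F := by exact_mod_cast Fintype.card_pos
  by_cases hx : x = 0
  · simp [hx]
  by_cases hy : y = 0
  · simp [hy]
  by_cases hxy : x + y = 0
  · simp [hxy]
  rw [inftyAbs_of_ne_zero F hx, inftyAbs_of_ne_zero F hy, inftyAbs_of_ne_zero F hxy]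
  refine (zpow_le_zpow_right₀ hq (RatFunc.intDegree_add_le hy hxy)).trans ?_
  rcases le_total x.intDegree y.intDegree with h | h
  · rw [max_eq_right h]
    exact le_max_right _ _
  · rw [max_eq_left h]
    exact le_max_left _ _

/-- `k_∞ = 𝔽_q((1/T))`, the `|·|_∞`-completion of `k`. -/
abbrev KInfty := (inftyAbs F).Completion

theorem KInfty.norm_coe (r : RatFunc F) : ‖algebraMap (RatFunc F) (KInfty F) r‖ = inftyAbs F r := by
  exact UniformSpace.Completion.norm_coe (WithAbs.toAbs (inftyAbs F) r)

instance : IsUltrametricDist (KInfty F) := by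
  refine IsUltrametricDist.isUltrametricDist_of_forall_norm_add_le_max_norm fun x y => ?_
  refine UniformSpace.Completion.induction_on₂ x y ?_ fun a b => ?_
  · exact isClosed_le (by fun_prop) (by fun_prop)
  · rw [← UniformSpace.Completion.coe_add]
    simp only [UniformSpace.Completion.norm_coe]
    exact inftyAbs_add_le_max F a.ofAbs b.ofAbs

instance : NontriviallyNormedField (KInfty F) where
  non_trivial := by
    refine ⟨algebraMap (RatFunc F) (KInfty F) RatFunc.X, ?_⟩
    rw [KInfty.norm_coe, inftyAbs_X]
    exact_mod_cast Fintype.one_lt_card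

/-- An algebraic closure of `k_∞`. -/
abbrev KInftyBar := AlgebraicClosure (KInfty F)

/-- The unique extension of `|·|_∞` to the algebraic closure of `k_∞`. -/
instance : NormedField (KInftyBar F) := spectralNorm.normedField (KInfty F) (KInftyBar F)

instance : NormedAlgebra (KInfty F) (KInftyBar F) := spectralNorm.normedAlgebra _ _

instance : UniformContinuousConstSMul (RatFunc F) (KInftyBar F) where
  uniformContinuous_const_smul r := by
    simp_rw [Algebra.smul_def]
    exact (Ring.uniformContinuousConstSMul (KInftyBar F)).uniformContinuous_const_smul _

/-- `C_∞`, the `|·|_∞`-completion of the algebraic closure of `k_∞`. -/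
abbrev CInfty := UniformSpace.Completion (KInftyBar F)

/-- `k̄`, the algebraic closure of `k` in `C_∞`. -/
abbrev KBar : IntermediateField (RatFunc F) (CInfty F) := algebraicClosure (RatFunc F) (CInfty F)

end Fields

/-! ### Diamond brackets and the factorial function `Π` -/

section Functions

variable {F : Type*} [Field F] [Fintype F]

open Classical in
/-- The generalized diamond bracket `⟨x⟩_N` for `x ∈ k_∞`: it is `1` if
`inf_{a ∈ A} |x - a - T^(-N-1)|_∞ < |T|_∞^(-N-1)` and `0` otherwise. In other words `⟨x⟩_N = 1` if
and only if `x` is congruent modulo `A` to an element of `k_∞` of degree `-N-1` with leading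
coefficient `1`. -/
def diamondN (N : ℕ) (x : KInfty F) : ℤ :=
  if (⨅ a : F[X], ‖x - algebraMap (RatFunc F) (KInfty F) (algebraMap F[X] (RatFunc F) a)
        - (algebraMap (RatFunc F) (KInfty F) RatFunc.X) ^ (-(N : ℤ) - 1)‖)
      < ‖algebraMap (RatFunc F) (KInfty F) RatFunc.X‖ ^ (-(N : ℤ) - 1)
  then 1 else 0

theorem diamondN_add (N : ℕ) (x : KInfty F) (b : F[X]) :
    diamondN N (x + algebraMap (RatFunc F) (KInfty F) (algebraMap F[X] (RatFunc F) b)) =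
      diamondN N x := by
  unfold diamondN
  congr 2
  rw [← (Equiv.addRight b).iInf_comp]
  congr 1
  ext a
  congr 1
  simp only [Equiv.coe_addRight, map_add]
  ring

/-- The geometric factorial function `Π(z) = ∏_{a ∈ A_+} (1 + z / a)⁻¹` on `C_∞`. (The product
converges unconditionally as `z / a → 0` along the cofinite filter. At the poles `z ∈ -A_+` the
value is irrelevant.) -/
def Pi (z : CInfty F) : CInfty F :=
  ∏' a : {a : F[X] // a.Monic},
    (1 + z / algebraMap (RatFunc F) (CInfty F) (algebraMap F[X] (RatFunc F) (a : F[X])))⁻¹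

end Functions

/-! ### The free abelian group `𝒜_f` -/

section LevelF

variable {F : Type*} [Field F] (f : F[X])

/-- The free abelian group `𝒜_f` on the symbols `[x]`, `x ∈ f⁻¹A`, with `[x]` and `[x']` identified
if `x ≡ x' mod A`. Since `a / f ≡ a' / f mod A` if and only if `a ≡ a' mod f`, the distinct symbols
are indexed by `A / f`, the class of `a` standing for `[a / f]`. -/
abbrev AGroup := AdjoinRoot f →₀ ℤ

/-- The symbol `[a / f]`. -/
def symb (a : F[X]) : AGroup f := Finsupp.single (AdjoinRoot.mk f a) 1

/-- The star action `b ⋆ [a / f] = [b a / f]`, for `b` prime to `f`. -/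
def star (b : F[X]) : AGroup f →+ AGroup f :=
  Finsupp.mapDomain.addMonoidHom (fun x => AdjoinRoot.mk f b * x)

theorem star_symb (b a : F[X]) : star f b (symb f a) = symb f (b * a) := by
  simp [star, symb]

variable {f} (hf : f.Monic)

/-- The element `x = a / f ∈ k` with `|x|_∞ < 1`, i.e. `deg a < deg f`, that represents a class of
`f⁻¹A` modulo `A`. -/
def rep (c : AdjoinRoot f) : RatFunc F :=
  algebraMap F[X] (RatFunc F) (AdjoinRoot.modByMonicHom hf c) / algebraMap F[X] (RatFunc F) f

theorem rep_mk {a : F[X]} (ha : a.degree < f.degree) :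
    rep hf (AdjoinRoot.mk f a) = algebraMap F[X] (RatFunc F) a / algebraMap F[X] (RatFunc F) f := by
  rw [rep, AdjoinRoot.modByMonicHom_mk, (modByMonic_eq_self_iff hf).2 ha]

variable [Fintype F]

/-- The homomorphism `𝒜_f → ℤ` with `⟨[x]⟩_N = ⟨x⟩_N`. -/
def bracketN (N : ℕ) : AGroup f →+ ℤ :=
  Finsupp.liftAddHom fun c =>
    AddMonoidHom.mulLeft (diamondN N (algebraMap (RatFunc F) (KInfty F) (rep hf c)))

theorem bracketN_symb (N : ℕ) (a : F[X]) :
    bracketN hf N (symb f a) =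
      diamondN N (algebraMap (RatFunc F) (KInfty F)
        (algebraMap F[X] (RatFunc F) a / algebraMap F[X] (RatFunc F) f)) := by
  have hf0 : algebraMap F[X] (RatFunc F) f ≠ 0 := by
    simpa using hf.ne_zero
  have h : algebraMap F[X] (RatFunc F) a / algebraMap F[X] (RatFunc F) f =
      algebraMap F[X] (RatFunc F) (a %ₘ f) / algebraMap F[X] (RatFunc F) f +
        algebraMap F[X] (RatFunc F) (a /ₘ f) := by
    nth_rewrite 1 [← modByMonic_add_div a f]
    rw [map_add, map_mul]
    field_simp
  rw [h, map_add, diamondN_add]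
  simp [bracketN, symb, rep, AdjoinRoot.modByMonicHom_mk]

/-- `⟨𝐚⟩ = ∑_{N ≥ 0} ⟨𝐚⟩_N`, a sum with only finitely many nonzero terms. -/
def bracket (a : AGroup f) : ℤ := ∑ᶠ N : ℕ, bracketN hf N a

/-- The relation `𝐚 ∼_f 𝐛`: `⟨u ⋆ 𝐚⟩ = ⟨u ⋆ 𝐛⟩` for all `u ∈ A` with `(u, f) = 1`,
`deg u < deg f`. -/
def Sim (a b : AGroup f) : Prop :=
  ∀ u : F[X], IsCoprime u f → u.degree < f.degree →
    bracket hf (star f u a) = bracket hf (star f u b)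

/-- The homomorphism `Π : 𝒜_f → C_∞ˣ` with `Π([x]) = Π(x)` for `x ∈ f⁻¹A`, `|x|_∞ < 1`; its values
are the `Π`-monomials of level `f`. -/
def PiMonomial (a : AGroup f) : CInfty F :=
  a.prod fun c n => Pi (algebraMap (RatFunc F) (CInfty F) (rep hf c)) ^ n

theorem PiMonomial_symb {a : F[X]} (ha : a.degree < f.degree) :
    PiMonomial hf (symb f a) = Pi (algebraMap (RatFunc F) (CInfty F)
      (algebraMap F[X] (RatFunc F) a / algebraMap F[X] (RatFunc F) f)) := by
  simp [PiMonomial, symb, rep_mk hf ha]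

variable (f)

/-- `E_f`, the subfield of `C_∞` generated over `k̄` by all `Π(a / f)`, `a ∈ A`,
`deg a < deg f`. -/
def EField : IntermediateField (KBar F) (CInfty F) :=
  IntermediateField.adjoin (KBar F)
    {y | ∃ a : F[X], a.degree < f.degree ∧
      y = Pi (algebraMap (RatFunc F) (CInfty F)
        (algebraMap F[X] (RatFunc F) a / algebraMap F[X] (RatFunc F) f))}

/-- `ν_f = 1 + (q - 2) / (q - 1) · #(A / f)ˣ`. -/
def nu : ℚ :=
  1 + ((Fintype.card F : ℚ) - 2) / ((Fintype.card F : ℚ) - 1) * (Nat.card (AdjoinRoot f)ˣ : ℚ)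

end LevelF

end GeomGamma

end

/-! The heart of the matter is that a `Π`-monomial whose brackets `⟨u ⋆ 𝐚⟩` all vanish is algebraic
over `k`. Given this, `Π` modulo `k̄ˣ` depends only on the bracket vector `(⟨u ⋆ 𝐚⟩)_u`. If `e_1, …,
e_r` lift a `ℤ`-basis of the lattice of bracket vectors, every monomial is a `k̄`-multiple of a
Laurent monomial in the `Π(e_i)`, and `E_f` is generated by these `r` elements. So the transcendence
degree is at most `r`, with equality exactly when the `Π(e_i)` are algebraically independent, that
is, when distinct Laurent monomials in them are linearly independent. Distinct exponents correspond
to inequivalent elements of `𝒜_f`, which gives (2) and (3) once `r = ν_f`.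

For the algebraicity, two families of relations are established up to algebraic factors: the
reflection formula, where `∏_θ Π(θx)` is a fixed period up to an algebraic factor because the
exponential-like function `z ∏ (1 + z/a)`, suitably normalized, takes torsion values at rational
points (`isAlgebraic_rho_div`), and the multiplication formula (`isAlgebraic_prod_Pi_div`). The
monomials algebraic over `k` form a subgroup of `𝒜_f` with torsion-free, hence free, quotient. A
linear functional on the quotient is therefore a distribution on `A/f`: a function obeying the
additive form of both families. It remains to see that every distribution is a linear combination of
the dilates of the indicator function of monic residues (`IsDistribution.exists_eq_sum`); such
combinations vanish on elements with zero brackets.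

This classification is done one character `χ` of `(A/f)ˣ` at a time. If `χ` is trivial on constants,
reflection kills the `χ`-component of a distribution of period zero. Otherwise a Fourier transform
turns the multiplication formula into dual relations under which an eigenfunction is determined by
its value at `1`. For the monic indicator this value is a power of `q` times a Gauss sum times `L(1,
χ)`, and `L(1, χ) ≠ 0` is the analogue of Dirichlet's theorem (`sum_lCoeff_ne_zero`). The same
nonvanishing computes the rank: the linear relations among the dilates of the monic indicator are
the coefficient functions of sum zero invariant under constants, so `r = #(A/f)ˣ - #(A/f)ˣ/(q-1) + 1
= ν_f`. -/

noncomputable section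

namespace GeomGamma

/-! ### Reindexing products over polynomials of bounded degree -/

section Finsets

variable (F : Type*) [Field F] [Fintype F]

/-- The finite set of polynomials of degree less than `d`. -/
def degLT (d : ℕ) : Finset F[X] :=
  have : Finite (degreeLT F d) := Finite.of_equiv _ (degreeLTEquiv F d).symm.toEquiv
  (Set.toFinite (degreeLT F d : Set F[X])).toFinset

open Classical in
/-- The finite set of monic polynomials of degree less than `d`. -/
def monicLT (d : ℕ) : Finset F[X] := (degLT F d).filter Monic

variable {F}

theorem mem_degLT {d : ℕ} {a : F[X]} : a ∈ degLT F d ↔ a.degree < d := by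
  simp [degLT, mem_degreeLT]

theorem mem_monicLT {d : ℕ} {a : F[X]} : a ∈ monicLT F d ↔ a.degree < d ∧ a.Monic := by
  simp [monicLT, mem_degLT]

theorem card_degLT (d : ℕ) : (degLT F d).card = Fintype.card F ^ d := by
  have : Finite (degreeLT F d) := Finite.of_equiv _ (degreeLTEquiv F d).symm.toEquiv
  have h := Nat.card_congr (degreeLTEquiv F d).toEquiv
  rw [Nat.card_eq_fintype_card (α := Fin d → F), Fintype.card_fun, Fintype.card_fin] at h
  rw [← h]
  exact (Set.ncard_eq_toFinset_card _ (Set.toFinite (degreeLT F d : Set F[X]))).symm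

theorem zero_mem_degLT (d : ℕ) : (0 : F[X]) ∈ degLT F d := by
  simp [mem_degLT]

theorem degLT_mono {d e : ℕ} (h : d ≤ e) : degLT F d ⊆ degLT F e := fun _ ha =>
  mem_degLT.2 ((mem_degLT.1 ha).trans_le (by exact_mod_cast h))

theorem monicLT_mono {d e : ℕ} (h : d ≤ e) : monicLT F d ⊆ monicLT F e := fun _ ha =>
  mem_monicLT.2 ⟨mem_degLT.1 (degLT_mono h (mem_degLT.2 (mem_monicLT.1 ha).1)),
    (mem_monicLT.1 ha).2⟩

-- A nonzero polynomial is uniquely a nonzero constant times a monic one.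
open Classical in
theorem prod_units_monicLT {M : Type*} [CommMonoid M] (d : ℕ) (φ : F[X] → M) :
    ∏ θ : Fˣ, ∏ a ∈ monicLT F d, φ (C (θ : F) * a) = ∏ a ∈ (degLT F d).erase 0, φ a := by
  rw [← Finset.prod_product']
  refine Finset.prod_bij' (fun p _ => C (p.1 : F) * p.2)
    (fun a _ => (if h : a.leadingCoeff = 0 then 1 else Units.mk0 _ h, C a.leadingCoeff⁻¹ * a))
    ?_ ?_ ?_ ?_ ?_
  · rintro ⟨θ, a⟩ h
    simp only [Finset.mem_product, Finset.mem_univ, true_and, mem_monicLT] at h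
    simp only [Finset.mem_erase, mem_degLT, degree_C_mul θ.ne_zero]
    exact ⟨mul_ne_zero (C_ne_zero.2 θ.ne_zero) h.2.ne_zero, h.1⟩
  · intro a h
    simp only [Finset.mem_erase, mem_degLT] at h
    simp only [Finset.mem_product, Finset.mem_univ, true_and, mem_monicLT]
    have hl : a.leadingCoeff⁻¹ ≠ 0 := inv_ne_zero (leadingCoeff_ne_zero.2 h.1)
    refine ⟨by rw [degree_C_mul hl]; exact h.2, ?_⟩
    rw [mul_comm]
    exact monic_mul_leadingCoeff_inv h.1
  · rintro ⟨θ, a⟩ h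
    simp only [Finset.mem_product, Finset.mem_univ, true_and, mem_monicLT] at h
    have h1 : (C (θ : F) * a).leadingCoeff = θ := by simp [h.2.leadingCoeff]
    simp only [h1, Units.ne_zero, dite_false, Units.mk0_val]
    rw [← mul_assoc, ← C_mul, inv_mul_cancel₀ θ.ne_zero, C_1, one_mul]
  · intro a h
    simp only [Finset.mem_erase] at h
    have hl : a.leadingCoeff ≠ 0 := leadingCoeff_ne_zero.2 h.1
    simp only [hl, dite_false, Units.val_mk0]
    rw [← mul_assoc, ← C_mul, mul_inv_cancel₀ hl, C_1, one_mul]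
  · rintro ⟨θ, a⟩ h
    rfl

theorem prod_degLT_succ {M : Type*} [CommMonoid M] (d : ℕ) (φ : F[X] → M) :
    ∏ a ∈ degLT F (d + 1), φ a = ∏ θ : F, ∏ b ∈ degLT F d, φ (X * b + C θ) := by
  rw [← Finset.prod_product']
  symm
  refine Finset.prod_bij' (fun p _ => X * p.2 + C p.1) (fun a _ => (a.coeff 0, a.divX))
    ?_ ?_ ?_ ?_ ?_
  · rintro ⟨θ, b⟩ h
    simp only [Finset.mem_product, Finset.mem_univ, true_and, mem_degLT] at h ⊢
    rw [degree_lt_iff_coeff_zero] at h ⊢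
    intro m hm
    obtain ⟨m, rfl⟩ : ∃ k, m = k + 1 := ⟨m - 1, by omega⟩
    simp [h m (by omega)]
  · intro a h
    simp only [Finset.mem_product, Finset.mem_univ, true_and, mem_degLT] at h ⊢
    rw [degree_lt_iff_coeff_zero] at h ⊢
    intro m hm
    rw [coeff_divX]
    exact h _ (by omega)
  · rintro ⟨θ, b⟩ h
    refine Prod.ext (by simp) ?_
    ext m
    simp
  · intro a h
    simp only
    exact X_mul_divX_add a
  · simp

/-- Division by `g` writes each monic polynomial of degree at least `deg g` as `g * b + t` with `b`
monic; the monics of smaller degree are the second product. -/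
theorem prod_monicLT_add {M : Type*} [CommMonoid M] (d : ℕ) {g : F[X]} (hg : g.Monic)
    (φ : F[X] → M) :
    (∏ b ∈ monicLT F d, ∏ t ∈ degLT F g.natDegree, φ (g * b + t)) *
      ∏ c ∈ monicLT F g.natDegree, φ c = ∏ c ∈ monicLT F (d + g.natDegree), φ c := by
  classical
  rw [← Finset.prod_sdiff (monicLT_mono (F := F) (Nat.le_add_left g.natDegree d))]
  congr 1
  rw [← Finset.prod_product']
  have hgd : g.degree = g.natDegree := degree_eq_natDegree hg.ne_zero
  refine Finset.prod_bij' (fun p _ => g * p.1 + p.2) (fun a _ => (a /ₘ g, a %ₘ g))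
    ?_ ?_ ?_ ?_ ?_
  · rintro ⟨b, t⟩ h
    simp only [Finset.mem_product, mem_degLT, mem_monicLT, Finset.mem_sdiff] at h ⊢
    have h1 : t.degree < (g * b).degree := by
      rw [degree_mul]
      refine h.2.trans_le ?_
      rw [hgd, degree_eq_natDegree h.1.2.ne_zero]
      exact_mod_cast Nat.le_add_right _ _
    have hm : (g * b + t).Monic := (hg.mul h.1.2).add_of_left h1
    have h2 : (g * b + t).degree = g.natDegree + b.natDegree := by
      rw [degree_add_eq_left_of_degree_lt h1, degree_mul, hgd, degree_eq_natDegree h.1.2.ne_zero]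
    have h3 := h.1.1
    rw [degree_eq_natDegree h.1.2.ne_zero] at h3
    rw [h2]
    norm_cast at h3 ⊢
    exact ⟨⟨by omega, hm⟩, fun h => by omega⟩
  · intro a h
    simp only [Finset.mem_product, mem_degLT, mem_monicLT, Finset.mem_sdiff] at h ⊢
    have h1 : g.degree ≤ a.degree := by
      by_contra! h'
      exact h.2 ⟨h'.trans_le hgd.le, h.1.2⟩
    have h2 := degree_add_divByMonic hg h1
    have h3 : (a /ₘ g).Monic := by
      have := leadingCoeff_divByMonic_of_monic hg h1
      rw [Monic, this, h.1.2]
    refine ⟨⟨?_, h3⟩, (degree_modByMonic_lt a hg).trans_le hgd.le⟩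
    have h4 := h.1.1
    rw [← h2, hgd, degree_eq_natDegree h3.ne_zero] at h4
    rw [degree_eq_natDegree h3.ne_zero]
    norm_cast at h4 ⊢
    omega
  · rintro ⟨b, t⟩ h
    simp only [Finset.mem_product, mem_degLT] at h
    have := div_modByMonic_unique (f := g * b + t) b t hg ⟨by ring, h.2.trans_le hgd.ge⟩
    simp [this.1, this.2]
  · intro a h
    simp only
    rw [add_comm, modByMonic_add_div]
  · simp

end Finsets

/-! ### Convergence of the product for `Π` on the open unit disc -/

section PiConvergence

open Filter Topology

variable {F : Type*} [Field F] [Fintype F]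

theorem CInfty.norm_coe (r : RatFunc F) : ‖algebraMap (RatFunc F) (CInfty F) r‖ = inftyAbs F r := by
  have h : algebraMap (RatFunc F) (CInfty F) r =
    ((algebraMap (RatFunc F) (KInftyBar F) r : KInftyBar F) : CInfty F) := rfl
  rw [h, UniformSpace.Completion.norm_coe,
    IsScalarTower.algebraMap_apply (RatFunc F) (KInfty F) (KInftyBar F), norm_algebraMap',
    KInfty.norm_coe]

theorem one_lt_card_real : (1 : ℝ) < Fintype.card F := by exact_mod_cast Fintype.one_lt_card

theorem inftyAbs_polynomial {a : F[X]} (ha : a ≠ 0) :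
    inftyAbs F (algebraMap F[X] (RatFunc F) a) = (Fintype.card F : ℝ) ^ a.natDegree := by
  rw [inftyAbs_of_ne_zero F (by simpa using ha), RatFunc.intDegree_polynomial, zpow_natCast]

theorem one_le_inftyAbs_polynomial {a : F[X]} (ha : a ≠ 0) :
    1 ≤ inftyAbs F (algebraMap F[X] (RatFunc F) a) := by
  rw [inftyAbs_polynomial ha]
  exact one_le_pow₀ one_lt_card_real.le

theorem inftyAbs_one_add {x : RatFunc F} (hx : inftyAbs F x < 1) : inftyAbs F (1 + x) = 1 := by
  apply le_antisymm
  · exact (inftyAbs_add_le_max F 1 x).trans (by simp [hx.le])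
  · by_contra! h
    have := inftyAbs_add_le_max F (1 + x) (-x)
    rw [add_neg_cancel_right, map_one, map_neg_eq_map] at this
    exact absurd this (not_le.2 (max_lt h hx))

theorem inftyAbs_prod_sub_one_lt {ι : Type*} (s : Finset ι) (u : ι → RatFunc F) {ε : ℝ}
    (h0 : 0 < ε) (h1 : ∀ i ∈ s, inftyAbs F (u i) = 1) (hs : ∀ i ∈ s, inftyAbs F (u i - 1) < ε) :
    inftyAbs F (∏ i ∈ s, u i - 1) < ε := by
  classical
  induction s using Finset.induction_on with
  | empty => simpa using h0
  | insert i s hi ih =>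
    rw [Finset.prod_insert hi]
    have : u i * ∏ j ∈ s, u j - 1 = u i * (∏ j ∈ s, u j - 1) + (u i - 1) := by ring
    rw [this]
    refine (inftyAbs_add_le_max F _ _).trans_lt (max_lt ?_ (hs i (by simp)))
    rw [map_mul, h1 i (by simp), one_mul]
    exact ih (fun j hj => h1 j (by simp [hj])) (fun j hj => hs j (by simp [hj]))

/-- The factor of `Π(x)` that belongs to `a`. -/
def piFactor (x : RatFunc F) (a : F[X]) : RatFunc F := (1 + x / algebraMap F[X] (RatFunc F) a)⁻¹

/-- The partial product of `Π(x)` over all `a` of degree less than `d`. -/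
def piFin (d : ℕ) (x : RatFunc F) : RatFunc F := ∏ a ∈ monicLT F d, piFactor x a

theorem inftyAbs_div_lt {x : RatFunc F} (hx : inftyAbs F x < 1) {a : F[X]} (ha : a ≠ 0) :
    inftyAbs F (x / algebraMap F[X] (RatFunc F) a) < ((Fintype.card F : ℝ) ^ a.natDegree)⁻¹ := by
  rw [map_div₀, inftyAbs_polynomial ha, div_eq_mul_inv]
  have := one_lt_card_real (F := F)
  exact mul_lt_of_lt_one_left (by positivity) hx

theorem inftyAbs_div_lt_one {x : RatFunc F} (hx : inftyAbs F x < 1) {a : F[X]} (ha : a ≠ 0) :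
    inftyAbs F (x / algebraMap F[X] (RatFunc F) a) < 1 :=
  (inftyAbs_div_lt hx ha).trans_le (inv_le_one_of_one_le₀ (one_le_pow₀ one_lt_card_real.le))

theorem inftyAbs_piFactor {x : RatFunc F} (hx : inftyAbs F x < 1) {a : F[X]} (ha : a ≠ 0) :
    inftyAbs F (piFactor x a) = 1 := by
  rw [piFactor, map_inv₀, inftyAbs_one_add (inftyAbs_div_lt_one hx ha), inv_one]

theorem inftyAbs_piFactor_sub_one {x : RatFunc F} (hx : inftyAbs F x < 1) {a : F[X]} (ha : a ≠ 0) :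
    inftyAbs F (piFactor x a - 1) < ((Fintype.card F : ℝ) ^ a.natDegree)⁻¹ := by
  have h1 := inftyAbs_one_add (inftyAbs_div_lt_one hx ha)
  have h0 : 1 + x / algebraMap F[X] (RatFunc F) a ≠ 0 := by
    intro h
    rw [h, map_zero] at h1
    exact zero_ne_one h1
  have : piFactor x a - 1 = piFactor x a * -(x / algebraMap F[X] (RatFunc F) a) := by
    rw [piFactor]
    generalize x / algebraMap F[X] (RatFunc F) a = y at *
    field_simp
    ring
  rw [this, map_mul, inftyAbs_piFactor hx ha, one_mul, map_neg_eq_map]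
  exact inftyAbs_div_lt hx ha

theorem piFactor_ne_zero {x : RatFunc F} (hx : inftyAbs F x < 1) {a : F[X]} (ha : a ≠ 0) :
    piFactor x a ≠ 0 := by
  intro h
  have := inftyAbs_piFactor hx ha
  rw [h, map_zero] at this
  exact zero_ne_one this

theorem piFin_ne_zero {x : RatFunc F} (hx : inftyAbs F x < 1) (d : ℕ) : piFin d x ≠ 0 :=
  Finset.prod_ne_zero_iff.2 fun _ ha => piFactor_ne_zero hx (mem_monicLT.1 ha).2.ne_zero

/-- All factors have absolute value `1`, and those of degree at least `d` lie within `q ^ (-d)` of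
`1`. By the ultrametric inequality any finite product of the latter is equally close to `1`, so the
partial products are Cauchy. -/
theorem multipliable_piFactor {x : RatFunc F} (hx : inftyAbs F x < 1) :
    Multipliable fun a : {a : F[X] // a.Monic} =>
      algebraMap (RatFunc F) (CInfty F) (piFactor x a) := by
  classical
  have key : CauchySeq fun s : Finset {a : F[X] // a.Monic} =>
      ∏ a ∈ s, algebraMap (RatFunc F) (CInfty F) (piFactor x a) := by
    rw [Metric.cauchySeq_iff']
    intro ε hε
    obtain ⟨d, hd⟩ := exists_pow_lt_of_lt_one hε (inv_lt_one_of_one_lt₀ (one_lt_card_real (F := F)))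
    refine ⟨(monicLT F d).subtype Monic, fun s hs => ?_⟩
    rw [ge_iff_le] at hs
    rw [dist_eq_norm, ← Finset.prod_sdiff hs, ← sub_one_mul, norm_mul]
    have h2 : ‖∏ a ∈ (monicLT F d).subtype Monic,
        algebraMap (RatFunc F) (CInfty F) (piFactor x a)‖ = 1 := by
      rw [norm_prod]
      refine Finset.prod_eq_one fun a _ => ?_
      rw [CInfty.norm_coe, inftyAbs_piFactor hx a.2.ne_zero]
    rw [h2, mul_one, ← map_prod, ← map_one (algebraMap (RatFunc F) (CInfty F)), ← map_sub,
      CInfty.norm_coe]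
    refine inftyAbs_prod_sub_one_lt _ _ hε (fun a _ => inftyAbs_piFactor hx a.2.ne_zero) ?_
    intro a ha
    refine (inftyAbs_piFactor_sub_one hx a.2.ne_zero).trans_le (le_trans ?_ hd.le)
    have h3 : d ≤ (a : F[X]).natDegree := by
      by_contra! h
      simp only [Finset.mem_sdiff, Finset.mem_subtype, mem_monicLT, a.2, and_true] at ha
      exact ha.2 (by rw [degree_eq_natDegree a.2.ne_zero]; exact_mod_cast h)
    rw [inv_pow]
    have := one_lt_card_real (F := F)
    gcongr
    exact this.le
  exact cauchySeq_tendsto_of_complete key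

theorem Pi_eq_tprod (x : RatFunc F) : Pi (algebraMap (RatFunc F) (CInfty F) x) =
    ∏' a : {a : F[X] // a.Monic}, algebraMap (RatFunc F) (CInfty F) (piFactor x a) := by
  simp [Pi, piFactor]

theorem tendsto_piFin {x : RatFunc F} (hx : inftyAbs F x < 1) :
    Tendsto (fun d => algebraMap (RatFunc F) (CInfty F) (piFin d x)) atTop
      (𝓝 (Pi (algebraMap (RatFunc F) (CInfty F) x))) := by
  classical
  have h := (multipliable_piFactor hx).hasProd
  rw [← Pi_eq_tprod] at h
  have hm : Tendsto (fun d => (monicLT F d).subtype Monic) atTop atTop := by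
    refine tendsto_atTop_finset_of_monotone (fun d e hde a ha => ?_) fun a => ?_
    · rw [Finset.mem_subtype] at ha ⊢
      exact monicLT_mono hde ha
    · refine ⟨(a : F[X]).natDegree + 1, ?_⟩
      rw [Finset.mem_subtype, mem_monicLT, degree_eq_natDegree a.2.ne_zero]
      exact ⟨by exact_mod_cast Nat.lt_succ_self _, a.2⟩
  refine (h.comp hm).congr fun d => ?_
  simp only [Function.comp_apply, piFin, map_prod]
  rw [Finset.prod_subtype_of_mem (fun a => algebraMap (RatFunc F) (CInfty F) (piFactor x a))]
  exact fun a ha => (mem_monicLT.1 ha).2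

theorem norm_Pi {x : RatFunc F} (hx : inftyAbs F x < 1) :
    ‖Pi (algebraMap (RatFunc F) (CInfty F) x)‖ = 1 := by
  refine tendsto_nhds_unique (tendsto_piFin hx).norm ?_
  refine tendsto_const_nhds.congr fun d => ?_
  rw [CInfty.norm_coe, piFin, map_prod]
  exact (Finset.prod_eq_one fun a ha => inftyAbs_piFactor hx (mem_monicLT.1 ha).2.ne_zero).symm

theorem Pi_ne_zero {x : RatFunc F} (hx : inftyAbs F x < 1) :
    Pi (algebraMap (RatFunc F) (CInfty F) x) ≠ 0 :=
  norm_ne_zero_iff.1 (by rw [norm_Pi hx]; exact one_ne_zero)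

end PiConvergence

/-! ### Finite-level exponential: additivity and the recursion for multiplication by `T` -/

section Reflection

open Filter Topology

variable {F : Type*} [Field F] [Fintype F]

theorem prod_X_sub_C_field (F : Type*) [Field F] [Fintype F] :
    ∏ θ : F, (X - C θ) = (X ^ Fintype.card F - X : F[X]) := by
  have hq : 1 < Fintype.card F := Fintype.one_lt_card
  have hr := FiniteField.roots_X_pow_card_sub_X F
  have h := prod_multiset_X_sub_C_of_monic_of_roots_card_eq (p := (X ^ Fintype.card F - X : F[X]))
    (monic_X_pow_sub (by rw [degree_X]; exact_mod_cast hq)) (by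
      rw [hr, FiniteField.X_pow_card_sub_X_natDegree_eq F hq]; rfl)
  rw [← h, hr]
  rfl

/-- The homogeneous form of `∏_θ (z + θ) = z^q - z`, with `z = x / y`. -/
theorem prod_add_smul {K : Type*} [Field K] [Algebra F K] (x y : K) :
    ∏ θ : F, (x + algebraMap F K θ * y) =
      x ^ Fintype.card F - x * y ^ (Fintype.card F - 1) := by
  classical
  have hq : 1 < Fintype.card F := Fintype.one_lt_card
  rcases eq_or_ne y 0 with rfl | hy
  · have : Fintype.card F - 1 ≠ 0 := by omega
    simp [this]
  have h : ∀ z : K, ∏ θ : F, (z + algebraMap F K θ) = z ^ Fintype.card F - z := by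
    intro z
    have h1 := congrArg (aeval z) (prod_X_sub_C_field F)
    simp only [map_sub, map_pow, aeval_X, map_prod, aeval_C] at h1
    rw [← h1]
    exact Fintype.prod_equiv (Equiv.neg F) _ _ fun θ => by simp
  have h2 : ∀ θ : F, x + algebraMap F K θ * y = y * (x / y + algebraMap F K θ) := by
    intro θ
    field_simp
  simp_rw [h2]
  rw [Finset.prod_mul_distrib, h, Finset.prod_const, Finset.card_univ]
  obtain ⟨n, hn⟩ : ∃ n, Fintype.card F = n + 1 := ⟨_, (Nat.sub_add_cancel hq.le).symm⟩
  rw [hn, Nat.add_sub_cancel, mul_sub, div_pow, mul_div_cancel₀ _ (pow_ne_zero _ hy), pow_succ y]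
  field_simp

/-- `∏ (z + a)` over all polynomials `a` of degree less than `d`. -/
def eFin (d : ℕ) (z : RatFunc F) : RatFunc F :=
  ∏ a ∈ degLT F d, (z + algebraMap F[X] (RatFunc F) a)

/-- The product of all nonzero polynomials of degree less than `d`. -/
def dFin (F : Type*) [Field F] [Fintype F] (d : ℕ) : RatFunc F := by
  classical exact ∏ a ∈ (degLT F d).erase 0, algebraMap F[X] (RatFunc F) a

theorem dFin_ne_zero (d : ℕ) : dFin F d ≠ 0 := by
  classical
  refine Finset.prod_ne_zero_iff.2 fun a ha => ?_
  simpa using (Finset.mem_erase.1 ha).1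

omit [Fintype F] in
theorem algebraMap_eq_poly_C (θ : F) :
    algebraMap F (RatFunc F) θ = algebraMap F[X] (RatFunc F) (C θ) := by
  rw [IsScalarTower.algebraMap_apply F F[X] (RatFunc F)]
  rfl

/-- Writing the roots as `X * b + θ` and pulling out `X`, the inner products become `eFin d (z + θ /
X) = eFin d z + θ * eFin d (1 / X)`. Linearity is a hypothesis here because `eFin_linear` is proved
by induction from this very recursion: its right side is visibly `F`-linear in `eFin d z`. -/
theorem eFin_X_mul_of_linear (d : ℕ) (hadd : ∀ z w : RatFunc F, eFin d (z + w) = eFin d z + eFin d w)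
    (hsmul : ∀ (θ : F) (z : RatFunc F), eFin d (θ • z) = θ • eFin d z) (z : RatFunc F) :
    eFin (d + 1) (RatFunc.X * z) = RatFunc.X ^ (Fintype.card F ^ (d + 1)) *
      (eFin d z ^ Fintype.card F - eFin d z * eFin d RatFunc.X⁻¹ ^ (Fintype.card F - 1)) := by
  have hX : (RatFunc.X : RatFunc F) ≠ 0 := RatFunc.X_ne_zero
  rw [eFin, prod_degLT_succ, ← prod_add_smul, pow_succ, pow_mul, ← Finset.card_univ (α := F),
    ← Finset.prod_const, ← Finset.prod_mul_distrib]
  refine Finset.prod_congr rfl fun θ _ => ?_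
  rw [← Algebra.smul_def, ← hsmul, ← hadd, eFin, Finset.card_univ, ← card_degLT,
    ← Finset.prod_const, ← Finset.prod_mul_distrib]
  refine Finset.prod_congr rfl fun b _ => ?_
  rw [Algebra.smul_def, algebraMap_eq_poly_C, map_add, map_mul, RatFunc.algebraMap_X]
  field_simp
  ring

theorem eFin_linear (d : ℕ) : (∀ z w : RatFunc F, eFin d (z + w) = eFin d z + eFin d w) ∧
    ∀ (θ : F) (z : RatFunc F), eFin d (θ • z) = θ • eFin d z := by
  induction d with
  | zero =>
    have : degLT F 0 = {0} := by
      ext a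
      rw [mem_degLT, Finset.mem_singleton]
      simp [Polynomial.ext_iff]
    simp [eFin, this]
  | succ d ih =>
    have hX : (RatFunc.X : RatFunc F) ≠ 0 := RatFunc.X_ne_zero
    have h : ∀ z : RatFunc F, eFin (d + 1) z = RatFunc.X ^ (Fintype.card F ^ (d + 1)) *
      (FiniteField.frobeniusAlgHom F (RatFunc F) (eFin d (RatFunc.X⁻¹ * z)) -
        eFin d (RatFunc.X⁻¹ * z) * eFin d RatFunc.X⁻¹ ^ (Fintype.card F - 1)) := by
      intro z
      have := eFin_X_mul_of_linear d ih.1 ih.2 (RatFunc.X⁻¹ * z)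
      rwa [mul_inv_cancel_left₀ hX] at this
    constructor
    · intro z w
      rw [h, h z, h w, mul_add, ih.1, map_add]
      ring
    · intro θ z
      rw [h, h z, mul_smul_comm, ih.2, map_smul, smul_mul_assoc, ← smul_sub, mul_smul_comm]

theorem eFin_X_mul (d : ℕ) (z : RatFunc F) :
    eFin (d + 1) (RatFunc.X * z) = RatFunc.X ^ (Fintype.card F ^ (d + 1)) *
      (eFin d z ^ Fintype.card F - eFin d z * eFin d RatFunc.X⁻¹ ^ (Fintype.card F - 1)) :=
  eFin_X_mul_of_linear d (eFin_linear d).1 (eFin_linear d).2 z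

theorem eFin_polynomial {d : ℕ} {a : F[X]} (ha : a.degree < d) :
    eFin d (algebraMap F[X] (RatFunc F) a) = 0 := by
  refine Finset.prod_eq_zero (i := -a) (mem_degLT.2 (by rwa [degree_neg])) ?_
  simp

open Classical in
theorem prod_erase_zero_eq_prod_units {M : Type*} [CommMonoid M] (φ : F → M) :
    ∏ θ ∈ Finset.univ.erase 0, φ θ = ∏ u : Fˣ, φ u := by
  symm
  refine Finset.prod_bij (fun u _ => (u : F)) (fun u _ => by simp) (fun u _ v _ h => Units.ext h)
    (fun θ hθ => ⟨Units.mk0 θ (Finset.mem_erase.1 hθ).1, Finset.mem_univ _, rfl⟩) fun u _ => rfl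

/-- Same splitting `a = X * b + θ`: the terms with `θ = 0` give the power of `X` and `dFin d`, the
others give values of `eFin d` at `θ / X`, and the sign is Wilson's `∏ θ = -1`. -/
theorem dFin_succ (d : ℕ) :
    dFin F (d + 1) = -(RatFunc.X ^ (Fintype.card F ^ (d + 1) - 1) * dFin F d *
      eFin d RatFunc.X⁻¹ ^ (Fintype.card F - 1)) := by
  classical
  have hX : (RatFunc.X : RatFunc F) ≠ 0 := RatFunc.X_ne_zero
  set q := Fintype.card F with hq
  have hq1 : 1 < q := Fintype.one_lt_card
  have hE : ∀ (e : ℕ), dFin F e = ∏ a ∈ degLT F e,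
      if a = 0 then 1 else algebraMap F[X] (RatFunc F) a := by
    intro e
    rw [← Finset.mul_prod_erase _ _ (zero_mem_degLT e), if_pos rfl, one_mul, dFin]
    exact Finset.prod_congr rfl fun a ha => by rw [if_neg (Finset.mem_erase.1 ha).1]
  rw [hE, prod_degLT_succ, ← Finset.mul_prod_erase _ _ (Finset.mem_univ (0 : F))]
  have h0 : ∏ b ∈ degLT F d, (if X * b + C (0 : F) = 0 then 1 else
      algebraMap F[X] (RatFunc F) (X * b + C 0)) = RatFunc.X ^ (q ^ d - 1) * dFin F d := by
    rw [← Finset.mul_prod_erase _ _ (zero_mem_degLT d), dFin, ← card_degLT,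
      ← Finset.card_erase_of_mem (zero_mem_degLT d), ← Finset.prod_const,
      ← Finset.prod_mul_distrib]
    simp only [C_0, add_zero, mul_zero, if_true, one_mul]
    refine Finset.prod_congr rfl fun a ha => ?_
    rw [if_neg (mul_ne_zero X_ne_zero (Finset.mem_erase.1 ha).1), map_mul, RatFunc.algebraMap_X]
  have h1 : ∀ θ ∈ Finset.univ.erase (0 : F), ∏ b ∈ degLT F d, (if X * b + C θ = 0 then 1 else
      algebraMap F[X] (RatFunc F) (X * b + C θ)) =
      RatFunc.X ^ q ^ d * eFin d RatFunc.X⁻¹ * algebraMap F (RatFunc F) θ := by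
    intro θ hθ
    rw [mul_assoc, mul_comm (eFin d _), ← Algebra.smul_def, ← (eFin_linear d).2, eFin,
      ← card_degLT, ← Finset.prod_const, ← Finset.prod_mul_distrib]
    refine Finset.prod_congr rfl fun b _ => ?_
    have : X * b + C θ ≠ 0 := by
      intro h
      have := congrArg (coeff · 0) h
      simp at this
      exact (Finset.mem_erase.1 hθ).1 this
    rw [if_neg this, Algebra.smul_def, algebraMap_eq_poly_C, map_add, map_mul, RatFunc.algebraMap_X]
    field_simp
    ring
  have h2 : ∏ θ ∈ Finset.univ.erase (0 : F), θ = -1 := by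
    rw [prod_erase_zero_eq_prod_units (fun θ => θ), ← Units.coe_prod,
      FiniteField.prod_univ_units_id_eq_neg_one, Units.val_neg, Units.val_one]
  rw [h0, Finset.prod_congr rfl h1, Finset.prod_mul_distrib, Finset.prod_const, ← map_prod, h2,
    Finset.card_erase_of_mem (Finset.mem_univ _), Finset.card_univ, ← hq, mul_pow, ← pow_mul]
  have h3 : q ^ (d + 1) - 1 = (q ^ d - 1) + q ^ d * (q - 1) := by
    have : 1 ≤ q ^ d := Nat.one_le_pow _ _ (by omega)
    have h4 : q ^ (d + 1) = q ^ d * (q - 1) + q ^ d := by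
      rw [pow_succ, ← Nat.mul_succ, Nat.succ_eq_add_one, Nat.sub_add_cancel hq1.le]
    omega
  rw [h3, pow_add, map_neg, map_one]
  ring

/-- The normalized partial product `z ∏ (1 + z / a)`. -/
def epsFin (d : ℕ) (z : RatFunc F) : RatFunc F := eFin d z / dFin F d

/-- After normalization the powers of `X` growing with `d` cancel, so that the recursion survives
the limit. -/
theorem epsFin_X_mul (d : ℕ) (z : RatFunc F) (h : epsFin d (RatFunc.X⁻¹ : RatFunc F) ≠ 0) :
    epsFin (d + 1) (RatFunc.X * z) = RatFunc.X * (epsFin d z -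
      epsFin d z ^ Fintype.card F / epsFin d RatFunc.X⁻¹ ^ (Fintype.card F - 1)) := by
  have hX : (RatFunc.X : RatFunc F) ≠ 0 := RatFunc.X_ne_zero
  have hD := dFin_ne_zero (F := F) d
  have he : eFin d (RatFunc.X⁻¹ : RatFunc F) ≠ 0 := fun h' => h (by rw [epsFin, h', zero_div])
  have hq1 : 1 < Fintype.card F := Fintype.one_lt_card
  simp only [epsFin]
  rw [eFin_X_mul, dFin_succ]
  obtain ⟨n, hn⟩ : ∃ n, Fintype.card F = n + 1 := ⟨_, (Nat.sub_add_cancel hq1.le).symm⟩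
  obtain ⟨k, hk⟩ : ∃ k, Fintype.card F ^ (d + 1) = k + 1 :=
    ⟨_, (Nat.sub_add_cancel (Nat.one_le_pow _ _ (by omega))).symm⟩
  rw [hk, hn]
  simp only [Nat.add_sub_cancel]
  generalize eFin d (RatFunc.X⁻¹ : RatFunc F) = e₁ at *
  generalize eFin d z = e at *
  generalize dFin F d = D at *
  rw [div_pow, div_pow, pow_succ D]
  field_simp
  ring

end Reflection

/-! ### Limit of the exponential, its torsion values, and the reflection formula -/

section Limits

open Filter Topology Classical

variable {F : Type*} [Field F] [Fintype F]

/-- The product `∏ Π(θ x)` over all `θ ∈ 𝔽_qˣ`. -/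
def rho (x : RatFunc F) : CInfty F :=
  ∏ θ : Fˣ, Pi (algebraMap (RatFunc F) (CInfty F) ((θ : F) • x))

theorem inftyAbs_smul (θ : Fˣ) (x : RatFunc F) : inftyAbs F ((θ : F) • x) = inftyAbs F x := by
  rw [Algebra.smul_def, algebraMap_eq_poly_C, map_mul, inftyAbs_polynomial (by simp)]
  simp

theorem rho_ne_zero {x : RatFunc F} (hx : inftyAbs F x < 1) : rho x ≠ 0 :=
  Finset.prod_ne_zero_iff.2 fun θ _ => Pi_ne_zero (by rwa [inftyAbs_smul])

theorem add_polynomial_ne_zero {x : RatFunc F} (hx : inftyAbs F x < 1) {a : F[X]} (ha : a ≠ 0) :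
    x + algebraMap F[X] (RatFunc F) a ≠ 0 := by
  intro h
  rw [eq_neg_of_add_eq_zero_left h, map_neg_eq_map] at hx
  exact absurd hx (not_lt.2 (one_le_inftyAbs_polynomial ha))

theorem eFin_ne_zero {x : RatFunc F} (hx : inftyAbs F x < 1) (h0 : x ≠ 0) (d : ℕ) :
    eFin d x ≠ 0 := by
  refine Finset.prod_ne_zero_iff.2 fun a _ => ?_
  rcases eq_or_ne a 0 with rfl | ha
  · simpa using h0
  · exact add_polynomial_ne_zero hx ha

theorem epsFin_ne_zero {x : RatFunc F} (hx : inftyAbs F x < 1) (h0 : x ≠ 0) (d : ℕ) :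
    epsFin d x ≠ 0 :=
  div_ne_zero (eFin_ne_zero hx h0 d) (dFin_ne_zero d)

/-- The reflection formula at finite level: scaling `x` by constants amounts to scaling the monic
`a`, so the product runs over all nonzero `a`. -/
theorem prod_piFin_smul {x : RatFunc F} (hx : inftyAbs F x < 1) (h0 : x ≠ 0) (d : ℕ) :
    ∏ θ : Fˣ, piFin d ((θ : F) • x) = x / epsFin d x := by
  have h1 : ∀ θ : Fˣ, piFin d ((θ : F) • x) =
      ∏ a ∈ monicLT F d, piFactor x (C ((θ⁻¹ : Fˣ) : F) * a) := by
    intro θ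
    refine Finset.prod_congr rfl fun a _ => ?_
    have hθ : algebraMap F (RatFunc F) θ ≠ 0 := by simp
    rw [piFactor, piFactor, Algebra.smul_def, map_mul, ← algebraMap_eq_poly_C, Units.val_inv_eq_inv_val,
      map_inv₀]
    field_simp
  simp_rw [h1]
  rw [Fintype.prod_equiv (Equiv.inv Fˣ)
    (fun θ => ∏ a ∈ monicLT F d, piFactor x (C ((θ⁻¹ : Fˣ) : F) * a))
    (fun θ => ∏ a ∈ monicLT F d, piFactor x (C (θ : F) * a)) (fun θ => rfl), prod_units_monicLT,
    epsFin, eFin, dFin, ← Finset.mul_prod_erase _ _ (zero_mem_degLT d), map_zero, add_zero,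
    div_div_eq_mul_div, mul_div_mul_left _ _ h0, ← Finset.prod_div_distrib]
  refine Finset.prod_congr rfl fun a ha => ?_
  have ha0 := (Finset.mem_erase.1 ha).1
  have h2 : algebraMap F[X] (RatFunc F) a ≠ 0 := by simpa using ha0
  have h3 := add_polynomial_ne_zero hx ha0
  rw [piFactor, one_add_div h2, inv_div, add_comm]

theorem tendsto_epsFin_of_lt {x : RatFunc F} (hx : inftyAbs F x < 1) :
    Tendsto (fun d => algebraMap (RatFunc F) (CInfty F) (epsFin d x)) atTop
      (𝓝 (algebraMap (RatFunc F) (CInfty F) x / rho x)) := by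
  rcases eq_or_ne x 0 with rfl | h0
  · have : ∀ d, epsFin d (0 : RatFunc F) = 0 := fun d => by
      have := eFin_polynomial (F := F) (d := d) (a := 0) (by simp)
      rw [map_zero] at this
      rw [epsFin, this, zero_div]
    simp [this]
  · have h1 : Tendsto (fun d => ∏ θ : Fˣ, algebraMap (RatFunc F) (CInfty F)
        (piFin d ((θ : F) • x))) atTop (𝓝 (rho x)) :=
      tendsto_finsetProd _ fun θ _ => tendsto_piFin (by rwa [inftyAbs_smul])
    refine (tendsto_const_nhds.div h1 (rho_ne_zero hx)).congr fun d => ?_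
    rw [Pi.div_apply, ← map_prod, prod_piFin_smul hx h0, ← map_div₀, div_div_cancel₀ h0]

theorem exists_polynomial_sub_lt (z : RatFunc F) :
    ∃ a : F[X], inftyAbs F (z - algebraMap F[X] (RatFunc F) a) < 1 := by
  have hd := RatFunc.monic_denom z
  have hd0 : algebraMap F[X] (RatFunc F) z.denom ≠ 0 := by simpa using hd.ne_zero
  refine ⟨z.num /ₘ z.denom, ?_⟩
  have h : z - algebraMap F[X] (RatFunc F) (z.num /ₘ z.denom) =
      algebraMap F[X] (RatFunc F) (z.num %ₘ z.denom) / algebraMap F[X] (RatFunc F) z.denom := by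
    have h1 := congrArg (algebraMap F[X] (RatFunc F)) (modByMonic_add_div z.num z.denom)
    rw [map_add, map_mul] at h1
    have h2 := RatFunc.num_div_denom z
    rw [← h1, div_eq_iff hd0] at h2
    rw [eq_div_iff hd0, sub_mul, ← h2]
    ring
  rw [h, map_div₀]
  rcases eq_or_ne (z.num %ₘ z.denom) 0 with h0 | h0
  · simp [h0]
  · have hq := one_lt_card_real (F := F)
    rw [inftyAbs_polynomial h0, inftyAbs_polynomial hd.ne_zero, div_lt_one (by positivity)]
    exact pow_lt_pow_right₀ hq (natDegree_lt_natDegree h0 (degree_modByMonic_lt _ hd))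

theorem eFin_add (d : ℕ) (z w : RatFunc F) : eFin d (z + w) = eFin d z + eFin d w :=
  (eFin_linear d).1 z w

/-- The limit is needed for every `z`, since multiplication by `T` leaves the unit disc. By
additivity, and because `eFin d` kills polynomials of degree below `d`, only the class of `z` modulo
`A` matters eventually. -/
theorem exists_tendsto_epsFin (z : RatFunc F) :
    ∃ l, Tendsto (fun d => algebraMap (RatFunc F) (CInfty F) (epsFin d z)) atTop (𝓝 l) := by
  obtain ⟨a, ha⟩ := exists_polynomial_sub_lt z
  refine ⟨_, (tendsto_epsFin_of_lt ha).congr' ?_⟩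
  filter_upwards [eventually_gt_atTop a.natDegree] with d hd
  have h := eFin_add d (z - algebraMap F[X] (RatFunc F) a) (algebraMap F[X] (RatFunc F) a)
  rw [sub_add_cancel, eFin_polynomial ((degree_le_natDegree).trans_lt (by exact_mod_cast hd)),
    add_zero] at h
  rw [epsFin, epsFin, h]

/-- The limit `z ∏ (1 + z / a)` of the normalized partial products. -/
def eps (z : RatFunc F) : CInfty F := (exists_tendsto_epsFin z).choose

theorem tendsto_epsFin (z : RatFunc F) :
    Tendsto (fun d => algebraMap (RatFunc F) (CInfty F) (epsFin d z)) atTop (𝓝 (eps z)) :=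
  (exists_tendsto_epsFin z).choose_spec

theorem eps_eq_of_lt {x : RatFunc F} (hx : inftyAbs F x < 1) :
    eps x = algebraMap (RatFunc F) (CInfty F) x / rho x :=
  tendsto_nhds_unique (tendsto_epsFin x) (tendsto_epsFin_of_lt hx)

theorem eps_add (z w : RatFunc F) : eps (z + w) = eps z + eps w := by
  refine tendsto_nhds_unique (tendsto_epsFin _) (((tendsto_epsFin z).add (tendsto_epsFin w)).congr
    fun d => ?_)
  rw [← map_add, epsFin, epsFin, epsFin, eFin_add, add_div]

theorem eps_smul (θ : F) (z : RatFunc F) :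
    eps (θ • z) = algebraMap (RatFunc F) (CInfty F) (algebraMap F (RatFunc F) θ) * eps z := by
  refine tendsto_nhds_unique (tendsto_epsFin _) (((tendsto_epsFin z).const_mul _).congr
    fun d => ?_)
  rw [← map_mul, epsFin, epsFin, (eFin_linear d).2, Algebra.smul_def, mul_div_assoc]

theorem eps_polynomial (a : F[X]) : eps (algebraMap F[X] (RatFunc F) a) = 0 := by
  refine tendsto_nhds_unique (tendsto_epsFin _) (tendsto_const_nhds.congr' ?_)
  filter_upwards [eventually_gt_atTop a.natDegree] with d hd
  rw [epsFin, eFin_polynomial ((degree_le_natDegree).trans_lt (by exact_mod_cast hd)), zero_div,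
    map_zero]

theorem inftyAbs_X_inv_lt : inftyAbs F (RatFunc.X⁻¹ : RatFunc F) < 1 := by
  rw [map_inv₀, inftyAbs_X]
  exact inv_lt_one_of_one_lt₀ one_lt_card_real

theorem eps_X_inv_ne_zero : eps (RatFunc.X⁻¹ : RatFunc F) ≠ 0 := by
  rw [eps_eq_of_lt inftyAbs_X_inv_lt]
  refine div_ne_zero ?_ (rho_ne_zero inftyAbs_X_inv_lt)
  rw [_root_.map_ne_zero]
  exact inv_ne_zero RatFunc.X_ne_zero

theorem eps_X_mul (z : RatFunc F) :
    eps (RatFunc.X * z) = algebraMap (RatFunc F) (CInfty F) RatFunc.X * (eps z -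
      eps z ^ Fintype.card F / eps (RatFunc.X⁻¹ : RatFunc F) ^ (Fintype.card F - 1)) := by
  refine tendsto_nhds_unique ((tendsto_epsFin _).comp (tendsto_add_atTop_nat 1))
    ((((tendsto_epsFin z).sub (((tendsto_epsFin z).pow _).div ((tendsto_epsFin _).pow _)
      (pow_ne_zero _ eps_X_inv_ne_zero))).const_mul _).congr fun d => ?_)
  rw [Function.comp_apply, epsFin_X_mul d z
    (epsFin_ne_zero inftyAbs_X_inv_lt (inv_ne_zero RatFunc.X_ne_zero) d)]
  simp

/-- The `F`-linear function `eps`, normalized so that it is compatible with an action of `F[X]`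
by additive polynomials over `k`. -/
def eta (z : RatFunc F) : CInfty F := eps z / eps (RatFunc.X⁻¹ : RatFunc F)

/-- Dividing by `eps (1 / X)` removes the only transcendental coefficient in the functional
equation. What remains is an `A`-action by additive polynomials over `k`, as for the Carlitz module.
-/
theorem eta_X_mul (z : RatFunc F) :
    eta (RatFunc.X * z) = algebraMap (RatFunc F) (CInfty F) RatFunc.X *
      (eta z - eta z ^ Fintype.card F) := by
  have h1 := eps_X_inv_ne_zero (F := F)
  have hq1 : 1 < Fintype.card F := Fintype.one_lt_card
  simp only [eta]
  rw [eps_X_mul]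
  obtain ⟨n, hn⟩ : ∃ n, Fintype.card F = n + 1 := ⟨_, (Nat.sub_add_cancel hq1.le).symm⟩
  rw [hn, Nat.add_sub_cancel]
  generalize eps (RatFunc.X⁻¹ : RatFunc F) = e₁ at *
  rw [div_pow, pow_succ e₁]
  field_simp

/-- The clause on the derivative shows that `P ≠ 0` when `a ≠ 0`; it propagates through the
induction because `q`-th powers have derivative zero. -/
theorem exists_polynomial_aeval_eta (a : F[X]) : ∃ P : (RatFunc F)[X],
    derivative P = C (algebraMap F[X] (RatFunc F) a) ∧
    ∀ z : RatFunc F, aeval (eta z) P = eta (algebraMap F[X] (RatFunc F) a * z) := by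
  induction a using Polynomial.induction_on with
  | C θ =>
    refine ⟨C (algebraMap F[X] (RatFunc F) (C θ)) * X, by simp, fun z => ?_⟩
    rw [map_mul, aeval_C, aeval_X, ← algebraMap_eq_poly_C, ← Algebra.smul_def θ z, eta, eta,
      eps_smul, mul_div_assoc]
  | add a b ha hb =>
    obtain ⟨P, hP, hP'⟩ := ha
    obtain ⟨Q, hQ, hQ'⟩ := hb
    refine ⟨P + Q, by simp [hP, hQ], fun z => ?_⟩
    rw [map_add, hP', hQ', map_add, add_mul, eta, eta, eta, eps_add, add_div]
  | monomial n θ h =>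
    obtain ⟨P, hP, hP'⟩ := h
    refine ⟨C RatFunc.X * (P - P ^ Fintype.card F), ?_, fun z => ?_⟩
    · have h0 : ((Fintype.card F : ℕ) : (RatFunc F)[X]) = 0 := by
        rw [← map_natCast (algebraMap F (RatFunc F)[X]), FiniteField.cast_card_eq_zero, map_zero]
      rw [derivative_mul, derivative_C, zero_mul, zero_add, derivative_sub, derivative_pow, hP]
      simp only [map_natCast, h0, zero_mul, sub_zero]
      rw [← C_mul, pow_succ, ← mul_assoc, map_mul (algebraMap F[X] (RatFunc F)) _ X,
        RatFunc.algebraMap_X, mul_comm]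
    · rw [map_mul, aeval_C, map_sub, map_pow, hP', ← eta_X_mul, pow_succ,
        ← mul_assoc, ← mul_assoc (C θ)]
      congr 1
      rw [map_mul (algebraMap F[X] (RatFunc F)) _ X, RatFunc.algebraMap_X]
      ring

/-- The denominator of `z` carries `z` into `A`, where `eta` vanishes, so `eta z` is a torsion point
of the action. -/
theorem isAlgebraic_eta (z : RatFunc F) : IsAlgebraic (RatFunc F) (eta z) := by
  obtain ⟨P, hP, hP'⟩ := exists_polynomial_aeval_eta z.denom
  have hd : algebraMap F[X] (RatFunc F) z.denom ≠ 0 := by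
    simpa using z.denom_ne_zero
  refine ⟨P, ?_, ?_⟩
  · rintro rfl
    rw [derivative_zero] at hP
    exact hd (C_eq_zero.1 hP.symm)
  · have h1 : algebraMap F[X] (RatFunc F) z.denom * z = algebraMap F[X] (RatFunc F) z.num := by
      rw [mul_comm]
      exact (div_eq_iff hd).1 (RatFunc.num_div_denom z) |>.symm
    rw [hP', h1, eta, eps_polynomial, zero_div]

/-- The reflection formula up to algebraic factors: `rho x = x / eps x`, and ratios of values of
`eps` are ratios of values of `eta`. All `rho x` thus represent one common period. -/
theorem isAlgebraic_rho_div {x y : RatFunc F} (hx : inftyAbs F x < 1) (hy : inftyAbs F y < 1)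
    (hx0 : x ≠ 0) (hy0 : y ≠ 0) : IsAlgebraic (RatFunc F) (rho x / rho y) := by
  have h : rho x / rho y = algebraMap (RatFunc F) (CInfty F) (x / y) * (eta y * (eta x)⁻¹) := by
    have h1 := rho_ne_zero hx
    have h2 := rho_ne_zero hy
    have h3 := eps_X_inv_ne_zero (F := F)
    have h4 : algebraMap (RatFunc F) (CInfty F) x ≠ 0 := (_root_.map_ne_zero _).2 hx0
    have h5 : algebraMap (RatFunc F) (CInfty F) y ≠ 0 := (_root_.map_ne_zero _).2 hy0
    simp only [eta]
    rw [eps_eq_of_lt hx, eps_eq_of_lt hy, map_div₀]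
    generalize eps (RatFunc.X⁻¹ : RatFunc F) = e₁ at *
    field_simp
  rw [h]
  exact (isAlgebraic_algebraMap _).mul ((isAlgebraic_eta y).mul (isAlgebraic_eta x).inv)

end Limits

/-! ### The multiplication formula for `Π` -/

section Multiplication

open Filter Topology Classical

variable {F : Type*} [Field F] [Fintype F]

-- The identity `1 + (x + t) / (g b) = (1 + x / (g b + t)) (1 + t / (g b))`. Together with the
-- reindexing `(b, t) ↦ g * b + t` it gives the multiplication formula at finite level.
omit [Fintype F] in
theorem piFactor_div_add (x : RatFunc F) {g b t : F[X]} (hg : g ≠ 0) (hb : b ≠ 0)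
    (h : g * b + t ≠ 0) :
    piFactor ((x + algebraMap F[X] (RatFunc F) t) / algebraMap F[X] (RatFunc F) g) b =
      piFactor x (g * b + t) *
        piFactor (algebraMap F[X] (RatFunc F) t / algebraMap F[X] (RatFunc F) g) b := by
  have hg' : algebraMap F[X] (RatFunc F) g ≠ 0 := by simpa using hg
  have hb' : algebraMap F[X] (RatFunc F) b ≠ 0 := by simpa using hb
  have h' : algebraMap F[X] (RatFunc F) (g * b + t) ≠ 0 := by
    rwa [Ne, FaithfulSMul.algebraMap_eq_zero_iff]
  simp only [piFactor]
  rw [div_div, div_div, one_add_div (mul_ne_zero hg' hb'), one_add_div h',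
    one_add_div (mul_ne_zero hg' hb'), inv_div, inv_div, inv_div, ← map_mul, ← map_add,
    div_mul_div_cancel₀' h']
  congr 1
  rw [map_add]
  ring

theorem prod_piFin_div_add (x : RatFunc F) {g : F[X]} (hg : g.Monic) (d : ℕ) :
    (∏ t ∈ degLT F g.natDegree,
      piFin d ((x + algebraMap F[X] (RatFunc F) t) / algebraMap F[X] (RatFunc F) g)) *
        piFin g.natDegree x =
      piFin (d + g.natDegree) x * ∏ t ∈ degLT F g.natDegree,
        piFin d (algebraMap F[X] (RatFunc F) t / algebraMap F[X] (RatFunc F) g) := by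
  simp only [piFin]
  rw [← prod_monicLT_add d hg, mul_right_comm]
  congr 1
  rw [Finset.prod_comm, Finset.prod_comm (s := degLT F g.natDegree), ← Finset.prod_mul_distrib]
  refine Finset.prod_congr rfl fun b hb => ?_
  rw [← Finset.prod_mul_distrib]
  refine Finset.prod_congr rfl fun t ht => ?_
  have hb' := (mem_monicLT.1 hb).2
  refine piFactor_div_add x hg.ne_zero hb'.ne_zero (Monic.ne_zero ?_)
  refine (hg.mul hb').add_of_left ((mem_degLT.1 ht).trans_le ?_)
  rw [degree_mul, degree_eq_natDegree hg.ne_zero, degree_eq_natDegree hb'.ne_zero]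
  exact_mod_cast Nat.le_add_right _ _

theorem inftyAbs_div_polynomial_lt {x : RatFunc F} {g t : F[X]} (hg : g ≠ 0) 
    (hx : inftyAbs F x < 1) (ht : t.degree < g.natDegree) :
    inftyAbs F ((x + algebraMap F[X] (RatFunc F) t) / algebraMap F[X] (RatFunc F) g) < 1 := by
  have hq := one_lt_card_real (F := F)
  rw [map_div₀, inftyAbs_polynomial hg, div_lt_one (by positivity)]
  refine (inftyAbs_add_le_max F _ _).trans_lt (max_lt (hx.trans_le (one_le_pow₀ hq.le)) ?_)
  rcases eq_or_ne t 0 with rfl | h0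
  · rw [map_zero, map_zero]
    positivity
  · rw [inftyAbs_polynomial h0]
    rw [degree_eq_natDegree h0] at ht
    exact pow_lt_pow_right₀ hq (by exact_mod_cast ht)

theorem prod_Pi_div_add {x : RatFunc F} (hx : inftyAbs F x < 1) {g : F[X]} (hg : g.Monic) :
    (∏ t ∈ degLT F g.natDegree, Pi (algebraMap (RatFunc F) (CInfty F)
      ((x + algebraMap F[X] (RatFunc F) t) / algebraMap F[X] (RatFunc F) g))) *
        algebraMap (RatFunc F) (CInfty F) (piFin g.natDegree x) =
      Pi (algebraMap (RatFunc F) (CInfty F) x) * ∏ t ∈ degLT F g.natDegree,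
        Pi (algebraMap (RatFunc F) (CInfty F)
          (algebraMap F[X] (RatFunc F) t / algebraMap F[X] (RatFunc F) g)) := by
  have h0 : inftyAbs F (0 : RatFunc F) < 1 := by simp
  have h1 := (tendsto_finsetProd (degLT F g.natDegree) fun t ht =>
    tendsto_piFin (inftyAbs_div_polynomial_lt hg.ne_zero hx (mem_degLT.1 ht))).mul_const
      (algebraMap (RatFunc F) (CInfty F) (piFin g.natDegree x))
  have h2 := ((tendsto_piFin hx).comp (tendsto_add_atTop_nat g.natDegree)).mul
    (tendsto_finsetProd (degLT F g.natDegree) fun t ht => tendsto_piFin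
      (inftyAbs_div_polynomial_lt hg.ne_zero h0 (mem_degLT.1 ht)))
  simp only [zero_add] at h2
  refine tendsto_nhds_unique h1 (h2.congr fun d => ?_)
  rw [Function.comp_apply, ← map_prod, ← map_prod, ← map_mul, ← map_mul, prod_piFin_div_add x hg]

theorem Pi_zero : Pi (algebraMap (RatFunc F) (CInfty F) 0) = 1 := by
  simp [Pi]

/-- Grouping `t` by constant multiples turns the constant of the multiplication formula into a
product of values of `rho`, that is, a power of the period up to an algebraic factor. -/
theorem prod_Pi_div (g : F[X]) :
    ∏ t ∈ degLT F g.natDegree, Pi (algebraMap (RatFunc F) (CInfty F)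
        (algebraMap F[X] (RatFunc F) t / algebraMap F[X] (RatFunc F) g)) =
      ∏ t ∈ monicLT F g.natDegree,
        rho (algebraMap F[X] (RatFunc F) t / algebraMap F[X] (RatFunc F) g) := by
  rw [← Finset.mul_prod_erase _ _ (zero_mem_degLT _), map_zero, zero_div, Pi_zero, one_mul,
    ← prod_units_monicLT, Finset.prod_comm]
  refine Finset.prod_congr rfl fun t _ => Finset.prod_congr rfl fun θ _ => ?_
  rw [Algebra.smul_def, algebraMap_eq_poly_C, map_mul, mul_div_assoc]

/-- The multiplication formula for `Π`, up to factors that are algebraic over `k`. -/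
theorem isAlgebraic_prod_Pi_div {x y : RatFunc F} (hx : inftyAbs F x < 1) (hy : inftyAbs F y < 1)
    (hy0 : y ≠ 0) {g : F[X]} (hg : g.Monic) :
    IsAlgebraic (RatFunc F) ((∏ t ∈ degLT F g.natDegree, Pi (algebraMap (RatFunc F) (CInfty F)
      ((x + algebraMap F[X] (RatFunc F) t) / algebraMap F[X] (RatFunc F) g))) /
        (Pi (algebraMap (RatFunc F) (CInfty F) x) * rho y ^ (monicLT F g.natDegree).card)) := by
  have h1 := prod_Pi_div_add hx hg
  have h2 : algebraMap (RatFunc F) (CInfty F) (piFin g.natDegree x) ≠ 0 :=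
    (_root_.map_ne_zero _).2 (piFin_ne_zero hx _)
  rw [← eq_div_iff h2] at h1
  rw [h1, prod_Pi_div g]
  have h3 : ∀ P Q S T : CInfty F, P ≠ 0 → P * Q / S / (P * T) = S⁻¹ * (Q / T) := by
    intro P Q S T hP
    field_simp
  rw [h3 _ _ _ _ (Pi_ne_zero hx), ← Finset.prod_const, ← Finset.prod_div_distrib, ← map_inv₀]
  refine (isAlgebraic_algebraMap _).mul (mem_algebraicClosure_iff.1
    (prod_mem fun t ht => mem_algebraicClosure_iff.2 ?_))
  have h0 : inftyAbs F (0 : RatFunc F) < 1 := by simp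
  obtain ⟨ht1, ht2⟩ := mem_monicLT.1 ht
  refine isAlgebraic_rho_div (by simpa only [zero_add] using inftyAbs_div_polynomial_lt hg.ne_zero h0 ht1) hy ?_ hy0
  exact div_ne_zero (by simpa using ht2.ne_zero) (by simpa using hg.ne_zero)

end Multiplication

/-! ### Monic polynomials of fixed degree and the von Mangoldt identity -/

section MonicOfDegree

variable (F : Type*) [Field F] [Fintype F]

/-- The finite set of monic polynomials of degree `d`. -/
def monicEq (d : ℕ) : Finset F[X] := (degLT F d).map (addLeftEmbedding (X ^ d))

variable {F}

theorem mem_monicEq {d : ℕ} {a : F[X]} : a ∈ monicEq F d ↔ a.Monic ∧ a.natDegree = d := by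
  simp only [monicEq, Finset.mem_map, addLeftEmbedding_apply, mem_degLT]
  constructor
  · rintro ⟨t, ht, rfl⟩
    exact ⟨monic_X_pow_add ht, natDegree_eq_of_degree_eq_some (by
      rw [degree_add_eq_left_of_degree_lt (by rwa [degree_X_pow]), degree_X_pow])⟩
  · rintro ⟨ha, rfl⟩
    refine ⟨a - X ^ a.natDegree, ?_, by ring⟩
    rw [← degree_eq_natDegree ha.ne_zero]
    refine degree_sub_lt_left ?_ ha.ne_zero ?_
    · rw [degree_X_pow, degree_eq_natDegree ha.ne_zero]
    · rw [ha.leadingCoeff, leadingCoeff_X_pow]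

theorem sum_monicEq {M : Type*} [AddCommMonoid M] (d : ℕ) (φ : F[X] → M) :
    ∑ a ∈ monicEq F d, φ a = ∑ t ∈ degLT F d, φ (X ^ d + t) := by
  simp [monicEq]

theorem card_monicEq (d : ℕ) : (monicEq F d).card = Fintype.card F ^ d := by
  rw [monicEq, Finset.card_map, card_degLT]

theorem sum_monicEq_add {M : Type*} [AddCommMonoid M] (d : ℕ) {g : F[X]} (hg : g.Monic)
    (φ : F[X] → M) :
    ∑ a ∈ monicEq F (d + g.natDegree), φ a =
      ∑ b ∈ monicEq F d, ∑ t ∈ degLT F g.natDegree, φ (g * b + t) := by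
  rw [← Finset.sum_product']
  have hgd : g.degree = g.natDegree := degree_eq_natDegree hg.ne_zero
  symm
  refine Finset.sum_bij' (fun p _ => g * p.1 + p.2) (fun a _ => (a /ₘ g, a %ₘ g))
    ?_ ?_ ?_ ?_ ?_
  · rintro ⟨b, t⟩ h
    simp only [Finset.mem_product, mem_degLT, mem_monicEq] at h ⊢
    have h1 : t.degree < (g * b).degree := by
      rw [degree_mul]
      refine h.2.trans_le ?_
      rw [hgd, degree_eq_natDegree h.1.1.ne_zero]
      exact_mod_cast Nat.le_add_right _ _
    refine ⟨(hg.mul h.1.1).add_of_left h1, ?_⟩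
    rw [natDegree_add_eq_left_of_degree_lt h1, hg.natDegree_mul h.1.1, h.1.2, add_comm]
  · intro a h
    simp only [Finset.mem_product, mem_degLT, mem_monicEq] at h ⊢
    have h1 : g.degree ≤ a.degree := by
      rw [hgd, degree_eq_natDegree h.1.ne_zero, h.2]
      exact_mod_cast Nat.le_add_left _ _
    refine ⟨⟨?_, ?_⟩, (degree_modByMonic_lt a hg).trans_le hgd.le⟩
    · rw [Monic, leadingCoeff_divByMonic_of_monic hg h1, h.1]
    · rw [natDegree_divByMonic _ hg, h.2, Nat.add_sub_cancel]
  · rintro ⟨b, t⟩ h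
    simp only [Finset.mem_product, mem_degLT] at h
    have := div_modByMonic_unique (f := g * b + t) b t hg ⟨by ring, h.2.trans_le hgd.ge⟩
    simp [this.1, this.2]
  · intro a h
    simp only
    rw [add_comm, modByMonic_add_div]
  · simp

theorem sum_degLT_mk {f : F[X]} (hf : f.Monic) [Fintype (AdjoinRoot f)] {M : Type*}
    [AddCommMonoid M] (φ : AdjoinRoot f → M) :
    ∑ t ∈ degLT F f.natDegree, φ (AdjoinRoot.mk f t) = ∑ r, φ r := by
  refine Finset.sum_bij' (fun t _ => AdjoinRoot.mk f t)
    (fun r _ => AdjoinRoot.modByMonicHom hf r) (fun _ _ => Finset.mem_univ _) ?_ ?_ ?_ ?_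
  · intro r _
    obtain ⟨a, rfl⟩ := AdjoinRoot.mk_surjective r
    rw [AdjoinRoot.modByMonicHom_mk, mem_degLT, ← degree_eq_natDegree hf.ne_zero]
    exact degree_modByMonic_lt _ hf
  · intro t ht
    rw [mem_degLT, ← degree_eq_natDegree hf.ne_zero] at ht
    rw [AdjoinRoot.modByMonicHom_mk, (modByMonic_eq_self_iff hf).2 ht]
  · intro r _
    exact AdjoinRoot.mk_leftInverse hf r
  · simp

open Classical in
/-- Pairs of a monic irreducible polynomial of degree at most `m` and an exponent between `1`
and `m`. -/
def primePowers (F : Type*) [Field F] [Fintype F] (m : ℕ) : Finset (F[X] × ℕ) :=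
  ((monicLT F (m + 1)).filter Irreducible) ×ˢ Finset.Icc 1 m

theorem mem_primePowers {m : ℕ} {P : F[X] × ℕ} : P ∈ primePowers F m ↔
    (P.1.Monic ∧ Irreducible P.1 ∧ P.1.natDegree ≤ m) ∧ 1 ≤ P.2 ∧ P.2 ≤ m := by
  simp only [primePowers, Finset.mem_product, Finset.mem_filter, mem_monicLT, Finset.mem_Icc]
  constructor
  · rintro ⟨⟨⟨h1, h2⟩, h3⟩, h4⟩
    rw [degree_eq_natDegree h2.ne_zero] at h1
    exact ⟨⟨h2, h3, by norm_cast at h1; omega⟩, h4⟩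
  · rintro ⟨⟨h1, h2, h3⟩, h4⟩
    refine ⟨⟨⟨?_, h1⟩, h2⟩, h4⟩
    rw [degree_eq_natDegree h1.ne_zero]
    norm_cast
    omega

open Classical in
/-- Every monic polynomial of degree `m` satisfies `∑ Λ(b) = m`, the sum being over its monic
divisors and `Λ` being the analogue of the von Mangoldt function. -/
theorem sum_natDegree_primePowers_dvd {m : ℕ} {a : F[X]} (ha : a ∈ monicEq F m) :
    ∑ P ∈ primePowers F m with P.1 ^ P.2 ∣ a, P.1.natDegree = m := by
  obtain ⟨ha1, ha2⟩ := mem_monicEq.1 ha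
  have ha0 := ha1.ne_zero
  open UniqueFactorizationMonoid in
  have hcount : ∀ P : F[X], P.Monic → Irreducible P → ∀ j, P ^ j ∣ a ↔
      j ≤ (normalizedFactors a).count P := by
    intro P hP hP' j
    rw [pow_dvd_iff_le_emultiplicity, emultiplicity_eq_count_normalizedFactors hP' ha0,
      hP.normalize_eq_self, Nat.cast_le]
  have hle : ∀ P : F[X], (UniqueFactorizationMonoid.normalizedFactors a).count P ≤ m := by
    intro P
    by_cases hmem : P ∈ UniqueFactorizationMonoid.normalizedFactors a
    · have hirr := UniqueFactorizationMonoid.irreducible_of_normalized_factor P hmem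
      have hmon : P.Monic := by
        have h1 := UniqueFactorizationMonoid.normalize_normalized_factor P hmem
        rw [← h1]
        exact monic_normalize hirr.ne_zero
      have h2 := natDegree_le_of_dvd ((hcount P hmon hirr _).2 le_rfl) ha0
      rw [natDegree_pow, ha2] at h2
      exact (Nat.le_mul_of_pos_right _ hirr.natDegree_pos).trans h2
    · rw [Multiset.count_eq_zero_of_notMem hmem]
      exact Nat.zero_le _
  rw [Finset.sum_filter, primePowers, Finset.sum_product]
  have h1 : ∀ P ∈ (monicLT F (m + 1)).filter Irreducible,
      (∑ j ∈ Finset.Icc 1 m, if P ^ j ∣ a then P.natDegree else 0) =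
        (UniqueFactorizationMonoid.normalizedFactors a).count P * P.natDegree := by
    intro P hP
    simp only [Finset.mem_filter, mem_monicLT] at hP
    rw [← Finset.sum_filter, Finset.sum_const, smul_eq_mul]
    congr 1
    have : (Finset.Icc 1 m).filter (fun j => P ^ j ∣ a) =
        Finset.Icc 1 ((UniqueFactorizationMonoid.normalizedFactors a).count P) := by
      ext j
      simp only [Finset.mem_filter, Finset.mem_Icc, hcount P hP.1.2 hP.2]
      have := hle P
      omega
    rw [this, Nat.card_Icc, Nat.add_sub_cancel]
  rw [Finset.sum_congr rfl h1]
  have hprod : (UniqueFactorizationMonoid.normalizedFactors a).prod = a := by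
    have h := UniqueFactorizationMonoid.prod_normalizedFactors_eq ha0
    rwa [ha1.normalize_eq_self] at h
  have hmon : ∀ P ∈ UniqueFactorizationMonoid.normalizedFactors a, P.Monic := by
    intro P hmem
    rw [← UniqueFactorizationMonoid.normalize_normalized_factor P hmem]
    exact monic_normalize (UniqueFactorizationMonoid.irreducible_of_normalized_factor P hmem).ne_zero
  have h2 := natDegree_multiset_prod_of_monic _ hmon
  rw [hprod, ha2, Finset.sum_multiset_map_count] at h2
  refine Eq.trans ?_ h2.symm
  simp only [smul_eq_mul]
  symm
  refine Finset.sum_subset ?_ fun P _ hP => ?_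
  · intro P hP
    rw [Multiset.mem_toFinset] at hP
    have hirr := UniqueFactorizationMonoid.irreducible_of_normalized_factor P hP
    rw [Finset.mem_filter, mem_monicLT]
    refine ⟨⟨?_, hmon P hP⟩, hirr⟩
    have h3 := natDegree_le_of_dvd (UniqueFactorizationMonoid.dvd_of_mem_normalizedFactors hP) ha0
    rw [degree_eq_natDegree hirr.ne_zero]
    norm_cast
    omega
  · rw [Multiset.mem_toFinset] at hP
    rw [Multiset.count_eq_zero_of_notMem hP, zero_mul]

end MonicOfDegree

/-! ### `L`-series of characters modulo `f` and their logarithmic derivatives -/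

section LSeries

variable {F : Type*} [Field F] [Fintype F] {f : F[X]}

/-- The coefficients of the `L`-series of `χ` in powers of `q⁻ˢ`. -/
def lCoeff (χ : MulChar (AdjoinRoot f) ℂ) (m : ℕ) : ℂ :=
  ∑ a ∈ monicEq F m, χ (AdjoinRoot.mk f a)

open Classical in
/-- The coefficients of the logarithmic derivative of the `L`-series of `χ`. -/
def logCoeff (χ : MulChar (AdjoinRoot f) ℂ) (m : ℕ) : ℂ :=
  ∑ P ∈ primePowers F m with P.2 * P.1.natDegree = m,
    (P.1.natDegree : ℂ) * χ (AdjoinRoot.mk f (P.1 ^ P.2))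

open Classical in
theorem logCoeff_eq (χ : MulChar (AdjoinRoot f) ℂ) {k m : ℕ} (hkm : k ≤ m) :
    logCoeff χ k = ∑ P ∈ primePowers F m with P.2 * P.1.natDegree = k,
      (P.1.natDegree : ℂ) * χ (AdjoinRoot.mk f (P.1 ^ P.2)) := by
  rw [logCoeff]
  refine Finset.sum_congr ?_ fun _ _ => rfl
  ext P
  simp only [Finset.mem_filter, mem_primePowers]
  constructor
  · rintro ⟨⟨⟨h1, h2, h3⟩, h4, h5⟩, h6⟩
    exact ⟨⟨⟨h1, h2, by omega⟩, h4, by omega⟩, h6⟩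
  · rintro ⟨⟨⟨h1, h2, h3⟩, h4, h5⟩, h6⟩
    have := h2.natDegree_pos
    exact ⟨⟨⟨h1, h2, by nlinarith⟩, h4, by nlinarith⟩, h6⟩

/-- Coefficientwise form of `X L' = (log-derivative) · L`: expand `m` as the sum of `deg P` over
prime powers `P ^ j ∣ a` and write `a = P ^ j * c`. -/
theorem mul_lCoeff (χ : MulChar (AdjoinRoot f) ℂ) (m : ℕ) :
    (m : ℂ) * lCoeff χ m =
      ∑ p ∈ Finset.HasAntidiagonal.antidiagonal m, logCoeff χ p.1 * lCoeff χ p.2 := by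
  classical
  have h1 : ∀ p ∈ Finset.HasAntidiagonal.antidiagonal m, logCoeff χ p.1 * lCoeff χ p.2 =
      ∑ P ∈ primePowers F m, if P.2 * P.1.natDegree = p.1 then
        (P.1.natDegree : ℂ) * ∑ c ∈ monicEq F p.2, χ (AdjoinRoot.mk f (P.1 ^ P.2 * c)) else 0 := by
    intro p hp
    rw [Finset.HasAntidiagonal.mem_antidiagonal] at hp
    rw [logCoeff_eq χ (m := m) (by omega), Finset.sum_filter, Finset.sum_mul]
    refine Finset.sum_congr rfl fun P _ => ?_
    split_ifs
    · rw [lCoeff, mul_assoc, Finset.mul_sum]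
      simp only [map_mul]
    · rw [zero_mul]
  have h2 : ∀ P ∈ primePowers F m, (∑ p ∈ Finset.HasAntidiagonal.antidiagonal m,
      if P.2 * P.1.natDegree = p.1 then
        (P.1.natDegree : ℂ) * ∑ c ∈ monicEq F p.2, χ (AdjoinRoot.mk f (P.1 ^ P.2 * c)) else 0) =
      (P.1.natDegree : ℂ) * ∑ a ∈ monicEq F m,
        if P.1 ^ P.2 ∣ a then χ (AdjoinRoot.mk f a) else 0 := by
    intro P hP
    obtain ⟨⟨hP1, hP2, hP3⟩, hP4, hP5⟩ := mem_primePowers.1 hP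
    by_cases hle : P.2 * P.1.natDegree ≤ m
    · rw [Finset.sum_eq_single (P.2 * P.1.natDegree, m - P.2 * P.1.natDegree)]
      · rw [if_pos rfl, ← Finset.sum_filter]
        congr 1
        refine Finset.sum_bij (fun c _ => P.1 ^ P.2 * c) ?_ ?_ ?_ ?_
        · intro c hc
          rw [mem_monicEq] at hc
          rw [Finset.mem_filter, mem_monicEq, (hP1.pow _).natDegree_mul hc.1, hc.2,
            natDegree_pow]
          exact ⟨⟨(hP1.pow _).mul hc.1, by simp only; omega⟩, dvd_mul_right _ _⟩
        · intro c _ c' _ h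
          exact mul_left_cancel₀ (hP1.pow _).ne_zero h
        · intro a ha
          rw [Finset.mem_filter, mem_monicEq] at ha
          obtain ⟨⟨ha1, ha2⟩, c, rfl⟩ := ha
          have hc : c.Monic := (hP1.pow _).of_mul_monic_left ha1
          rw [(hP1.pow _).natDegree_mul hc, natDegree_pow] at ha2
          exact ⟨c, mem_monicEq.2 ⟨hc, by simp only; omega⟩, rfl⟩
        · intro c _
          rfl
      · intro p hp hne
        rw [Finset.HasAntidiagonal.mem_antidiagonal] at hp
        refine if_neg fun h => hne ?_
        refine Prod.ext h.symm ?_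
        simp only
        omega
      · intro h
        exact absurd (Finset.HasAntidiagonal.mem_antidiagonal.2 (by simp only; omega)) h
    · rw [Finset.sum_eq_zero, Finset.sum_eq_zero, mul_zero]
      · intro a ha
        rw [mem_monicEq] at ha
        refine if_neg fun h => hle ?_
        have := natDegree_le_of_dvd h ha.1.ne_zero
        rwa [natDegree_pow, ha.2] at this
      · intro p hp
        rw [Finset.HasAntidiagonal.mem_antidiagonal] at hp
        exact if_neg (by omega)
  rw [Finset.sum_congr rfl h1, Finset.sum_comm, Finset.sum_congr rfl h2]
  simp only [Finset.mul_sum]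
  rw [Finset.sum_comm, lCoeff, Finset.mul_sum]
  refine Finset.sum_congr rfl fun a ha => ?_
  have h3 := congrArg (Nat.cast (R := ℂ)) (sum_natDegree_primePowers_dvd ha)
  rw [← h3, Nat.cast_sum, Finset.sum_filter, Finset.sum_mul]
  refine Finset.sum_congr rfl fun P _ => ?_
  split_ifs <;> simp

end LSeries

/-! ### Nonvanishing of `L(1, χ)` -/

section Nonvanishing

open ComplexOrder

variable {F : Type*} [Field F] [Fintype F] {f : F[X]}

theorem finite_adjoinRoot (hf : f.Monic) : Finite (AdjoinRoot f) :=
  have : Finite (degreeLT F f.natDegree) := Finite.of_equiv _ (degreeLTEquiv F _).symm.toEquiv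
  Finite.of_injective (β := degreeLT F f.natDegree) (fun r => ⟨AdjoinRoot.modByMonicHom hf r, by
    obtain ⟨a, rfl⟩ := AdjoinRoot.mk_surjective r
    rw [AdjoinRoot.modByMonicHom_mk, mem_degreeLT, ← degree_eq_natDegree hf.ne_zero]
    exact degree_modByMonic_lt _ hf⟩) fun r s h =>
      (AdjoinRoot.mk_leftInverse hf).injective (congrArg Subtype.val h)

theorem sum_mulChar_eq_zero {M : Type*} [CommMonoid M] [Finite M] [Fintype (MulChar M ℂ)] {x : M}
    (hx : x ≠ 1) : ∑ χ : MulChar M ℂ, χ x = 0 := by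
  obtain ⟨χ, hχ⟩ := MulChar.exists_apply_ne_one_of_hasEnoughRootsOfUnity M ℂ hx
  refine eq_zero_of_mul_eq_self_left hχ ?_
  simp only [Finset.mul_sum, ← MulChar.mul_apply]
  exact Fintype.sum_bijective _ (Group.mulLeft_bijective χ) _ _ fun χ' => rfl

theorem sum_mulChar_nonneg {M : Type*} [CommMonoid M] [Finite M] [Fintype (MulChar M ℂ)] (x : M) :
    0 ≤ ∑ χ : MulChar M ℂ, χ x := by
  by_cases hx : x = 1
  · simp [hx]
  · rw [sum_mulChar_eq_zero hx]

/-- From degree `deg f` on, monic polynomials are equidistributed modulo `f`. So a nontrivial `χ`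
has a polynomial `L`-series, and the trivial one has eventually geometric coefficients of ratio `q`.
-/
theorem lCoeff_add (hf : f.Monic) [Fintype (AdjoinRoot f)] (χ : MulChar (AdjoinRoot f) ℂ) (d : ℕ) :
    lCoeff χ (d + f.natDegree) = (Fintype.card F : ℂ) ^ d * ∑ r, χ r := by
  rw [lCoeff, sum_monicEq_add d hf, ← sum_degLT_mk hf]
  simp [card_monicEq]

theorem lCoeff_zero (χ : MulChar (AdjoinRoot f) ℂ) : lCoeff χ 0 = 1 := by
  rw [lCoeff, sum_monicEq]
  have : degLT F 0 = {0} := by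
    ext a
    rw [mem_degLT, Finset.mem_singleton]
    simp
  simp [this]

/-- The `L`-series of `χ` as a formal power series in `q⁻ˢ`. -/
def lSeries (χ : MulChar (AdjoinRoot f) ℂ) : PowerSeries ℂ := PowerSeries.mk (lCoeff χ)

/-- The logarithmic derivative of the `L`-series of `χ`. -/
def logSeries (χ : MulChar (AdjoinRoot f) ℂ) : PowerSeries ℂ := PowerSeries.mk (logCoeff χ)

theorem coeff_X_mul_derivative (s : PowerSeries ℂ) (m : ℕ) :
    PowerSeries.coeff m (PowerSeries.X * PowerSeries.derivative ℂ s) =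
      m * PowerSeries.coeff m s := by
  cases m with
  | zero => simp
  | succ m =>
    rw [PowerSeries.coeff_succ_X_mul, PowerSeries.coeff_derivative]
    push_cast
    ring

theorem X_mul_derivative_lSeries (χ : MulChar (AdjoinRoot f) ℂ) :
    PowerSeries.X * PowerSeries.derivative ℂ (lSeries χ) = logSeries χ * lSeries χ := by
  ext m
  rw [coeff_X_mul_derivative, PowerSeries.coeff_mul, lSeries, PowerSeries.coeff_mk, mul_lCoeff]
  simp [logSeries]

theorem X_mul_derivative_prod_lSeries (s : Finset (MulChar (AdjoinRoot f) ℂ)) :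
    PowerSeries.X * PowerSeries.derivative ℂ (∏ χ ∈ s, lSeries χ) =
      (∑ χ ∈ s, logSeries χ) * ∏ χ ∈ s, lSeries χ := by
  classical
  induction s using Finset.induction_on with
  | empty => simp
  | insert χ s hχ ih =>
    rw [Finset.prod_insert hχ, Finset.sum_insert hχ, Derivation.leibniz, smul_eq_mul, smul_eq_mul]
    linear_combination lSeries χ * ih + (∏ ψ ∈ s, lSeries ψ) * X_mul_derivative_lSeries χ

/-- By orthogonality the summed logarithmic derivative has nonnegative coefficients, and the
recursion `X H' = (∑ log-derivatives) H` with `H(0) = 1` passes this on to the product `H`. The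
second bound keeps only the term `(m, 0)` of the convolution. -/
theorem prod_lSeries_coeff [Finite (AdjoinRoot f)] [Fintype (MulChar (AdjoinRoot f) ℂ)] (m : ℕ) :
    0 ≤ PowerSeries.coeff m (∏ χ : MulChar (AdjoinRoot f) ℂ, lSeries χ) ∧
      ∑ χ : MulChar (AdjoinRoot f) ℂ, logCoeff χ m ≤
        m * PowerSeries.coeff m (∏ χ : MulChar (AdjoinRoot f) ℂ, lSeries χ) := by
  set H := ∏ χ : MulChar (AdjoinRoot f) ℂ, lSeries χ with hH
  have hlog : ∀ k, 0 ≤ ∑ χ : MulChar (AdjoinRoot f) ℂ, logCoeff χ k := by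
    intro k
    simp only [logCoeff]
    rw [Finset.sum_comm]
    refine Finset.sum_nonneg fun P _ => ?_
    rw [← Finset.mul_sum]
    exact mul_nonneg (Nat.cast_nonneg _) (sum_mulChar_nonneg _)
  have h0 : PowerSeries.coeff 0 H = 1 := by
    rw [PowerSeries.coeff_zero_eq_constantCoeff_apply, hH, map_prod]
    refine Finset.prod_eq_one fun χ _ => ?_
    rw [← PowerSeries.coeff_zero_eq_constantCoeff_apply, lSeries, PowerSeries.coeff_mk, lCoeff_zero]
  have hrec : ∀ k : ℕ, (k : ℂ) * PowerSeries.coeff k H = ∑ p ∈ Finset.HasAntidiagonal.antidiagonal k,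
      (∑ χ : MulChar (AdjoinRoot f) ℂ, logCoeff χ p.1) * PowerSeries.coeff p.2 H := by
    intro k
    rw [← coeff_X_mul_derivative, hH, X_mul_derivative_prod_lSeries, PowerSeries.coeff_mul]
    simp [logSeries]
  have hlog0 : ∀ χ : MulChar (AdjoinRoot f) ℂ, logCoeff χ 0 = 0 := by
    intro χ
    refine Finset.sum_eq_zero fun P hP => ?_
    have := (mem_primePowers.1 (Finset.mem_filter.1 hP).1).2
    omega
  have hpos : ∀ k, 0 ≤ PowerSeries.coeff k H := by
    intro k
    induction k using Nat.strong_induction_on with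
    | _ k ih =>
      rcases Nat.eq_zero_or_pos k with rfl | hk
      · rw [h0]
        exact zero_le_one
      · have h1 : 0 ≤ (k : ℂ) * PowerSeries.coeff k H := by
          rw [hrec]
          refine Finset.sum_nonneg fun p hp => ?_
          rw [Finset.HasAntidiagonal.mem_antidiagonal] at hp
          rcases Nat.eq_zero_or_pos p.1 with h | h
          · simp [h, hlog0]
          · exact mul_nonneg (hlog _) (ih _ (by omega))
        have hk' : (k : ℂ) ≠ 0 := by exact_mod_cast hk.ne'
        have h2 : PowerSeries.coeff k H = ((k⁻¹ : ℝ) : ℂ) * ((k : ℂ) * PowerSeries.coeff k H) := by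
          push_cast
          rw [inv_mul_cancel_left₀ hk']
        rw [h2]
        refine mul_nonneg ?_ h1
        rw [Complex.zero_le_real]
        positivity
  refine ⟨hpos m, ?_⟩
  rw [hrec]
  have hmem : (m, 0) ∈ Finset.HasAntidiagonal.antidiagonal m :=
    Finset.HasAntidiagonal.mem_antidiagonal.2 (add_zero m)
  refine le_trans ?_ (Finset.single_le_sum (fun p _ => mul_nonneg (hlog p.1) (hpos p.2)) hmem)
  simp [h0]

omit [Fintype F] in
theorem exists_irreducible_coprime (hf : f.Monic) (hdeg : 0 < f.natDegree) :
    ∃ P : F[X], P.Monic ∧ Irreducible P ∧ IsUnit (AdjoinRoot.mk f P) := by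
  -- Every irreducible factor of `X * f + 1` is prime to `f`.
  have h0 : ¬IsUnit (X * f + 1) := by
    intro h
    have h1 : (X * f + 1).natDegree = 1 + f.natDegree := by
      rw [natDegree_add_eq_left_of_natDegree_lt, natDegree_mul X_ne_zero hf.ne_zero, natDegree_X]
      rw [natDegree_one, natDegree_mul X_ne_zero hf.ne_zero, natDegree_X]
      omega
    have := natDegree_eq_zero_of_isUnit h
    omega
  obtain ⟨P, hP, hirr, Q, hQ⟩ := exists_monic_irreducible_factor _ h0
  refine ⟨P, hP, hirr, IsUnit.of_mul_eq_one (AdjoinRoot.mk f Q) ?_⟩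
  rw [← map_mul, ← hQ, map_add, map_mul, AdjoinRoot.mk_self, mul_zero, zero_add, map_one]

/-- If `P` is a prime not dividing `f` and `e` is a multiple of `#(A/f)ˣ`, then `P ^ e ≡ 1`, so
every `χ` contributes positively in degree `e * deg P`; such degrees are unbounded. -/
theorem one_le_sum_logCoeff (hf : f.Monic) (hdeg : 0 < f.natDegree)
    [Fintype (MulChar (AdjoinRoot f) ℂ)] (N : ℕ) :
    ∃ m, N < m ∧ 1 ≤ ∑ χ : MulChar (AdjoinRoot f) ℂ, logCoeff χ m := by
  have : Finite (AdjoinRoot f) := finite_adjoinRoot hf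
  obtain ⟨P, hP, hirr, u, hu⟩ := exists_irreducible_coprime hf hdeg
  have hd := hirr.natDegree_pos
  have he : 0 < Nat.card (AdjoinRoot f)ˣ := Nat.card_pos
  set e := Nat.card (AdjoinRoot f)ˣ * (N + 1) with he'
  have heN : N + 1 ≤ e := Nat.le_mul_of_pos_left _ he
  have hed : e ≤ e * P.natDegree := Nat.le_mul_of_pos_right _ hd
  refine ⟨e * P.natDegree, by omega, ?_⟩
  simp only [logCoeff]
  rw [Finset.sum_comm]
  have hmem : (P, e) ∈ (primePowers F (e * P.natDegree)).filter
      fun Q => Q.2 * Q.1.natDegree = e * P.natDegree := by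
    rw [Finset.mem_filter, mem_primePowers]
    exact ⟨⟨⟨hP, hirr, Nat.le_mul_of_pos_left _ (by omega)⟩, by omega, hed⟩, rfl⟩
  refine le_trans ?_ (Finset.single_le_sum (fun Q _ => ?_) hmem)
  · have h1 : AdjoinRoot.mk f (P ^ e) = 1 := by
      rw [map_pow, ← hu, ← Units.val_pow_eq_pow_val, he', pow_mul, pow_card_eq_one', one_pow,
        Units.val_one]
    have h2 : 1 ≤ P.natDegree * Fintype.card (MulChar (AdjoinRoot f) ℂ) :=
      Nat.mul_pos hd Fintype.card_pos
    simp only [h1, MulChar.map_one, Finset.sum_const, Finset.card_univ, nsmul_eq_mul, mul_one]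
    rw [mul_comm]
    exact_mod_cast h2
  · rw [← Finset.mul_sum]
    exact mul_nonneg (Nat.cast_nonneg _) (sum_mulChar_nonneg _)

theorem exists_coe_eq_of_coeff_eq_zero {s : PowerSeries ℂ} {N : ℕ}
    (h : ∀ m, N ≤ m → PowerSeries.coeff m s = 0) : ∃ p : ℂ[X], (p : PowerSeries ℂ) = s := by
  refine ⟨PowerSeries.trunc N s, ?_⟩
  ext m
  rw [coeff_coe, PowerSeries.coeff_trunc]
  split_ifs with hm
  · rfl
  · exact (h m (not_lt.1 hm)).symm

/-- The `L`-value of a nontrivial character at `s = 1` does not vanish. -/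
theorem sum_lCoeff_ne_zero (hf : f.Monic) (hdeg : 0 < f.natDegree) {χ : MulChar (AdjoinRoot f) ℂ}
    (hχ : χ ≠ 1) :
    ∑ m ∈ Finset.range f.natDegree, lCoeff χ m * ((Fintype.card F : ℂ)⁻¹) ^ m ≠ 0 := by
  classical
  intro h
  have : Finite (AdjoinRoot f) := finite_adjoinRoot hf
  have : Fintype (AdjoinRoot f) := Fintype.ofFinite _
  have : Fintype (MulChar (AdjoinRoot f) ℂ) := Fintype.ofFinite _
  set z : ℂ := (Fintype.card F : ℂ)⁻¹ with hz
  have hq : (Fintype.card F : ℂ) ≠ 0 := by exact_mod_cast Fintype.card_ne_zero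
  have hvan : ∀ ψ : MulChar (AdjoinRoot f) ℂ, ψ ≠ 1 → ∀ m, f.natDegree ≤ m → lCoeff ψ m = 0 := by
    intro ψ hψ m hm
    obtain ⟨d, rfl⟩ := Nat.exists_eq_add_of_le' hm
    rw [lCoeff_add hf, MulChar.sum_eq_zero_of_ne_one hψ, mul_zero]
  have hpoly : ∀ ψ : MulChar (AdjoinRoot f) ℂ, ψ ≠ 1 →
      ∃ p : ℂ[X], (p : PowerSeries ℂ) = lSeries ψ := fun ψ hψ =>
    exists_coe_eq_of_coeff_eq_zero (N := f.natDegree) fun m hm => by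
      rw [lSeries, PowerSeries.coeff_mk, hvan ψ hψ m hm]
  obtain ⟨p, hp⟩ := hpoly χ hχ
  have hroot : p.IsRoot z := by
    have hcoeff : ∀ m, p.coeff m = lCoeff χ m := by
      intro m
      rw [← coeff_coe, hp, lSeries, PowerSeries.coeff_mk]
    have hdegp : p.natDegree < f.natDegree := by
      by_contra! hle
      have hlead : p.leadingCoeff = 0 := by rw [leadingCoeff, hcoeff, hvan χ hχ _ hle]
      rw [leadingCoeff_eq_zero.1 hlead, natDegree_zero] at hle
      omega
    rw [IsRoot, eval_eq_sum_range' hdegp, ← h]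
    simp only [hcoeff]
  -- The assumed zero at `1 / q` cancels the only pole of the product of all `L`-series, which comes
  -- from the trivial character. The product is then a polynomial, and its vanishing coefficients in
  -- high degree contradict `one_le_sum_logCoeff`. Real and complex characters need no separate
  -- treatment.
  obtain ⟨p₁, hp₁⟩ := dvd_iff_isRoot.2 hroot
  obtain ⟨p₂, hp₂⟩ : ∃ p₂ : ℂ[X], (p₂ : PowerSeries ℂ) =
      (lSeries (1 : MulChar (AdjoinRoot f) ℂ)) * ((X - C z : ℂ[X]) : PowerSeries ℂ) := by
    refine exists_coe_eq_of_coeff_eq_zero (N := f.natDegree + 1) fun m hm => ?_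
    obtain ⟨d, rfl⟩ := Nat.exists_eq_add_of_le' hm
    rw [coe_sub, mul_sub, map_sub, coe_X, coe_C, PowerSeries.coeff_mul_C, ← add_assoc,
      PowerSeries.coeff_succ_mul_X, lSeries, PowerSeries.coeff_mk, PowerSeries.coeff_mk,
      add_right_comm, lCoeff_add hf, lCoeff_add hf, pow_succ, hz]
    field_simp
    ring
  have hrest : ∀ s : Finset (MulChar (AdjoinRoot f) ℂ), (∀ ψ ∈ s, ψ ≠ 1) →
      ∃ p : ℂ[X], (p : PowerSeries ℂ) = ∏ ψ ∈ s, lSeries ψ := by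
    intro s hs
    induction s using Finset.induction_on with
    | empty => exact ⟨1, by simp⟩
    | insert ψ s hψ ih =>
      obtain ⟨p, hp⟩ := ih fun ψ' h' => hs ψ' (Finset.mem_insert_of_mem h')
      obtain ⟨r, hr⟩ := hpoly ψ (hs ψ (Finset.mem_insert_self _ _))
      exact ⟨r * p, by rw [Finset.prod_insert hψ, coe_mul, hr, hp]⟩
  obtain ⟨p₃, hp₃⟩ := hrest ((Finset.univ.erase 1).erase χ) fun ψ hψ => by
    simp only [Finset.mem_erase] at hψ
    exact hψ.2.1
  have hH : ((p₂ * p₁ * p₃ : ℂ[X]) : PowerSeries ℂ) =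
      ∏ ψ : MulChar (AdjoinRoot f) ℂ, lSeries ψ := by
    rw [← Finset.mul_prod_erase _ _ (Finset.mem_univ (1 : MulChar (AdjoinRoot f) ℂ)),
      ← Finset.mul_prod_erase _ _ (Finset.mem_erase.2 ⟨hχ, Finset.mem_univ χ⟩), coe_mul, coe_mul,
      hp₂, hp₃, ← hp, hp₁, coe_mul]
    ring
  obtain ⟨m, hm, hm'⟩ := one_le_sum_logCoeff hf hdeg (p₂ * p₁ * p₃).natDegree
  have h1 := (prod_lSeries_coeff (f := f) m).2
  rw [← hH, coeff_coe, coeff_eq_zero_of_natDegree_lt hm, mul_zero] at h1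
  exact (zero_lt_one (α := ℂ)).not_ge (hm'.trans h1)

end Nonvanishing

/-! ### Distributions on `A/f` and the monic indicator function -/

section Distributions

variable {F : Type*} [Field F] [Fintype F] {f : F[X]}

theorem sum_degLT_add {M : Type*} [AddCommMonoid M] (d : ℕ) {g : F[X]} (hg : g.Monic)
    (φ : F[X] → M) :
    ∑ a ∈ degLT F (d + g.natDegree), φ a =
      ∑ b ∈ degLT F d, ∑ t ∈ degLT F g.natDegree, φ (g * b + t) := by
  have h1 : ∑ a ∈ degLT F (d + g.natDegree), φ a =
      ∑ a ∈ monicEq F (d + g.natDegree), φ (a - g * X ^ d) := by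
    symm
    refine Finset.sum_bij' (fun a _ => a - g * X ^ d) (fun a _ => a + g * X ^ d) ?_ ?_ ?_ ?_ ?_
    · intro a ha
      rw [mem_monicEq] at ha
      have hgX : (g * X ^ d).Monic := hg.mul (monic_X_pow d)
      have h2 : (g * X ^ d).natDegree = d + g.natDegree := by
        rw [hg.natDegree_mul (monic_X_pow d), natDegree_X_pow, add_comm]
      rw [mem_degLT, ← ha.2, ← degree_eq_natDegree ha.1.ne_zero]
      refine degree_sub_lt_left ?_ ha.1.ne_zero (by rw [ha.1.leadingCoeff, hgX.leadingCoeff])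
      rw [degree_eq_natDegree ha.1.ne_zero, degree_eq_natDegree hgX.ne_zero, h2, ha.2]
    · intro a ha
      rw [mem_degLT] at ha
      have hgX : (g * X ^ d).Monic := hg.mul (monic_X_pow d)
      have h2 : (g * X ^ d).natDegree = d + g.natDegree := by
        rw [hg.natDegree_mul (monic_X_pow d), natDegree_X_pow, add_comm]
      have h3 : a.degree < (g * X ^ d).degree := by
        rw [degree_eq_natDegree hgX.ne_zero, h2]
        exact ha
      rw [mem_monicEq, add_comm a]
      exact ⟨hgX.add_of_left h3, by rw [natDegree_add_eq_left_of_degree_lt h3, h2]⟩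
    · simp
    · simp
    · simp
  rw [h1, sum_monicEq_add d hg, sum_monicEq]
  refine Finset.sum_congr rfl fun b _ => Finset.sum_congr rfl fun t _ => ?_
  congr 1
  ring

/-- Modulo `f = g h` the product `h * r` depends only on `r` modulo `g`, so each value is hit `q ^
deg h` times; a shift of `r` replaces `a` by its remainder. -/
theorem sum_add_mk_mul [Fintype (AdjoinRoot f)] {g h : F[X]} (hg : g.Monic) (hh : h.Monic)
    (hgh : g * h = f) {M : Type*} [AddCommMonoid M] (φ : AdjoinRoot f → M) (a : F[X]) :
    ∑ r, φ (AdjoinRoot.mk f a + AdjoinRoot.mk f h * r) =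
      (Fintype.card F ^ h.natDegree) • ∑ t ∈ degLT F g.natDegree,
        φ (AdjoinRoot.mk f (a %ₘ h + h * t)) := by
  have hf : f.Monic := hgh ▸ hg.mul hh
  have h0 : AdjoinRoot.mk f h * AdjoinRoot.mk f g = 0 := by
    rw [← map_mul, mul_comm, hgh, AdjoinRoot.mk_self]
  have h1 : ∑ r, φ (AdjoinRoot.mk f a + AdjoinRoot.mk f h * r) =
      ∑ r, φ (AdjoinRoot.mk f (a %ₘ h) + AdjoinRoot.mk f h * r) := by
    refine Fintype.sum_equiv (Equiv.addLeft (AdjoinRoot.mk f (a /ₘ h))) _ _ fun r => ?_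
    congr 1
    have := congrArg (AdjoinRoot.mk f) (modByMonic_add_div a h)
    rw [map_add, map_mul] at this
    rw [Equiv.coe_addLeft, mul_add, ← add_assoc, this]
  have hn : f.natDegree = h.natDegree + g.natDegree := by
    rw [← hgh, hg.natDegree_mul hh, add_comm]
  rw [h1, ← sum_degLT_mk hf, hn, sum_degLT_add _ hg, ← card_degLT, ← Finset.sum_const]
  refine Finset.sum_congr rfl fun b _ => Finset.sum_congr rfl fun t _ => ?_
  rw [map_add, map_add, map_mul, map_mul, mul_add, ← mul_assoc, h0, zero_mul, zero_add]

open Classical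

/-- The functions on `A / f` that satisfy the functional equations of `Π`, the reflection formula
and the multiplication formula, in additive form; `c` stands for the period. -/
structure IsDistribution [Fintype (AdjoinRoot f)] (φ : AdjoinRoot f → ℂ) (c : ℂ) : Prop where
  map_zero : φ 0 = 0
  reflection : ∀ x ≠ 0, ∑ θ : Fˣ, φ (AdjoinRoot.mk f (C (θ : F)) * x) = c
  multiplication : ∀ g h : F[X], g.Monic → h.Monic → g * h = f → ∀ y,
    ∑ r, φ (y + AdjoinRoot.mk f h * r) = (Fintype.card F : ℂ) ^ h.natDegree *
      (φ (AdjoinRoot.mk f g * y) + (monicLT F g.natDegree).card * c)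

section Closure

variable [Fintype (AdjoinRoot f)]

theorem IsDistribution.sum {ι : Type*} (s : Finset ι) (k : ι → ℂ) {φ : ι → AdjoinRoot f → ℂ}
    {c : ι → ℂ} (h : ∀ i ∈ s, IsDistribution (φ i) (c i)) :
    IsDistribution (fun x => ∑ i ∈ s, k i * φ i x) (∑ i ∈ s, k i * c i) where
  map_zero := Finset.sum_eq_zero fun i hi => by rw [(h i hi).map_zero, mul_zero]
  reflection x hx := by
    rw [Finset.sum_comm]
    refine Finset.sum_congr rfl fun i hi => ?_
    rw [← Finset.mul_sum, (h i hi).reflection x hx]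
  multiplication g h' hg hh hgh y := by
    rw [Finset.sum_comm, Finset.mul_sum, ← Finset.sum_add_distrib, Finset.mul_sum]
    refine Finset.sum_congr rfl fun i hi => ?_
    rw [← Finset.mul_sum, (h i hi).multiplication g h' hg hh hgh y]
    ring

theorem IsDistribution.sub_mul {φ ψ : AdjoinRoot f → ℂ} {c d : ℂ} (hφ : IsDistribution φ c)
    (hψ : IsDistribution ψ d) (k : ℂ) :
    IsDistribution (fun x => φ x - k * ψ x) (c - k * d) where
  map_zero := by rw [hφ.map_zero, hψ.map_zero, mul_zero, sub_zero]
  reflection x hx := by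
    rw [Finset.sum_sub_distrib, ← Finset.mul_sum, hφ.reflection x hx, hψ.reflection x hx]
  multiplication g h hg hh hgh y := by
    rw [Finset.sum_sub_distrib, ← Finset.mul_sum, hφ.multiplication g h hg hh hgh y,
      hψ.multiplication g h hg hh hgh y]
    ring

theorem IsDistribution.comp_mul {φ : AdjoinRoot f → ℂ} {c : ℂ} (hφ : IsDistribution φ c)
    (u : (AdjoinRoot f)ˣ) : IsDistribution (fun x => φ ((u : AdjoinRoot f) * x)) c where
  map_zero := by rw [mul_zero, hφ.map_zero]
  reflection x hx := by
    have h0 : (u : AdjoinRoot f) * x ≠ 0 := fun h => hx ((Units.mul_right_eq_zero u).1 h)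
    rw [← hφ.reflection _ h0]
    exact Finset.sum_congr rfl fun θ _ => by rw [mul_left_comm]
  multiplication g h hg hh hgh y := by
    rw [mul_left_comm, ← hφ.multiplication g h hg hh hgh]
    refine Fintype.sum_equiv u.mulLeft _ _ fun r => ?_
    rw [Units.mulLeft_apply, mul_add, mul_left_comm]

end Closure

/-- The indicator function of the classes in `A / f` whose representative of degree less than
`deg f` is monic. -/
def monicInd (hf : f.Monic) (x : AdjoinRoot f) : ℂ :=
  if (AdjoinRoot.modByMonicHom hf x).Monic then 1 else 0

omit [Fintype F] in
theorem monicInd_mk (hf : f.Monic) {a : F[X]} (ha : a.degree < f.natDegree) :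
    monicInd hf (AdjoinRoot.mk f a) = if a.Monic then 1 else 0 := by
  rw [monicInd, AdjoinRoot.modByMonicHom_mk, (modByMonic_eq_self_iff hf).2]
  rwa [degree_eq_natDegree hf.ne_zero]

omit [Fintype F] in
theorem exists_mk_eq (hf : f.Monic) (x : AdjoinRoot f) :
    ∃ a : F[X], a.degree < f.natDegree ∧ AdjoinRoot.mk f a = x := by
  refine ⟨AdjoinRoot.modByMonicHom hf x, ?_, AdjoinRoot.mk_leftInverse hf x⟩
  obtain ⟨a, rfl⟩ := AdjoinRoot.mk_surjective x
  rw [AdjoinRoot.modByMonicHom_mk, ← degree_eq_natDegree hf.ne_zero]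
  exact degree_modByMonic_lt _ hf

omit [Fintype F] in
theorem monicInd_zero (hf : f.Monic) : monicInd hf 0 = 0 := by
  rw [monicInd, map_zero, if_neg not_monic_zero]

theorem sum_units_monicInd (hf : f.Monic) {x : AdjoinRoot f} (hx : x ≠ 0) :
    ∑ θ : Fˣ, monicInd hf (AdjoinRoot.mk f (C (θ : F)) * x) = 1 := by
  obtain ⟨a, ha, rfl⟩ := exists_mk_eq hf x
  have ha0 : a ≠ 0 := by
    rintro rfl
    exact hx (map_zero _)
  have hl : a.leadingCoeff ≠ 0 := leadingCoeff_ne_zero.2 ha0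
  have h : ∀ θ : Fˣ, monicInd hf (AdjoinRoot.mk f (C (θ : F)) * AdjoinRoot.mk f a) =
      if θ = (Units.mk0 _ hl)⁻¹ then 1 else 0 := by
    intro θ
    rw [← map_mul, monicInd_mk hf (by rwa [degree_C_mul θ.ne_zero])]
    congr 1
    rw [Monic, leadingCoeff_mul, leadingCoeff_C, eq_inv_iff_mul_eq_one, Units.ext_iff]
    simp
  rw [Finset.sum_congr rfl fun θ _ => h θ]
  simp

/-- For `t ≠ 0` the leading term of `b + h t` is that of `h t`, so it is monic exactly when `t` is;
for `t = 0` it is `b`, monic exactly when `g b` is. -/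
theorem sum_degLT_monicInd (hf : f.Monic) {g h : F[X]} (hg : g.Monic) (hh : h.Monic)
    (hgh : g * h = f) {b : F[X]} (hb : b.degree < h.natDegree) :
    ∑ t ∈ degLT F g.natDegree, monicInd hf (AdjoinRoot.mk f (b + h * t)) =
      monicInd hf (AdjoinRoot.mk f (g * b)) + (monicLT F g.natDegree).card := by
  have hn : f.natDegree = g.natDegree + h.natDegree := by rw [← hgh, hg.natDegree_mul hh]
  have hh' : h.degree = h.natDegree := degree_eq_natDegree hh.ne_zero
  have h1 : monicInd hf (AdjoinRoot.mk f (g * b)) = if b.Monic then 1 else 0 := by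
    rw [monicInd_mk]
    · congr 1
      exact propext ⟨hg.of_mul_monic_left, hg.mul⟩
    · rcases eq_or_ne b 0 with rfl | hb0
      · simp
      rw [degree_mul, degree_eq_natDegree hg.ne_zero, hn]
      rw [degree_eq_natDegree hb0] at hb ⊢
      norm_cast at hb ⊢
      omega
  have h2 : ∀ t ∈ (degLT F g.natDegree).erase 0,
      monicInd hf (AdjoinRoot.mk f (b + h * t)) = if t.Monic then 1 else 0 := by
    intro t ht
    rw [Finset.mem_erase, mem_degLT] at ht
    have h3 : b.degree < (h * t).degree := by
      refine hb.trans_le ?_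
      rw [degree_mul, hh', degree_eq_natDegree ht.1]
      exact_mod_cast Nat.le_add_right _ _
    rw [monicInd_mk]
    · congr 1
      rw [Monic, leadingCoeff_add_of_degree_lt h3, ← Monic]
      exact propext ⟨hh.of_mul_monic_left, hh.mul⟩
    · rw [degree_add_eq_right_of_degree_lt h3, degree_mul, hh', hn]
      have h4 := ht.2
      rw [degree_eq_natDegree ht.1] at h4 ⊢
      norm_cast at h4 ⊢
      omega
  rw [h1, ← Finset.add_sum_erase _ _ (zero_mem_degLT _), Finset.sum_congr rfl h2, mul_zero,
    add_zero, monicInd_mk]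
  · congr 1
    rw [Finset.sum_erase (f := fun t : F[X] => if t.Monic then (1 : ℂ) else 0) _
      (if_neg not_monic_zero), ← Finset.sum_filter]
    simp [monicLT]
  · refine hb.trans_le ?_
    rw [hn]
    exact_mod_cast Nat.le_add_left _ _

/-- Here the formula is in terms of small representatives, as it comes from analysis. The structure
`IsDistribution` sums over the whole ring instead, which makes invariance under unit dilations and
the Fourier transform immediate. -/
theorem isDistribution_of_sum_degLT (hf : f.Monic) [Fintype (AdjoinRoot f)]
    {φ : AdjoinRoot f → ℂ} {c : ℂ}
    (h0 : φ 0 = 0) (h1 : ∀ x ≠ 0, ∑ θ : Fˣ, φ (AdjoinRoot.mk f (C (θ : F)) * x) = c)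
    (h2 : ∀ g h : F[X], g.Monic → h.Monic → g * h = f → ∀ b : F[X], b.degree < h.natDegree →
      ∑ t ∈ degLT F g.natDegree, φ (AdjoinRoot.mk f (b + h * t)) =
        φ (AdjoinRoot.mk f (g * b)) + (monicLT F g.natDegree).card * c) :
    IsDistribution φ c where
  map_zero := h0
  reflection := h1
  multiplication g h hg hh hgh y := by
    obtain ⟨a, -, rfl⟩ := exists_mk_eq hf y
    have h3 : (a %ₘ h).degree < h.natDegree := by
      rw [← degree_eq_natDegree hh.ne_zero]
      exact degree_modByMonic_lt _ hh
    have h4 : AdjoinRoot.mk f (g * (a %ₘ h)) = AdjoinRoot.mk f g * AdjoinRoot.mk f a := by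
      have := congrArg (AdjoinRoot.mk f) (congrArg (g * ·) (modByMonic_add_div a h))
      rw [mul_add, ← mul_assoc, hgh, map_add, map_mul (AdjoinRoot.mk f) f, AdjoinRoot.mk_self,
        zero_mul, add_zero, map_mul _ g a] at this
      exact this
    rw [sum_add_mk_mul hg hh hgh, h2 g h hg hh hgh _ h3, nsmul_eq_mul, h4]
    push_cast
    rfl

theorem isDistribution_monicInd (hf : f.Monic) [Fintype (AdjoinRoot f)] :
    IsDistribution (monicInd hf) 1 := by
  refine isDistribution_of_sum_degLT hf (monicInd_zero hf)
    (fun x hx => sum_units_monicInd hf hx) fun g h hg hh hgh b hb => ?_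
  rw [sum_degLT_monicInd hf hg hh hgh hb, mul_one]

end Distributions

/-! ### Fourier transform on `A/f` and the dual multiplication relations -/

section Fourier

open Classical

variable {F : Type*} [Field F] [Fintype F] {f : F[X]} (hf : f.Monic)

/-- The `F`-linear residue functional `a / f ↦ Res (a / f)` on `A / f`. -/
def residue : AdjoinRoot f →ₗ[F] F := lcoeff F (f.natDegree - 1) ∘ₗ AdjoinRoot.modByMonicHom hf

omit [Fintype F] in
theorem residue_mk {a : F[X]} (ha : a.degree < f.natDegree) :
    residue hf (AdjoinRoot.mk f a) = a.coeff (f.natDegree - 1) := by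
  rw [residue, LinearMap.comp_apply, AdjoinRoot.modByMonicHom_mk, (modByMonic_eq_self_iff hf).2,
    lcoeff_apply]
  rwa [degree_eq_natDegree hf.ne_zero]

/-- A primitive additive character of `A / f`. -/
def addCharF : AddChar (AdjoinRoot f) ℂ :=
  (AddChar.FiniteField.primitiveChar_to_Complex F).compAddMonoidHom (residue hf).toAddMonoidHom

theorem addCharF_apply (x : AdjoinRoot f) :
    addCharF hf x = AddChar.FiniteField.primitiveChar_to_Complex F (residue hf x) := rfl

theorem exists_primitiveChar_ne_one :
    ∃ θ : F, AddChar.FiniteField.primitiveChar_to_Complex F θ ≠ 1 := by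
  have h := AddChar.FiniteField.primitiveChar_to_Complex_isPrimitive F one_ne_zero
  rw [AddChar.mulShift_one] at h
  exact AddChar.ne_one_iff.1 h

theorem addCharF_isPrimitive : (addCharF hf).IsPrimitive := by
  intro x hx
  obtain ⟨a, ha, rfl⟩ := exists_mk_eq hf x
  have ha0 : a ≠ 0 := by
    rintro rfl
    exact hx (map_zero _)
  obtain ⟨θ, hθ⟩ := exists_primitiveChar_ne_one (F := F)
  have hl : a.leadingCoeff ≠ 0 := leadingCoeff_ne_zero.2 ha0
  have hd := ha
  rw [degree_eq_natDegree ha0] at hd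
  norm_cast at hd
  -- This multiple moves the leading term of `a` to degree `deg f - 1` and makes the residue equal
  -- to `θ`.
  refine AddChar.ne_one_iff.2 ⟨AdjoinRoot.mk f (C (θ / a.leadingCoeff) *
    X ^ (f.natDegree - 1 - a.natDegree)), ?_⟩
  rw [AddChar.mulShift_apply, ← map_mul, addCharF_apply, residue_mk]
  · have h1 : f.natDegree - 1 = a.natDegree + (f.natDegree - 1 - a.natDegree) := by omega
    have h2 : (a * (C (θ / a.leadingCoeff) * X ^ (f.natDegree - 1 - a.natDegree))).coeff
        (f.natDegree - 1) = θ := by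
      conv_lhs => arg 2; rw [h1]
      rw [← mul_assoc, coeff_mul_X_pow, coeff_mul_C]
      change a.leadingCoeff * _ = θ
      field_simp
    rwa [h2]
  · refine lt_of_le_of_lt degree_le_natDegree ?_
    have h3 : (a * (C (θ / a.leadingCoeff) * X ^ (f.natDegree - 1 - a.natDegree))).natDegree ≤
        a.natDegree + (f.natDegree - 1 - a.natDegree) :=
      natDegree_mul_le_of_le le_rfl (natDegree_C_mul_X_pow_le _ _)
    norm_cast
    omega

variable [Fintype (AdjoinRoot f)]

/-- The Fourier transform on `A / f`. -/
def fourier (φ : AdjoinRoot f → ℂ) (w : AdjoinRoot f) : ℂ := ∑ z, φ z * addCharF hf (z * w)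

theorem sum_addCharF_mul (b : AdjoinRoot f) :
    ∑ r, addCharF hf (b * r) = if b = 0 then (Fintype.card (AdjoinRoot f) : ℂ) else 0 := by
  have h := AddChar.sum_mulShift b (addCharF_isPrimitive hf)
  push_cast at h
  rw [← h]
  exact Finset.sum_congr rfl fun r _ => by rw [mul_comm]

theorem eq_zero_of_fourier_eq_zero {φ : AdjoinRoot f → ℂ} (h : ∀ w, fourier hf φ w = 0)
    (x : AdjoinRoot f) : φ x = 0 := by
  have h1 : ∑ w, fourier hf φ w * addCharF hf (-x * w) = Fintype.card (AdjoinRoot f) * φ x := by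
    simp only [fourier, Finset.sum_mul]
    rw [Finset.sum_comm]
    have h2 : ∀ z : AdjoinRoot f, ∑ w, φ z * addCharF hf (z * w) * addCharF hf (-x * w) =
        if z - x = 0 then φ z * Fintype.card (AdjoinRoot f) else 0 := by
      intro z
      rw [← mul_ite_zero, ← sum_addCharF_mul hf, Finset.mul_sum]
      refine Finset.sum_congr rfl fun w _ => ?_
      rw [mul_assoc, ← AddChar.map_add_eq_mul]
      congr 2
      ring
    simp only [h2, sub_eq_zero, Finset.sum_ite_eq', Finset.mem_univ, if_true]
    rw [mul_comm]
  simp only [h, zero_mul, Finset.sum_const_zero] at h1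
  have h3 : (Fintype.card (AdjoinRoot f) : ℂ) ≠ 0 := by exact_mod_cast Fintype.card_ne_zero
  exact (mul_eq_zero.1 h1.symm).resolve_left h3

theorem card_adjoinRoot (hf : f.Monic) :
    Fintype.card (AdjoinRoot f) = Fintype.card F ^ f.natDegree := by
  have h := sum_degLT_mk hf (fun _ => (1 : ℕ))
  simpa [card_degLT] using h.symm

theorem sum_mk_mul (hf : f.Monic) {g h : F[X]} (hg : g.Monic) (hh : h.Monic) (hgh : g * h = f)
    (Φ : AdjoinRoot f → ℂ) :
    ∑ y, Φ (AdjoinRoot.mk f g * y) =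
      (Fintype.card F : ℂ) ^ g.natDegree * ∑ z, if z * AdjoinRoot.mk f h = 0 then Φ z else 0 := by
  have h1 := sum_add_mk_mul hh hg (by rw [mul_comm, hgh]) Φ 0
  simp only [map_zero, zero_add, zero_modByMonic] at h1
  rw [h1, nsmul_eq_mul, ← sum_degLT_mk hf, ← Finset.sum_filter]
  push_cast
  congr 1
  refine Finset.sum_bij (fun t _ => g * t) ?_ ?_ ?_ ?_
  · intro t ht
    rw [mem_degLT] at ht
    rw [Finset.mem_filter, mem_degLT, ← map_mul, mul_right_comm, hgh, map_mul, AdjoinRoot.mk_self,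
      zero_mul, ← degree_eq_natDegree hf.ne_zero, ← hgh, degree_mul, degree_mul,
      degree_eq_natDegree hh.ne_zero, degree_eq_natDegree hg.ne_zero]
    refine ⟨?_, rfl⟩
    exact WithBot.add_lt_add_left (by simp) ht
  · intro t _ t' _ h
    exact mul_left_cancel₀ hg.ne_zero h
  · intro a ha
    rw [Finset.mem_filter, mem_degLT, ← map_mul, AdjoinRoot.mk_eq_zero, ← hgh] at ha
    obtain ⟨t, rfl⟩ := (mul_dvd_mul_iff_right hh.ne_zero).1 ha.2
    refine ⟨t, ?_, rfl⟩
    have h2 := ha.1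
    rw [hgh, ← degree_eq_natDegree hf.ne_zero, ← hgh, degree_mul, degree_mul] at h2
    rw [mem_degLT, ← degree_eq_natDegree hh.ne_zero]
    exact lt_of_add_lt_add_left h2
  · intro t _
    rfl

/-- Both sides equal `#(A/f)` times the sum of `φ z * addCharF (z w)` over the `z` killed by `h`:
the left by orthogonality in `r`, the right by averaging `φ` over translates by multiples of `h` and
applying the multiplication formula. -/
theorem sum_fourier_add_mk_mul {φ : AdjoinRoot f → ℂ} (hφ : IsDistribution φ 0) {g h : F[X]}
    (hg : g.Monic) (hh : h.Monic) (hgh : g * h = f) (w : AdjoinRoot f) :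
    ∑ r, fourier hf φ (w + AdjoinRoot.mk f h * r) =
      Fintype.card (AdjoinRoot f) * fourier hf φ (AdjoinRoot.mk f g * w) := by
  set N : ℂ := (Fintype.card (AdjoinRoot f) : ℂ) with hN
  have h0 : AdjoinRoot.mk f h * AdjoinRoot.mk f g = 0 := by
    rw [← map_mul, mul_comm, hgh, AdjoinRoot.mk_self]
  have hn : f.natDegree = g.natDegree + h.natDegree := by rw [← hgh, hg.natDegree_mul hh]
  have h1 : ∑ r, fourier hf φ (w + AdjoinRoot.mk f h * r) =
      N * ∑ z, if z * AdjoinRoot.mk f h = 0 then φ z * addCharF hf (z * w) else 0 := by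
    simp only [fourier]
    rw [Finset.sum_comm, Finset.mul_sum]
    refine Finset.sum_congr rfl fun z _ => ?_
    have h2 := sum_addCharF_mul hf (z * AdjoinRoot.mk f h)
    have h3 : ∀ r, φ z * addCharF hf (z * (w + AdjoinRoot.mk f h * r)) =
        φ z * addCharF hf (z * w) * addCharF hf (z * AdjoinRoot.mk f h * r) := by
      intro r
      rw [mul_assoc, ← AddChar.map_add_eq_mul, mul_add, ← mul_assoc z]
    simp only [h3]
    rw [← Finset.mul_sum, h2]
    split_ifs <;> ring
  have h4 : N * fourier hf φ (AdjoinRoot.mk f g * w) =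
      N * ∑ z, if z * AdjoinRoot.mk f h = 0 then φ z * addCharF hf (z * w) else 0 := by
    have h5 : ∀ r, fourier hf φ (AdjoinRoot.mk f g * w) =
        ∑ y, φ (y + AdjoinRoot.mk f h * r) * addCharF hf (AdjoinRoot.mk f g * y * w) := by
      intro r
      symm
      refine Fintype.sum_equiv (Equiv.addRight (AdjoinRoot.mk f h * r)) _ _ fun y => ?_
      rw [Equiv.coe_addRight]
      congr 2
      linear_combination (-r * w) * h0
    have h6 : N * fourier hf φ (AdjoinRoot.mk f g * w) = ∑ r : AdjoinRoot f,
        ∑ y, φ (y + AdjoinRoot.mk f h * r) * addCharF hf (AdjoinRoot.mk f g * y * w) := by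
      rw [← Finset.sum_congr rfl fun r _ => h5 r, Finset.sum_const, Finset.card_univ, nsmul_eq_mul]
    rw [h6, Finset.sum_comm]
    have h7 : ∀ y, ∑ r, φ (y + AdjoinRoot.mk f h * r) * addCharF hf (AdjoinRoot.mk f g * y * w) =
        (Fintype.card F : ℂ) ^ h.natDegree * ((fun z => φ z * addCharF hf (z * w))
          (AdjoinRoot.mk f g * y)) := by
      intro y
      rw [← Finset.sum_mul, hφ.multiplication g h hg hh hgh]
      ring
    simp only [h7]
    rw [← Finset.mul_sum, sum_mk_mul hf hg hh hgh (fun z => φ z * addCharF hf (z * w)),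
      ← mul_assoc, hN, card_adjoinRoot hf, hn]
    push_cast
    ring
  rw [h1, h4]

end Fourier

/-! ### Functions with the dual relations are determined by their values at units -/

section Uniqueness

variable {F : Type*} [Field F] {f : F[X]} [Fintype (AdjoinRoot f)]

omit [Fintype (AdjoinRoot f)] in
theorem exists_monic_mul_isCoprime (hf : f.Monic) (a : F[X]) :
    ∃ g h w : F[X], g.Monic ∧ h.Monic ∧ g * h = f ∧ a = g * w ∧ IsCoprime w h := by
  classical
  let : GCDMonoid F[X] := UniqueFactorizationMonoid.toGCDMonoid _
  obtain ⟨x, y, hx, hy, hxy⟩ := extract_gcd a f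
  set d := gcd a f
  have hd0 : d ≠ 0 := by
    rintro h
    rw [h, zero_mul] at hy
    exact hf.ne_zero hy
  have hl : d.leadingCoeff ≠ 0 := leadingCoeff_ne_zero.2 hd0
  have hC : C d.leadingCoeff⁻¹ * C d.leadingCoeff = 1 := by
    rw [← C_mul, inv_mul_cancel₀ hl, C_1]
  have hu : IsUnit (C d.leadingCoeff) := isUnit_C.2 (isUnit_iff_ne_zero.2 hl)
  have hg : (d * C d.leadingCoeff⁻¹).Monic := monic_mul_leadingCoeff_inv hd0
  have hgh : d * C d.leadingCoeff⁻¹ * (C d.leadingCoeff * y) = f := by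
    rw [mul_assoc, ← mul_assoc _ _ y, hC, one_mul, ← hy]
  refine ⟨d * C d.leadingCoeff⁻¹, C d.leadingCoeff * y, C d.leadingCoeff * x, hg,
    hg.of_mul_monic_left (hgh ▸ hf), hgh, ?_, ?_⟩
  · rw [mul_assoc, ← mul_assoc _ _ x, hC, one_mul, ← hx]
  · exact (isCoprime_mul_unit_left hu x y).2 ((gcd_isUnit_iff _ _).1 hxy)

/-- Induction on the degree of the gcd `g` with `f`, by a maximum principle. At a point `g w₀` where
`|ψ|` is maximal among classes with gcd `g`, the relation writes `#(A/f) * ψ (g w₀)` as a sum of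
`#(A/f)` values at `w₀ + h r`. Their gcds with `f` divide `g`, so each value is zero by induction or
bounded by the maximum, and at least one is zero. Hence the maximum is zero. -/
theorem eq_zero_of_sum_add_mk_mul_aux (hf : f.Monic) {ψ : AdjoinRoot f → ℂ}
    (h0 : ∀ u, IsUnit u → ψ u = 0)
    (h1 : ∀ g h : F[X], g.Monic → h.Monic → g * h = f → ∀ w,
      ∑ r, ψ (w + AdjoinRoot.mk f h * r) =
        Fintype.card (AdjoinRoot f) * ψ (AdjoinRoot.mk f g * w)) (d : ℕ) :
    ∀ g h : F[X], g.Monic → h.Monic → g * h = f → g.natDegree = d → ∀ w, IsCoprime w h →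
      ψ (AdjoinRoot.mk f (g * w)) = 0 := by
  classical
  induction d using Nat.strong_induction_on with
  | _ d ih =>
    intro g h hg hh hgh hd w hw
    rcases Nat.eq_zero_or_pos d with rfl | hpos
    · obtain rfl := hg.natDegree_eq_zero.1 hd
      rw [one_mul] at hgh ⊢
      subst hgh
      obtain ⟨a, b, hab⟩ := hw
      refine h0 _ (IsUnit.of_mul_eq_one (AdjoinRoot.mk h a) ?_)
      have := congrArg (AdjoinRoot.mk h) hab
      rw [map_add, map_mul, map_mul, AdjoinRoot.mk_self, mul_zero, add_zero, map_one] at this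
      rw [mul_comm, this]
    set S : Finset (AdjoinRoot f) := Finset.univ.filter fun z =>
      ∃ v, IsCoprime v h ∧ z = AdjoinRoot.mk f (g * v) with hS
    have hwS : AdjoinRoot.mk f (g * w) ∈ S := by
      rw [hS, Finset.mem_filter]
      exact ⟨Finset.mem_univ _, w, hw, rfl⟩
    obtain ⟨z₀, hz₀, hmax⟩ := S.exists_max_image (fun z => ‖ψ z‖) ⟨_, hwS⟩
    obtain ⟨w₀, hw₀, rfl⟩ := (Finset.mem_filter.1 hz₀).2
    set m := ‖ψ (AdjoinRoot.mk f (g * w₀))‖ with hm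
    have hterm : ∀ s : F[X], ‖ψ (AdjoinRoot.mk f (w₀ + h * s))‖ ≤ m ∧
        (¬g ∣ w₀ + h * s → ψ (AdjoinRoot.mk f (w₀ + h * s)) = 0) := by
      intro s
      set w' := w₀ + h * s with hw'
      have hcop : IsCoprime w' h := hw₀.add_mul_left_left s
      obtain ⟨g', h', w'', hg'm, hh'm, hh', hw'', hcop'⟩ := exists_monic_mul_isCoprime hf w'
      have hg'h : IsCoprime g' h := hcop.of_isCoprime_of_dvd_left (hw'' ▸ dvd_mul_right _ _)
      have hg'g : g' ∣ g := hg'h.dvd_of_dvd_mul_right (by rw [hgh]; exact hh' ▸ dvd_mul_right _ _)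
      have hle := natDegree_le_of_dvd hg'g hg.ne_zero
      rcases hle.lt_or_eq with hlt | heq
      · have hzero : ψ (AdjoinRoot.mk f w') = 0 := by
          rw [hw'']
          exact ih _ (hd ▸ hlt) g' h' hg'm hh'm hh' rfl w'' hcop'
        exact ⟨by rw [hzero, norm_zero]; exact norm_nonneg _, fun _ => hzero⟩
      · have hgg : g' = g := (eq_of_monic_of_dvd_of_natDegree_le hg'm hg hg'g heq.ge).symm
        have hhh : h' = h := by
          rw [hgg, ← hgh] at hh'
          exact mul_left_cancel₀ hg.ne_zero hh'
        refine ⟨?_, fun h => absurd ?_ h⟩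
        swap
        · rw [hw'', hgg]
          exact dvd_mul_right _ _
        refine hmax _ (Finset.mem_filter.2 ⟨Finset.mem_univ _, w'', hhh ▸ hcop', ?_⟩)
        rw [hw'', hgg]
    -- If `g` divided both `w₀` and `w₀ + h`, it would divide the coprime pair `w₀`, `h`.
    have hex : ∃ s : F[X], ¬g ∣ w₀ + h * s := by
      by_contra! hall
      have h2 := hall 0
      have h3 := hall 1
      rw [mul_zero, add_zero] at h2
      rw [mul_one] at h3
      have h4 := (dvd_add_right h2).1 h3
      have h5 := natDegree_eq_zero_of_isUnit (hw₀.isUnit_of_dvd' h2 h4)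
      omega
    obtain ⟨s₀, hs₀⟩ := hex
    have hsum := h1 g h hg hh hgh (AdjoinRoot.mk f w₀)
    rw [← map_mul] at hsum
    have hbound : ∀ r, ‖ψ (AdjoinRoot.mk f w₀ + AdjoinRoot.mk f h * r)‖ ≤ m := by
      intro r
      obtain ⟨s, rfl⟩ := AdjoinRoot.mk_surjective r
      rw [← map_mul, ← map_add]
      exact (hterm s).1
    have hle : Fintype.card (AdjoinRoot f) * m ≤ (Fintype.card (AdjoinRoot f) - 1) * m := by
      have h2 := congrArg norm hsum
      rw [norm_mul, Complex.norm_natCast, ← Finset.add_sum_erase _ _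
        (Finset.mem_univ (AdjoinRoot.mk f s₀)), ← map_mul, ← map_add, (hterm s₀).2 hs₀,
        zero_add] at h2
      rw [← h2]
      refine (norm_sum_le_of_le _ fun r _ => hbound r).trans ?_
      rw [Finset.sum_const, Finset.card_erase_of_mem (Finset.mem_univ _), Finset.card_univ,
        nsmul_eq_mul, Nat.cast_sub Fintype.card_pos, Nat.cast_one]
    have hm0 : m ≤ 0 := by linarith
    have := (hmax _ hwS).trans hm0
    exact norm_le_zero_iff.1 this

theorem eq_zero_of_sum_add_mk_mul (hf : f.Monic) {ψ : AdjoinRoot f → ℂ}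
    (h0 : ∀ u, IsUnit u → ψ u = 0)
    (h1 : ∀ g h : F[X], g.Monic → h.Monic → g * h = f → ∀ w,
      ∑ r, ψ (w + AdjoinRoot.mk f h * r) =
        Fintype.card (AdjoinRoot f) * ψ (AdjoinRoot.mk f g * w)) (x : AdjoinRoot f) :
    ψ x = 0 := by
  obtain ⟨a, rfl⟩ := AdjoinRoot.mk_surjective x
  obtain ⟨g, h, w, hg, hh, hgh, rfl, hw⟩ := exists_monic_mul_isCoprime hf a
  exact eq_zero_of_sum_add_mk_mul_aux hf h0 h1 _ g h hg hh hgh rfl w hw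

end Uniqueness
-- Character components and the classification of distributions
section Twists

open Classical

variable {F : Type*} [Field F] [Fintype F] {f : F[X]}

/-- The restriction of a character of `A / f` to the constants. -/
def constChar (χ : MulChar (AdjoinRoot f) ℂ) : MulChar F ℂ :=
  MulChar.ofUnitHom (χ.toUnitHom.comp (Units.map (AdjoinRoot.of f).toMonoidHom))

omit [Fintype F] in
theorem constChar_apply (χ : MulChar (AdjoinRoot f) ℂ) (θ : Fˣ) :
    constChar χ (θ : F) = χ (AdjoinRoot.mk f (C (θ : F))) := by
  rw [constChar, MulChar.ofUnitHom_coe, MonoidHom.comp_apply, MulChar.coe_toUnitHom]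
  rfl

theorem sum_units_monicEq_sum {M : Type*} [AddCommMonoid M] (d : ℕ) (φ : F[X] → M) :
    ∑ a ∈ (degLT F d).erase 0, φ a =
      ∑ m ∈ Finset.range d, ∑ v ∈ monicEq F m, ∑ θ : Fˣ, φ (C (θ : F) * v) := by
  have h1 := prod_units_monicLT (M := Multiplicative M) d (fun a => Multiplicative.ofAdd (φ a))
  have h2 : ∑ a ∈ (degLT F d).erase 0, φ a =
      ∑ θ : Fˣ, ∑ a ∈ monicLT F d, φ (C (θ : F) * a) := h1.symm
  rw [h2, Finset.sum_comm, ← Finset.sum_fiberwise_of_maps_to (s := monicLT F d)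
    (t := Finset.range d) (g := natDegree)]
  · refine Finset.sum_congr rfl fun m hm => Finset.sum_congr ?_ fun _ _ => rfl
    ext a
    rw [Finset.mem_filter, mem_monicLT, mem_monicEq]
    constructor
    · rintro ⟨⟨-, ha⟩, ha'⟩
      exact ⟨ha, ha'⟩
    · rintro ⟨ha, rfl⟩
      refine ⟨⟨?_, ha⟩, rfl⟩
      rw [degree_eq_natDegree ha.ne_zero]
      exact_mod_cast Finset.mem_range.1 hm
  · intro a ha
    rw [mem_monicLT] at ha
    have h3 := ha.1
    rw [degree_eq_natDegree ha.2.ne_zero] at h3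
    exact Finset.mem_range.2 (by exact_mod_cast h3)

variable (hf : f.Monic)

theorem sum_monicEq_addCharF {a : F[X]} {j d : ℕ} (hj : j < f.natDegree) (ha : a.natDegree = d)
    (ha0 : a ≠ 0) (hd : d < f.natDegree) :
    ∑ b ∈ monicEq F j, addCharF hf (AdjoinRoot.mk f (b * a)) =
      if j < f.natDegree - 1 - d then (Fintype.card F : ℂ) ^ j
      else if j = f.natDegree - 1 - d then
        (Fintype.card F : ℂ) ^ j *
          AddChar.FiniteField.primitiveChar_to_Complex F a.leadingCoeff
      else 0 := by
  have hl : a.leadingCoeff ≠ 0 := leadingCoeff_ne_zero.2 ha0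
  have hdeg : ∀ b ∈ monicEq F j, (b * a).natDegree = j + d := by
    intro b hb
    rw [mem_monicEq] at hb
    rw [hb.1.natDegree_mul' ha0, hb.2, ha]
  have hres : ∀ b : F[X], j + d < f.natDegree → (b * a).natDegree = j + d →
      residue hf (AdjoinRoot.mk f (b * a)) = (b * a).coeff (f.natDegree - 1) := by
    intro b h1 h2
    refine residue_mk hf (degree_le_natDegree.trans_lt ?_)
    rw [h2]
    exact_mod_cast h1
  split_ifs with h1 h2
  · rw [← Nat.cast_pow, ← card_monicEq, Finset.cast_card]
    refine Finset.sum_congr rfl fun b hb => ?_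
    rw [addCharF_apply, hres b (by omega) (hdeg b hb), coeff_eq_zero_of_natDegree_lt,
      AddChar.map_zero_eq_one]
    rw [hdeg b hb]
    omega
  · rw [← Nat.cast_pow, ← card_monicEq, ← nsmul_eq_mul, ← Finset.sum_const]
    refine Finset.sum_congr rfl fun b hb => ?_
    have h3 : f.natDegree - 1 = (b * a).natDegree := by
      rw [hdeg b hb]
      omega
    rw [addCharF_apply, hres b (by omega) (hdeg b hb), h3]
    change AddChar.FiniteField.primitiveChar_to_Complex F (b * a).leadingCoeff = _
    rw [leadingCoeff_mul, (mem_monicEq.1 hb).1, one_mul]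
  -- For larger `j` there is room to translate `b` by a `t` of degree `deg f - 1 - d`; this permutes
  -- the monics of degree `j` and multiplies the sum by a number different from `1`.
  · obtain ⟨θ, hθ⟩ := exists_primitiveChar_ne_one (F := F)
    have hs : f.natDegree - 1 - d < j := by omega
    set t : F[X] := C (θ / a.leadingCoeff) * X ^ (f.natDegree - 1 - d) with ht
    have htdeg : t.degree < j := by
      refine (degree_C_mul_X_pow_le _ _).trans_lt ?_
      exact_mod_cast hs
    have hta : addCharF hf (AdjoinRoot.mk f (t * a)) =
        AddChar.FiniteField.primitiveChar_to_Complex F θ := by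
      have h3 : (t * a).natDegree ≤ f.natDegree - 1 - d + d :=
        natDegree_mul_le_of_le (natDegree_C_mul_X_pow_le _ _) ha.le
      rw [addCharF_apply, residue_mk hf]
      · congr 1
        have h4 : f.natDegree - 1 = d + (f.natDegree - 1 - d) := by omega
        conv_lhs => arg 2; rw [h4]
        rw [ht, mul_right_comm, coeff_mul_X_pow, coeff_C_mul, ← ha]
        change _ * a.leadingCoeff = θ
        field_simp
      · refine degree_le_natDegree.trans_lt ?_
        norm_cast
        omega
    have h5 : ∑ b ∈ monicEq F j, addCharF hf (AdjoinRoot.mk f (b * a)) =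
        ∑ b ∈ monicEq F j, addCharF hf (AdjoinRoot.mk f ((b + t) * a)) := by
      have hmem : ∀ (t : F[X]), t.degree < j → ∀ b ∈ monicEq F j, b + t ∈ monicEq F j := by
        intro t ht b hb
        rw [mem_monicEq] at hb ⊢
        have h6 : t.degree < b.degree := by rwa [degree_eq_natDegree hb.1.ne_zero, hb.2]
        exact ⟨hb.1.add_of_left h6, by rw [natDegree_add_eq_left_of_degree_lt h6, hb.2]⟩
      refine Finset.sum_bij' (fun b _ => b - t) (fun b _ => b + t) ?_ (hmem t htdeg) ?_ ?_ ?_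
      · intro b hb
        rw [sub_eq_add_neg]
        exact hmem (-t) (by rwa [degree_neg]) b hb
      · simp
      · simp
      · simp
    simp only [add_mul, map_add, AddChar.map_add_eq_mul, hta] at h5
    rw [← Finset.sum_mul] at h5
    exact eq_zero_of_mul_eq_self_right hθ h5.symm

variable [Fintype (AdjoinRoot f)]

theorem fourier_monicInd {a : F[X]} {d : ℕ} (ha : a.natDegree = d) (ha0 : a ≠ 0)
    (hd : d < f.natDegree) :
    fourier hf (monicInd hf) (AdjoinRoot.mk f a) =
      ∑ j ∈ Finset.range (f.natDegree - 1 - d), (Fintype.card F : ℂ) ^ j +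
        (Fintype.card F : ℂ) ^ (f.natDegree - 1 - d) *
          AddChar.FiniteField.primitiveChar_to_Complex F a.leadingCoeff := by
  have h1 : fourier hf (monicInd hf) (AdjoinRoot.mk f a) = ∑ j ∈ Finset.range f.natDegree,
      ∑ b ∈ monicEq F j, addCharF hf (AdjoinRoot.mk f (b * a)) := by
    rw [fourier, ← sum_degLT_mk hf, ← Finset.sum_erase (a := 0) _ (by
      rw [map_zero, monicInd_zero, zero_mul]), sum_units_monicEq_sum]
    refine Finset.sum_congr rfl fun j hj => Finset.sum_congr rfl fun b hb => ?_
    rw [mem_monicEq] at hb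
    rw [Finset.sum_eq_single 1]
    · rw [Units.val_one, C_1, one_mul, monicInd_mk hf, if_pos hb.1, one_mul, map_mul (AdjoinRoot.mk f)]
      rw [degree_eq_natDegree hb.1.ne_zero, hb.2]
      exact_mod_cast Finset.mem_range.1 hj
    · intro θ _ hθ
      rw [monicInd_mk hf, if_neg, zero_mul]
      · rw [Monic, leadingCoeff_mul, leadingCoeff_C, hb.1, mul_one]
        exact fun h => hθ (Units.ext h)
      · rw [degree_C_mul θ.ne_zero, degree_eq_natDegree hb.1.ne_zero, hb.2]
        exact_mod_cast Finset.mem_range.1 hj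
    · exact fun h => absurd (Finset.mem_univ _) h
  rw [h1, Finset.sum_congr rfl fun j hj =>
    sum_monicEq_addCharF hf (Finset.mem_range.1 hj) ha ha0 hd]
  have h2 : f.natDegree = (f.natDegree - 1 - d) + (1 + d) := by omega
  set s := f.natDegree - 1 - d
  rw [h2, Finset.sum_range_add, add_comm 1 d, Finset.sum_range_succ',
    Finset.sum_eq_zero (s := Finset.range d)]
  · rw [zero_add, add_zero, if_neg (lt_irrefl _), if_pos rfl]
    congr 1
    exact Finset.sum_congr rfl fun j hj => if_pos (Finset.mem_range.1 hj)
  · intro j _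
    rw [if_neg (by omega), if_neg (by omega)]

/-- The `χ`-component of a function on `A / f`. -/
def twist (χ : MulChar (AdjoinRoot f) ℂ) (φ : AdjoinRoot f → ℂ) (x : AdjoinRoot f) : ℂ :=
  ∑ u : (AdjoinRoot f)ˣ, χ ((u⁻¹ : (AdjoinRoot f)ˣ) : AdjoinRoot f) * φ ((u : AdjoinRoot f) * x)

omit [Fintype F] in
theorem twist_mul (χ : MulChar (AdjoinRoot f) ℂ) (φ : AdjoinRoot f → ℂ) (v : (AdjoinRoot f)ˣ)
    (x : AdjoinRoot f) : twist χ φ ((v : AdjoinRoot f) * x) = χ (v : AdjoinRoot f) * twist χ φ x := by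
  rw [twist, twist, Finset.mul_sum]
  refine Fintype.sum_equiv (Equiv.mulRight v) _ _ fun u => ?_
  rw [Equiv.coe_mulRight, mul_inv_rev, Units.val_mul, Units.val_mul, map_mul, ← mul_assoc (χ v),
    ← mul_assoc (χ v), ← map_mul, Units.mul_inv, MulChar.map_one, one_mul, mul_assoc (u : AdjoinRoot f)]

theorem fourier_eigen {χ : MulChar (AdjoinRoot f) ℂ} {φ : AdjoinRoot f → ℂ}
    (h : ∀ (v : (AdjoinRoot f)ˣ) x, φ ((v : AdjoinRoot f) * x) = χ (v : AdjoinRoot f) * φ x)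
    (u : (AdjoinRoot f)ˣ) : fourier hf φ (u : AdjoinRoot f) =
      χ ((u⁻¹ : (AdjoinRoot f)ˣ) : AdjoinRoot f) * fourier hf φ 1 := by
  rw [fourier, fourier, Finset.mul_sum]
  refine Fintype.sum_equiv u.mulRight _ _ fun z => ?_
  simp only [Units.mulRight_apply]
  rw [mul_one, ← mul_assoc, ← h, mul_comm z, Units.inv_mul_cancel_left]

omit [Fintype F] in
theorem sum_units_eq_sum {φ : AdjoinRoot f → ℂ} (h : ∀ x, ¬IsUnit x → φ x = 0) :
    ∑ u : (AdjoinRoot f)ˣ, φ u = ∑ x, φ x :=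
  Fintype.sum_of_injective (fun u : (AdjoinRoot f)ˣ => (u : AdjoinRoot f)) Units.val_injective _ _
    (fun x hx => h x fun hu => hx ⟨hu.unit, hu.unit_spec⟩) fun _ => rfl

/-- Reduces the one Fourier value that matters for an eigenfunction to a character sum of the
explicit transform `fourier_monicInd`. -/
theorem fourier_twist_one (χ : MulChar (AdjoinRoot f) ℂ) (φ : AdjoinRoot f → ℂ) :
    fourier hf (twist χ φ) 1 = ∑ x, χ x * fourier hf φ x := by
  rw [← sum_units_eq_sum fun x hx => by rw [MulChar.map_nonunit _ hx, zero_mul]]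
  simp only [fourier, twist, Finset.sum_mul, Finset.mul_sum]
  rw [Finset.sum_comm]
  refine Fintype.sum_equiv (Equiv.inv _) _ _ fun u => ?_
  refine Fintype.sum_equiv u.mulLeft _ _ fun z => ?_
  simp only [Equiv.inv_apply, Units.mulLeft_apply]
  rw [mul_one, mul_comm (u : AdjoinRoot f) z, Units.mul_inv_cancel_right, mul_assoc]

omit [Fintype (AdjoinRoot f)] in
theorem sum_constChar {χ : MulChar (AdjoinRoot f) ℂ} (hχ : constChar χ ≠ 1) :
    ∑ θ : Fˣ, constChar χ (θ : F) = 0 := by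
  rw [← MulChar.sum_eq_zero_of_ne_one hχ]
  exact Fintype.sum_of_injective (fun u : Fˣ => (u : F)) Units.val_injective _ _
    (fun x hx => MulChar.map_nonunit _ fun hu => hx ⟨hu.unit, hu.unit_spec⟩) fun _ => rfl

omit [Fintype (AdjoinRoot f)] in
theorem sum_constChar_mul (χ : MulChar (AdjoinRoot f) ℂ) (ψ : AddChar F ℂ) :
    ∑ θ : Fˣ, constChar χ (θ : F) * ψ (θ : F) = gaussSum (constChar χ) ψ := by
  exact Fintype.sum_of_injective (fun u : Fˣ => (u : F)) Units.val_injective _ _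
    (fun x hx => by rw [MulChar.map_nonunit _ fun hu => hx ⟨hu.unit, hu.unit_spec⟩, zero_mul])
    fun _ => rfl

/-- The value is `q ^ (deg f - 1)` times a Gauss sum over `F` times `L(1, χ)`. In `fourier_monicInd`
the terms free of the leading coefficient cancel on summing over constants, as `χ` is nontrivial
there; the rest yields the Gauss sum. -/
theorem fourier_twist_monicInd_ne_zero (hdeg : 0 < f.natDegree) {χ : MulChar (AdjoinRoot f) ℂ}
    (hχ : constChar χ ≠ 1) : fourier hf (twist χ (monicInd hf)) 1 ≠ 0 := by
  have hχ1 : χ ≠ 1 := by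
    rintro rfl
    refine hχ (MulChar.ext fun θ => ?_)
    rw [constChar_apply, MulChar.one_apply_coe, MulChar.one_apply]
    exact (isUnit_C.2 θ.isUnit).map _
  have hnt : Nontrivial (AdjoinRoot f) :=
    AdjoinRoot.nontrivial f (by rw [degree_eq_natDegree hf.ne_zero]; exact_mod_cast hdeg.ne')
  have hq : (Fintype.card F : ℂ) ≠ 0 := by exact_mod_cast Fintype.card_ne_zero
  set ψ := AddChar.FiniteField.primitiveChar_to_Complex F with hψ
  have key : fourier hf (twist χ (monicInd hf)) 1 =
      (Fintype.card F : ℂ) ^ (f.natDegree - 1) * gaussSum (constChar χ) ψ *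
        ∑ m ∈ Finset.range f.natDegree, lCoeff χ m * ((Fintype.card F : ℂ)⁻¹) ^ m := by
    rw [fourier_twist_one, ← sum_degLT_mk hf, ← Finset.sum_erase (a := 0) _ (by
      rw [map_zero, MulChar.map_zero, zero_mul]), sum_units_monicEq_sum, Finset.mul_sum]
    refine Finset.sum_congr rfl fun m hm => ?_
    rw [Finset.mem_range] at hm
    rw [lCoeff, Finset.sum_mul, Finset.mul_sum]
    refine Finset.sum_congr rfl fun v hv => ?_
    rw [mem_monicEq] at hv
    have h1 : ∀ θ : Fˣ, χ (AdjoinRoot.mk f (C (θ : F) * v)) *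
        fourier hf (monicInd hf) (AdjoinRoot.mk f (C (θ : F) * v)) =
        χ (AdjoinRoot.mk f v) * (constChar χ (θ : F) *
          ∑ j ∈ Finset.range (f.natDegree - 1 - m), (Fintype.card F : ℂ) ^ j) +
        χ (AdjoinRoot.mk f v) * ((Fintype.card F : ℂ) ^ (f.natDegree - 1 - m) *
          (constChar χ (θ : F) * ψ (θ : F))) := by
      intro θ
      rw [fourier_monicInd hf (d := m) (by rw [natDegree_C_mul θ.ne_zero, hv.2])
        (mul_ne_zero (C_ne_zero.2 θ.ne_zero) hv.1.ne_zero) hm, map_mul, map_mul, constChar_apply,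
        leadingCoeff_mul, leadingCoeff_C, hv.1, mul_one]
      ring
    simp only [h1]
    rw [Finset.sum_add_distrib, ← Finset.mul_sum, ← Finset.sum_mul, sum_constChar hχ, zero_mul,
      mul_zero, zero_add, ← Finset.mul_sum, ← Finset.mul_sum, sum_constChar_mul]
    have h2 : (Fintype.card F : ℂ) ^ (f.natDegree - 1) =
        (Fintype.card F : ℂ) ^ (f.natDegree - 1 - m) * (Fintype.card F : ℂ) ^ m := by
      rw [← pow_add]
      congr 1
      omega
    rw [h2, inv_pow]
    field_simp
  rw [key]
  refine mul_ne_zero (mul_ne_zero (pow_ne_zero _ hq) ?_) (sum_lCoeff_ne_zero hf hdeg hχ1)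
  exact gaussSum_ne_zero_of_nontrivial hq hχ
    (AddChar.FiniteField.primitiveChar_to_Complex_isPrimitive F)

theorem isDistribution_twist {φ : AdjoinRoot f → ℂ} {c : ℂ} (hφ : IsDistribution φ c)
    (χ : MulChar (AdjoinRoot f) ℂ) : IsDistribution (twist χ φ)
      (∑ u : (AdjoinRoot f)ˣ, χ ((u⁻¹ : (AdjoinRoot f)ˣ) : AdjoinRoot f) * c) :=
  IsDistribution.sum _ (fun u : (AdjoinRoot f)ˣ => χ ((u⁻¹ : (AdjoinRoot f)ˣ) : AdjoinRoot f))
    fun u _ => hφ.comp_mul u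

/-- Such a component is constant along multiplication by constants, while reflection with period
zero makes the sum over them vanish. -/
theorem twist_eq_zero {φ : AdjoinRoot f → ℂ} (hφ : IsDistribution φ 0)
    {χ : MulChar (AdjoinRoot f) ℂ} (hχ : constChar χ = 1) (x : AdjoinRoot f) : twist χ φ x = 0 := by
  have h1 := isDistribution_twist hφ χ
  simp only [mul_zero, Finset.sum_const_zero] at h1
  rcases eq_or_ne x 0 with rfl | hx
  · exact h1.map_zero
  have h2 := h1.reflection x hx
  have h3 : ∀ θ : Fˣ, twist χ φ (AdjoinRoot.mk f (C (θ : F)) * x) = twist χ φ x := by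
    intro θ
    have h4 : AdjoinRoot.mk f (C (θ : F)) =
      ((Units.map (AdjoinRoot.of f).toMonoidHom θ : (AdjoinRoot f)ˣ) : AdjoinRoot f) := rfl
    rw [h4, twist_mul, ← h4, ← constChar_apply, hχ, MulChar.one_apply_coe, one_mul]
  simp only [h3, Finset.sum_const, Finset.card_univ, nsmul_eq_mul] at h2
  refine (mul_eq_zero.1 h2).resolve_left ?_
  exact_mod_cast Fintype.card_ne_zero

/-- When `χ` is nontrivial on constants, `k` is chosen so that the difference has Fourier transform
zero at `1`. Being an eigenfunction, its transform vanishes at all units, hence everywhere by the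
dual relations. These apply because the period of the twisted indicator is a sum of a nontrivial
character, hence zero. -/
theorem exists_twist_eq_mul (hdeg : 0 < f.natDegree) {φ : AdjoinRoot f → ℂ}
    (hφ : IsDistribution φ 0) (χ : MulChar (AdjoinRoot f) ℂ) :
    ∃ k : ℂ, ∀ x, twist χ φ x = k * twist χ (monicInd hf) x := by
  by_cases hχ : constChar χ = 1
  · exact ⟨0, fun x => by rw [twist_eq_zero hφ hχ, zero_mul]⟩
  have hne := fourier_twist_monicInd_ne_zero hf hdeg hχ
  set k := fourier hf (twist χ φ) 1 / fourier hf (twist χ (monicInd hf)) 1 with hk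
  have hχ1 : ∑ u : (AdjoinRoot f)ˣ, χ ((u⁻¹ : (AdjoinRoot f)ˣ) : AdjoinRoot f) = 0 := by
    have hχ1 : χ ≠ 1 := by
      rintro rfl
      refine hχ (MulChar.ext fun θ => ?_)
      rw [constChar_apply, MulChar.one_apply_coe, MulChar.one_apply]
      exact (isUnit_C.2 θ.isUnit).map _
    rw [← MulChar.sum_eq_zero_of_ne_one hχ1, ← sum_units_eq_sum fun x hx => MulChar.map_nonunit _ hx]
    exact Fintype.sum_equiv (Equiv.inv _) _ _ fun u => rfl
  have h1 := isDistribution_twist hφ χ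
  have h2 := isDistribution_twist (isDistribution_monicInd hf) χ
  simp only [mul_zero, Finset.sum_const_zero] at h1
  simp only [mul_one, hχ1] at h2
  have h3 := h1.sub_mul h2 k
  rw [mul_zero, sub_zero] at h3
  have h4 : ∀ (v : (AdjoinRoot f)ˣ) (x : AdjoinRoot f),
      twist χ φ ((v : AdjoinRoot f) * x) - k * twist χ (monicInd hf) ((v : AdjoinRoot f) * x) =
      χ (v : AdjoinRoot f) * (twist χ φ x - k * twist χ (monicInd hf) x) := by
    intro v x
    rw [twist_mul, twist_mul]
    ring
  have h5 : fourier hf (fun x => twist χ φ x - k * twist χ (monicInd hf) x) 1 = 0 := by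
    have h6 : fourier hf (fun x => twist χ φ x - k * twist χ (monicInd hf) x) 1 =
        fourier hf (twist χ φ) 1 - k * fourier hf (twist χ (monicInd hf)) 1 := by
      simp only [fourier, sub_mul, Finset.sum_sub_distrib, Finset.mul_sum, mul_assoc]
    rw [h6, hk, div_mul_cancel₀ _ hne, sub_self]
  refine ⟨k, fun x => sub_eq_zero.1 (eq_zero_of_fourier_eq_zero hf
    (φ := fun x => twist χ φ x - k * twist χ (monicInd hf) x) (fun w => ?_) x)⟩
  refine eq_zero_of_sum_add_mk_mul hf ?_ (fun g h hg hh hgh w =>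
    sum_fourier_add_mk_mul hf h3 hg hh hgh w) w
  rintro _ ⟨u, rfl⟩
  rw [fourier_eigen hf h4, h5, mul_zero]

/-- Every distribution is a linear combination of the dilates of `monicInd`. -/
theorem IsDistribution.exists_eq_sum (hdeg : 0 < f.natDegree) {φ : AdjoinRoot f → ℂ} {c : ℂ}
    (hφ : IsDistribution φ c) : ∃ k : (AdjoinRoot f)ˣ → ℂ, ∀ x,
      φ x = ∑ u, k u * monicInd hf ((u : AdjoinRoot f) * x) := by
  have : Fintype (MulChar (AdjoinRoot f) ℂ) := Fintype.ofFinite _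
  -- Subtracting `c` times the monic indicator, which has period `1`, reduces to period zero.
  have h1 := hφ.sub_mul (isDistribution_monicInd hf) c
  rw [mul_one, sub_self] at h1
  choose k hk using exists_twist_eq_mul hf hdeg h1
  set N : ℂ := (Fintype.card (MulChar (AdjoinRoot f) ℂ) : ℂ) with hN
  have hN0 : N ≠ 0 := by
    rw [hN]
    exact_mod_cast Fintype.card_ne_zero
  have h2 : ∀ x, ∑ χ : MulChar (AdjoinRoot f) ℂ,
      twist χ (fun x => φ x - c * monicInd hf x) x = N * (φ x - c * monicInd hf x) := by
    intro x
    simp only [twist]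
    rw [Finset.sum_comm, Finset.sum_eq_single 1]
    · simp [hN]
      ring
    · intro u _ hu
      rw [← Finset.sum_mul, sum_mulChar_eq_zero, zero_mul]
      intro h
      rw [Units.val_eq_one, inv_eq_one] at h
      exact hu h
    · exact fun h => absurd (Finset.mem_univ _) h
  refine ⟨fun u => (if u = 1 then c else 0) + N⁻¹ * ∑ χ : MulChar (AdjoinRoot f) ℂ,
    k χ * χ ((u⁻¹ : (AdjoinRoot f)ˣ) : AdjoinRoot f), fun x => ?_⟩
  have h3 : φ x = c * monicInd hf x + N⁻¹ * ∑ χ : MulChar (AdjoinRoot f) ℂ,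
      k χ * twist χ (monicInd hf) x := by
    rw [← Finset.sum_congr rfl fun χ _ => hk χ x, h2, inv_mul_cancel_left₀ hN0]
    ring
  rw [h3]
  simp only [add_mul, Finset.sum_add_distrib, twist, ite_mul, zero_mul, Finset.sum_ite_eq',
    Finset.mem_univ, if_true, Units.val_one, one_mul]
  congr 1
  simp only [Finset.mul_sum, Finset.sum_mul]
  rw [Finset.sum_comm]
  exact Finset.sum_congr rfl fun u _ => Finset.sum_congr rfl fun χ _ => by ring

end Twists

/-! ### Brackets in terms of the monic indicator -/

section Brackets

variable {F : Type*} [Field F] {f : F[X]} (hf : f.Monic)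

open Classical in
/-- The integral version of `monicInd`. -/
def monicIndInt (x : AdjoinRoot f) : ℤ := if (AdjoinRoot.modByMonicHom hf x).Monic then 1 else 0

theorem monicIndInt_cast (x : AdjoinRoot f) : (monicIndInt hf x : ℂ) = monicInd hf x := by
  rw [monicIndInt, monicInd]
  split_ifs <;> simp

theorem exists_rep_eq (c : AdjoinRoot f) : ∃ a : F[X], a.degree < f.natDegree ∧
    AdjoinRoot.mk f a = c ∧ AdjoinRoot.modByMonicHom hf c = a ∧
    rep hf c = algebraMap F[X] (RatFunc F) a / algebraMap F[X] (RatFunc F) f := by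
  obtain ⟨a, ha, rfl⟩ := exists_mk_eq hf c
  have ha' : a.degree < f.degree := by rwa [degree_eq_natDegree hf.ne_zero]
  exact ⟨a, ha, rfl, by rw [AdjoinRoot.modByMonicHom_mk, (modByMonic_eq_self_iff hf).2 ha'],
    rep_mk hf ha'⟩

variable [Fintype F]

theorem inftyAbs_rep (c : AdjoinRoot f) : inftyAbs F (rep hf c) < 1 := by
  obtain ⟨a, ha, -, -, h⟩ := exists_rep_eq hf c
  have h0 : inftyAbs F (0 : RatFunc F) < 1 := by simp
  rw [h]
  simpa only [zero_add] using inftyAbs_div_polynomial_lt hf.ne_zero h0 ha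

theorem inftyAbs_polynomial_lt_iff {a b : F[X]} (hb : b ≠ 0) :
    inftyAbs F (algebraMap F[X] (RatFunc F) a) < inftyAbs F (algebraMap F[X] (RatFunc F) b) ↔
      a.degree < b.degree := by
  have hq := one_lt_card_real (F := F)
  rw [inftyAbs_polynomial hb, degree_eq_natDegree hb]
  rcases eq_or_ne a 0 with rfl | ha
  · have : (0 : ℝ) < (Fintype.card F : ℝ) ^ b.natDegree := by positivity
    simpa using this
  · rw [inftyAbs_polynomial ha, pow_lt_pow_iff_right₀ hq, degree_eq_natDegree ha]
    exact_mod_cast Iff.rfl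

theorem diamondN_eq_one_iff (N : ℕ) {x : RatFunc F} (hx : inftyAbs F x < 1) :
    diamondN N (algebraMap (RatFunc F) (KInfty F) x) = 1 ↔
      inftyAbs F (x - RatFunc.X ^ (-(N : ℤ) - 1)) < inftyAbs F (RatFunc.X ^ (-(N : ℤ) - 1)) := by
  set y : RatFunc F := RatFunc.X ^ (-(N : ℤ) - 1) with hy
  have hq := one_lt_card_real (F := F)
  have hy1 : inftyAbs F y < 1 := by
    rw [hy, map_zpow₀, inftyAbs_X]
    exact zpow_lt_one_of_neg₀ hq (by omega)
  have h1 : ∀ a : F[X], ‖algebraMap (RatFunc F) (KInfty F) x -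
      algebraMap (RatFunc F) (KInfty F) (algebraMap F[X] (RatFunc F) a) -
        (algebraMap (RatFunc F) (KInfty F) RatFunc.X) ^ (-(N : ℤ) - 1)‖ =
      inftyAbs F (x - y - algebraMap F[X] (RatFunc F) a) := by
    intro a
    rw [← map_zpow₀, ← map_sub, ← map_sub, KInfty.norm_coe, sub_right_comm]
  have h2 : ‖algebraMap (RatFunc F) (KInfty F) RatFunc.X‖ ^ (-(N : ℤ) - 1) = inftyAbs F y := by
    rw [KInfty.norm_coe, hy, map_zpow₀]
  have hxy : inftyAbs F (x - y) < 1 := by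
    rw [sub_eq_add_neg]
    exact (inftyAbs_add_le_max F _ _).trans_lt (max_lt hx (by rwa [map_neg_eq_map]))
  unfold diamondN
  rw [h2]
  simp only [h1]
  -- Only `a = 0` matters for the infimum: as `|x - y| < 1`, a nonzero `a` keeps the distance at
  -- least `1`, above `|y|`.
  have h3 : (⨅ a : F[X], inftyAbs F (x - y - algebraMap F[X] (RatFunc F) a)) < inftyAbs F y ↔
      inftyAbs F (x - y) < inftyAbs F y := by
    constructor
    · intro h
      obtain ⟨a, ha⟩ := exists_lt_of_ciInf_lt h
      rcases eq_or_ne a 0 with rfl | ha0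
      · simpa using ha
      · exfalso
        have h4 := inftyAbs_add_le_max F (x - y) (-(x - y - algebraMap F[X] (RatFunc F) a))
        rw [map_neg_eq_map] at h4
        have h5 : x - y + -(x - y - algebraMap F[X] (RatFunc F) a) =
            algebraMap F[X] (RatFunc F) a := by ring
        rw [h5] at h4
        exact absurd ((one_le_inftyAbs_polynomial ha0).trans h4)
          (not_le.2 (max_lt hxy (ha.trans hy1)))
    · intro h
      refine (ciInf_le ⟨0, ?_⟩ 0).trans_lt (by simpa using h)
      rintro _ ⟨a, rfl⟩
      exact (inftyAbs F).nonneg _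
  rw [← h3]
  split_ifs with h
  · simp [h]
  · simp [h]

theorem diamondN_rep_eq_one_iff (N : ℕ) (c : AdjoinRoot f) :
    diamondN N (algebraMap (RatFunc F) (KInfty F) (rep hf c)) = 1 ↔
      (AdjoinRoot.modByMonicHom hf c).Monic ∧
        (AdjoinRoot.modByMonicHom hf c).natDegree + N + 1 = f.natDegree := by
  rw [diamondN_eq_one_iff N (inftyAbs_rep hf c)]
  obtain ⟨a, ha, -, h1, h2⟩ := exists_rep_eq hf c
  rw [h1, h2]
  have hX : (RatFunc.X : RatFunc F) ≠ 0 := RatFunc.X_ne_zero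
  have hf0 : algebraMap F[X] (RatFunc F) f ≠ 0 := by simpa using hf.ne_zero
  -- Clearing denominators by `g` turns the condition into `deg (a * X ^ (N + 1) - f) < deg f`: `a`
  -- is monic of degree `deg f - N - 1`.
  set g : RatFunc F := RatFunc.X ^ (N + 1) * algebraMap F[X] (RatFunc F) f with hg
  have hg0 : g ≠ 0 := mul_ne_zero (pow_ne_zero _ hX) hf0
  have hgpos : 0 < inftyAbs F g := (inftyAbs F).pos hg0
  have hz : (RatFunc.X : RatFunc F) ^ (-(N : ℤ) - 1) = (RatFunc.X ^ (N + 1))⁻¹ := by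
    rw [← zpow_natCast, ← zpow_neg]
    congr 1
    push_cast
    ring
  rw [hz, ← mul_lt_mul_iff_left₀ hgpos, ← map_mul, ← map_mul]
  have h3 : (algebraMap F[X] (RatFunc F) a / algebraMap F[X] (RatFunc F) f -
      (RatFunc.X ^ (N + 1))⁻¹) * g = algebraMap F[X] (RatFunc F) (a * X ^ (N + 1) - f) := by
    rw [hg, map_sub, map_mul, map_pow, RatFunc.algebraMap_X]
    field_simp
  have h4 : (RatFunc.X ^ (N + 1))⁻¹ * g = algebraMap F[X] (RatFunc F) f := by
    rw [hg, inv_mul_cancel_left₀ (pow_ne_zero _ hX)]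
  rw [h3, h4, inftyAbs_polynomial_lt_iff hf.ne_zero]
  constructor
  · intro h
    have h5 : a * X ^ (N + 1) = f + (a * X ^ (N + 1) - f) := by ring
    have h6 : (a * X ^ (N + 1)).Monic := by
      rw [h5]
      exact hf.add_of_left h
    have h7 : (a * X ^ (N + 1)).natDegree = f.natDegree := by
      rw [h5, natDegree_add_eq_left_of_degree_lt h]
    have h8 : a.Monic := (monic_X_pow (N + 1)).of_mul_monic_right h6
    rw [h8.natDegree_mul (monic_X_pow _), natDegree_X_pow] at h7
    exact ⟨h8, by omega⟩
  · rintro ⟨h5, h6⟩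
    have h7 : (a * X ^ (N + 1)).Monic := h5.mul (monic_X_pow _)
    have h8 : (a * X ^ (N + 1)).natDegree = f.natDegree := by
      rw [h5.natDegree_mul (monic_X_pow _), natDegree_X_pow]
      omega
    have h9 : (a * X ^ (N + 1)).degree = f.degree := by
      rw [degree_eq_natDegree h7.ne_zero, degree_eq_natDegree hf.ne_zero, h8]
    rw [← h9]
    exact degree_sub_lt_left h9 h7.ne_zero (by rw [h7.leadingCoeff, hf.leadingCoeff])

theorem diamondN_rep (N : ℕ) (c : AdjoinRoot f) :
    diamondN N (algebraMap (RatFunc F) (KInfty F) (rep hf c)) =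
      if N + 1 + (AdjoinRoot.modByMonicHom hf c).natDegree = f.natDegree then monicIndInt hf c
      else 0 := by
  have h := diamondN_rep_eq_one_iff hf N c
  have h01 : diamondN N (algebraMap (RatFunc F) (KInfty F) (rep hf c)) = 1 ∨
      diamondN N (algebraMap (RatFunc F) (KInfty F) (rep hf c)) = 0 := by
    unfold diamondN
    split_ifs <;> simp
  by_cases h1 : diamondN N (algebraMap (RatFunc F) (KInfty F) (rep hf c)) = 1
  · rw [h1]
    obtain ⟨h2, h3⟩ := h.1 h1
    rw [if_pos (by omega), monicIndInt, if_pos h2]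
  · rw [h01.resolve_left h1]
    rw [h] at h1
    split_ifs with h2
    · rw [monicIndInt, if_neg fun h3 => h1 ⟨h3, by omega⟩]
    · rfl

/-- A class with monic representative `b` is seen by exactly one bracket, `N = deg f - 1 - deg b`;
all other classes are seen by none. -/
theorem bracket_eq (a : AGroup f) : bracket hf a = a.sum fun c n => monicIndInt hf c * n := by
  have h1 : ∀ N, bracketN hf N a = a.sum fun c n =>
      (if N + 1 + (AdjoinRoot.modByMonicHom hf c).natDegree = f.natDegree then monicIndInt hf c
        else 0) * n := by
    intro N
    rw [bracketN, Finsupp.liftAddHom_apply]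
    exact Finsupp.sum_congr fun c _ => by
      rw [AddMonoidHom.coe_mulLeft, diamondN_rep]
  have h2 : Function.support (fun N => bracketN hf N a) ⊆ Finset.range f.natDegree := by
    intro N hN
    by_contra h3
    refine hN ?_
    simp only [h1]
    refine Finset.sum_eq_zero fun c _ => ?_
    rw [Finset.coe_range, Set.mem_Iio] at h3
    beta_reduce
    rw [if_neg (by omega), zero_mul]
  rw [bracket, finsum_eq_sum_of_support_subset _ h2]
  simp only [h1, Finsupp.sum]
  rw [Finset.sum_comm]
  refine Finset.sum_congr rfl fun c _ => ?_
  rw [← Finset.sum_mul]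
  congr 1
  by_cases hc : (AdjoinRoot.modByMonicHom hf c).Monic
  · obtain ⟨b, hb, -, hb', -⟩ := exists_rep_eq hf c
    rw [hb'] at hc ⊢
    rw [degree_eq_natDegree hc.ne_zero] at hb
    norm_cast at hb
    rw [Finset.sum_eq_single (f.natDegree - 1 - b.natDegree)]
    · rw [if_pos (by omega)]
    · intro N _ hN
      rw [if_neg (by omega)]
    · intro h
      rw [Finset.mem_range] at h
      omega
  · rw [monicIndInt, if_neg hc]
    simp

/-- The vector of the brackets of all translates of an element of `𝒜_f`. -/
def bracketVec : AGroup f →ₗ[ℤ] ((AdjoinRoot f)ˣ → ℤ) :=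
  Finsupp.linearCombination ℤ fun x u => monicIndInt hf ((u : AdjoinRoot f) * x)

omit [Fintype F] in
theorem bracketVec_apply (a : AGroup f) (u : (AdjoinRoot f)ˣ) :
    bracketVec hf a u = a.sum fun c n => monicIndInt hf ((u : AdjoinRoot f) * c) * n := by
  rw [bracketVec, Finsupp.linearCombination_apply, Finsupp.sum, Finsupp.sum, Finset.sum_apply]
  exact Finset.sum_congr rfl fun c _ => by rw [Pi.smul_apply, smul_eq_mul, mul_comm]

theorem bracket_star {b : F[X]} {u : (AdjoinRoot f)ˣ} (hb : AdjoinRoot.mk f b = u) (a : AGroup f) :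
    bracket hf (star f b a) = bracketVec hf a u := by
  rw [bracketVec_apply, bracket_eq, star, Finsupp.mapDomain.addMonoidHom_apply,
    Finsupp.sum_mapDomain_index (by simp) (by intros; ring), hb]

theorem sim_iff (a b : AGroup f) : Sim hf a b ↔ bracketVec hf a = bracketVec hf b := by
  constructor
  · intro h
    funext u
    obtain ⟨c, hc, hcu⟩ := exists_mk_eq hf (u : AdjoinRoot f)
    obtain ⟨d, hd⟩ := AdjoinRoot.mk_surjective ((u⁻¹ : (AdjoinRoot f)ˣ) : AdjoinRoot f)
    have h1 : IsCoprime c f := by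
      have h2 : AdjoinRoot.mk f (d * c - 1) = 0 := by
        rw [map_sub, map_mul, hd, hcu, Units.inv_mul, map_one, sub_self]
      obtain ⟨e, he⟩ := AdjoinRoot.mk_eq_zero.1 h2
      exact ⟨d, -e, by linear_combination he⟩
    rw [← bracket_star hf hcu, ← bracket_star hf hcu]
    exact h c h1 (by rwa [degree_eq_natDegree hf.ne_zero])
  · intro h c ⟨d, e, hde⟩ _
    have h1 : AdjoinRoot.mk f c * AdjoinRoot.mk f d = 1 := by
      have := congrArg (AdjoinRoot.mk f) hde
      rwa [map_add, map_mul, map_mul, AdjoinRoot.mk_self, mul_zero, add_zero, map_one,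
        mul_comm] at this
    rw [bracket_star hf (u := Units.mkOfMulEqOne _ _ h1) rfl,
      bracket_star hf (u := Units.mkOfMulEqOne _ _ h1) rfl, h]

end Brackets

/-! ### Algebraic `Π`-monomials -/

section Monomials

open Classical

variable {F : Type*} [Field F] [Fintype F] {f : F[X]} (hf : f.Monic)

theorem Pi_rep_ne_zero (c : AdjoinRoot f) :
    Pi (algebraMap (RatFunc F) (CInfty F) (rep hf c)) ≠ 0 :=
  Pi_ne_zero (inftyAbs_rep hf c)

theorem PiMonomial_single (c : AdjoinRoot f) (n : ℤ) : PiMonomial hf (Finsupp.single c n) =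
    Pi (algebraMap (RatFunc F) (CInfty F) (rep hf c)) ^ n :=
  Finsupp.prod_single_index (zpow_zero _)

theorem PiMonomial_zero : PiMonomial hf 0 = 1 := Finsupp.prod_zero_index

theorem PiMonomial_add (a b : AGroup f) :
    PiMonomial hf (a + b) = PiMonomial hf a * PiMonomial hf b :=
  Finsupp.prod_add_index' (fun _ => zpow_zero _)
    fun c _ _ => zpow_add₀ (Pi_rep_ne_zero hf c) _ _

theorem PiMonomial_ne_zero (a : AGroup f) : PiMonomial hf a ≠ 0 :=
  Finset.prod_ne_zero_iff.2 fun c _ => zpow_ne_zero _ (Pi_rep_ne_zero hf c)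

theorem PiMonomial_neg (a : AGroup f) : PiMonomial hf (-a) = (PiMonomial hf a)⁻¹ := by
  refine eq_inv_of_mul_eq_one_left ?_
  rw [← PiMonomial_add, neg_add_cancel, PiMonomial_zero]

theorem PiMonomial_sub (a b : AGroup f) :
    PiMonomial hf (a - b) = PiMonomial hf a / PiMonomial hf b := by
  rw [sub_eq_add_neg, PiMonomial_add, PiMonomial_neg, div_eq_mul_inv]

theorem PiMonomial_nsmul (n : ℕ) (a : AGroup f) : PiMonomial hf (n • a) = PiMonomial hf a ^ n := by
  induction n with
  | zero => rw [zero_smul, PiMonomial_zero, pow_zero]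
  | succ n ih => rw [succ_nsmul, PiMonomial_add, ih, pow_succ]

theorem PiMonomial_zsmul (n : ℤ) (a : AGroup f) : PiMonomial hf (n • a) = PiMonomial hf a ^ n := by
  obtain ⟨m, rfl | rfl⟩ := n.eq_nat_or_neg
  · rw [natCast_zsmul, PiMonomial_nsmul, zpow_natCast]
  · rw [neg_smul, natCast_zsmul, PiMonomial_neg, PiMonomial_nsmul, zpow_neg, zpow_natCast]

theorem PiMonomial_sum {ι : Type*} (s : Finset ι) (a : ι → AGroup f) :
    PiMonomial hf (∑ i ∈ s, a i) = ∏ i ∈ s, PiMonomial hf (a i) := by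
  induction s using Finset.induction_on with
  | empty => rw [Finset.sum_empty, Finset.prod_empty, PiMonomial_zero]
  | insert i s hi ih => rw [Finset.sum_insert hi, Finset.prod_insert hi, PiMonomial_add, ih]

/-- The elements of `𝒜_f` whose `Π`-monomials are algebraic over `k`. -/
def algebraicMonomials : Submodule ℤ (AGroup f) where
  carrier := {a | PiMonomial hf a ∈ KBar F}
  add_mem' {a b} ha hb := by
    rw [Set.mem_ofPred_eq, PiMonomial_add]
    exact mul_mem ha hb
  zero_mem' := by
    rw [Set.mem_ofPred_eq, PiMonomial_zero]
    exact one_mem _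
  smul_mem' n a ha := by
    rw [Set.mem_ofPred_eq, PiMonomial_zsmul]
    exact zpow_mem ha n

theorem mem_algebraicMonomials {a : AGroup f} :
    a ∈ algebraicMonomials hf ↔ PiMonomial hf a ∈ KBar F := Iff.rfl

theorem mem_algebraicMonomials_of_smul {n : ℤ} (hn : n ≠ 0) {a : AGroup f}
    (h : n • a ∈ algebraicMonomials hf) : a ∈ algebraicMonomials hf := by
  have h1 : (n.natAbs : ℤ) • a ∈ algebraicMonomials hf := by
    rcases n.natAbs_eq with h2 | h2
    · rwa [← h2]
    · have h3 : (n.natAbs : ℤ) = -n := by omega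
      rw [h3, neg_smul]
      exact neg_mem h
  rw [mem_algebraicMonomials, natCast_zsmul, PiMonomial_nsmul, mem_algebraicClosure_iff] at h1
  rw [mem_algebraicMonomials, mem_algebraicClosure_iff]
  exact h1.of_pow (Int.natAbs_pos.2 hn)

/-- Roots of algebraic elements are algebraic. Torsion-freeness makes this finitely generated
quotient free, so that its integral functionals separate points. -/
instance : Module.IsTorsionFree ℤ (AGroup f ⧸ algebraicMonomials hf) where
  isSMulRegular n hn := by
    intro x y hxy
    obtain ⟨a, rfl⟩ := Submodule.Quotient.mk_surjective _ x
    obtain ⟨b, rfl⟩ := Submodule.Quotient.mk_surjective _ y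
    rw [Submodule.Quotient.eq]
    refine mem_algebraicMonomials_of_smul hf hn.ne_zero ?_
    rw [smul_sub, ← Submodule.Quotient.eq]
    exact hxy

omit [Fintype F] in
theorem rep_smul (θ : Fˣ) (x : AdjoinRoot f) :
    rep hf (AdjoinRoot.mk f (C (θ : F)) * x) = (θ : F) • rep hf x := by
  have h : AdjoinRoot.mk f (C (θ : F)) * x = (θ : F) • x := by
    rw [AdjoinRoot.mk_C, Algebra.smul_def, AdjoinRoot.algebraMap_eq]
  rw [h, rep, rep, map_smul, smul_eq_C_mul, map_mul, mul_div_assoc, Algebra.smul_def]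
  rfl

theorem PiMonomial_sum_units (x : AdjoinRoot f) :
    PiMonomial hf (∑ θ : Fˣ, Finsupp.single (AdjoinRoot.mk f (C (θ : F)) * x) 1) =
      rho (rep hf x) := by
  rw [PiMonomial_sum, rho]
  exact Finset.prod_congr rfl fun θ _ => by rw [PiMonomial_single, zpow_one, rep_smul]

omit [Fintype F] in
theorem rep_ne_zero {x : AdjoinRoot f} (hx : x ≠ 0) : rep hf x ≠ 0 := by
  obtain ⟨a, ha, rfl, -, h⟩ := exists_rep_eq hf x
  rw [h]
  refine div_ne_zero ?_ (by simpa using hf.ne_zero)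
  rw [Ne, FaithfulSMul.algebraMap_eq_zero_iff]
  rintro rfl
  exact hx (map_zero _)

theorem sum_units_sub_mem {x y : AdjoinRoot f} (hx : x ≠ 0) (hy : y ≠ 0) :
    ∑ θ : Fˣ, Finsupp.single (AdjoinRoot.mk f (C (θ : F)) * x) 1 -
      ∑ θ : Fˣ, Finsupp.single (AdjoinRoot.mk f (C (θ : F)) * y) 1 ∈ algebraicMonomials hf := by
  rw [mem_algebraicMonomials, PiMonomial_sub, PiMonomial_sum_units, PiMonomial_sum_units,
    mem_algebraicClosure_iff]
  exact isAlgebraic_rho_div (inftyAbs_rep hf x) (inftyAbs_rep hf y) (rep_ne_zero hf hx)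
    (rep_ne_zero hf hy)

theorem single_zero_mem : Finsupp.single 0 1 ∈ algebraicMonomials hf := by
  rw [mem_algebraicMonomials, PiMonomial_single, rep, map_zero, map_zero, zero_div, Pi_zero,
    one_zpow]
  exact one_mem _

/-- The multiplication formula at `x = b / h`, since `(x + t) / g = (b + h t) / f` and `x = g b /
f`. -/
theorem sum_degLT_sub_mem {g h : F[X]} (hg : g.Monic) (hh : h.Monic) (hgh : g * h = f) {b : F[X]}
    (hb : b.degree < h.natDegree) {y : AdjoinRoot f} (hy : y ≠ 0) :
    ∑ t ∈ degLT F g.natDegree, Finsupp.single (AdjoinRoot.mk f (b + h * t)) 1 -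
      (Finsupp.single (AdjoinRoot.mk f (g * b)) 1 + (monicLT F g.natDegree).card •
        ∑ θ : Fˣ, Finsupp.single (AdjoinRoot.mk f (C (θ : F)) * y) 1) ∈ algebraicMonomials hf := by
  have hfgh : f.degree = g.degree + h.degree := by rw [← hgh, degree_mul]
  have hg0 : algebraMap F[X] (RatFunc F) g ≠ 0 := by simpa using hg.ne_zero
  have hh0 : algebraMap F[X] (RatFunc F) h ≠ 0 := by simpa using hh.ne_zero
  have hfa : algebraMap F[X] (RatFunc F) f =
      algebraMap F[X] (RatFunc F) g * algebraMap F[X] (RatFunc F) h := by rw [← map_mul, hgh]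
  have hb' : b.degree < h.degree := by rwa [degree_eq_natDegree hh.ne_zero]
  set x : RatFunc F := algebraMap F[X] (RatFunc F) b / algebraMap F[X] (RatFunc F) h with hx
  have hx1 : inftyAbs F x < 1 := by
    have h0 : inftyAbs F (0 : RatFunc F) < 1 := by simp
    simpa only [zero_add] using inftyAbs_div_polynomial_lt hh.ne_zero h0 hb
  have h1 : ∀ t ∈ degLT F g.natDegree, rep hf (AdjoinRoot.mk f (b + h * t)) =
      (x + algebraMap F[X] (RatFunc F) t) / algebraMap F[X] (RatFunc F) g := by
    intro t ht
    rw [mem_degLT, ← degree_eq_natDegree hg.ne_zero] at ht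
    have h2 : (h * t).degree < f.degree := by
      rw [hfgh, degree_mul, add_comm, degree_eq_natDegree hh.ne_zero]
      exact WithBot.add_lt_add_right (WithBot.natCast_ne_bot _) ht
    have h3 : b.degree < f.degree := by
      refine hb'.trans_le ?_
      rw [hfgh, degree_eq_natDegree hg.ne_zero, degree_eq_natDegree hh.ne_zero]
      exact_mod_cast Nat.le_add_left _ _
    rw [rep_mk hf ((degree_add_le _ _).trans_lt (max_lt h3 h2)), hfa, hx, map_add, map_mul]
    field_simp
  have h2 : rep hf (AdjoinRoot.mk f (g * b)) = x := by
    have h3 : (g * b).degree < f.degree := by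
      rw [hfgh, degree_mul, degree_eq_natDegree hg.ne_zero]
      exact WithBot.add_lt_add_left (WithBot.natCast_ne_bot _) hb'
    rw [rep_mk hf h3, hfa, hx, map_mul]
    field_simp
  rw [mem_algebraicMonomials, PiMonomial_sub, PiMonomial_add, PiMonomial_nsmul,
    PiMonomial_sum_units, PiMonomial_sum, mem_algebraicClosure_iff, PiMonomial_single, zpow_one, h2]
  have h3 := isAlgebraic_prod_Pi_div hx1 (inftyAbs_rep hf y) (rep_ne_zero hf hy) hg
  rwa [Finset.prod_congr rfl fun t ht => by rw [PiMonomial_single, zpow_one, h1 t ht]]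

/-- A `Π`-monomial whose brackets all vanish is algebraic over `k`. -/
theorem mem_algebraicMonomials_of_bracketVec (hdeg : 0 < f.natDegree) {a : AGroup f}
    (ha : bracketVec hf a = 0) : a ∈ algebraicMonomials hf := by
  have := finite_adjoinRoot hf
  have : Fintype (AdjoinRoot f) := Fintype.ofFinite _
  have : Nontrivial (AdjoinRoot f) :=
    AdjoinRoot.nontrivial f (by rw [degree_eq_natDegree hf.ne_zero]; exact_mod_cast hdeg.ne')
  have : Module.Finite ℤ (AGroup f) := Module.Finite.finsupp
  have : Module.Free ℤ (AGroup f ⧸ algebraicMonomials hf) :=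
    Module.free_of_finite_type_torsion_free'
  rw [← Submodule.Quotient.mk_eq_zero]
  refine (Module.forall_dual_apply_eq_zero_iff ℤ _).1 fun φ => ?_
  set ψ : AGroup f →ₗ[ℤ] ℤ := φ ∘ₗ (algebraicMonomials hf).mkQ with hψ
  have hker : ∀ b ∈ algebraicMonomials hf, ψ b = 0 := fun b hb => by
    rw [hψ, LinearMap.comp_apply, Submodule.mkQ_apply, (Submodule.Quotient.mk_eq_zero _).2 hb,
      map_zero]
  -- A functional that kills the algebraic monomials satisfies both functional equations exactly;
  -- its period is its value on the orbit of `1` under constants.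
  have hdist : IsDistribution (fun x : AdjoinRoot f => (ψ (Finsupp.single x 1) : ℂ))
      (ψ (∑ θ : Fˣ, Finsupp.single (AdjoinRoot.mk f (C (θ : F)) * 1) 1) : ℤ) := by
    refine isDistribution_of_sum_degLT hf ?_ ?_ ?_
    · rw [hker _ (single_zero_mem hf), Int.cast_zero]
    · intro x hx
      have h := hker _ (sum_units_sub_mem hf hx one_ne_zero)
      rw [map_sub, sub_eq_zero] at h
      rw [← h, map_sum, Int.cast_sum]
    · intro g h hg hh hgh b hb
      have h := hker _ (sum_degLT_sub_mem hf hg hh hgh hb one_ne_zero)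
      rw [map_sub, sub_eq_zero, map_add, map_nsmul] at h
      rw [← Int.cast_sum, ← map_sum, h]
      push_cast
      rw [nsmul_eq_mul]
      push_cast
      rfl
  obtain ⟨k, hk⟩ := hdist.exists_eq_sum hf hdeg
  -- By the classification `ψ` factors through the bracket vector, so it kills `a`.
  have h1 : ((ψ a : ℤ) : ℂ) = ∑ u, k u * (bracketVec hf a u : ℤ) := by
    conv_lhs => rw [← Finsupp.sum_single a]
    rw [Finsupp.sum, map_sum]
    simp only [bracketVec_apply, Finsupp.sum]
    push_cast
    simp only [Finset.mul_sum]
    rw [Finset.sum_comm]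
    refine Finset.sum_congr rfl fun c _ => ?_
    have h2 : Finsupp.single c (a c) = a c • Finsupp.single c 1 := by simp
    rw [h2, map_smul, smul_eq_mul, Int.cast_mul, hk c, Finset.mul_sum]
    exact Finset.sum_congr rfl fun u _ => by rw [monicIndInt_cast]; ring
  have h2 : ψ a = 0 := by simpa [ha] using h1
  exact h2

end Monomials

/-! ### Rank of the lattice of bracket vectors -/

/-- The rank of a lattice in `ℤ^ι` is the dimension of the rational space it spans. -/
theorem finrank_span_intCast {ι κ : Type*} [Finite ι] (L : Submodule ℤ (ι → ℤ)) (v : κ → ι → ℤ)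
    (hv : Submodule.span ℤ (Set.range v) = L) :
    Module.finrank ℤ L =
      Module.finrank ℚ (Submodule.span ℚ (Set.range fun j i => (v j i : ℚ))) := by
  let T : (ι → ℤ) →ₗ[ℤ] (ι → ℚ) :=
    { toFun := fun w i => (w i : ℚ)
      map_add' := fun w w' => by ext i; simp
      map_smul' := fun n w => by ext i; simp }
  have hT : LinearMap.ker T = ⊥ := by
    rw [LinearMap.ker_eq_bot]
    intro w w' h
    funext i
    have hi : (w i : ℚ) = w' i := congrFun h i
    exact_mod_cast hi
  let b := Module.Free.chooseBasis ℤ L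
  have h1 : LinearIndependent ℤ fun i => (b i : ι → ℤ) :=
    b.linearIndependent.map' L.subtype L.ker_subtype
  have h2 : LinearIndependent ℚ fun i => T (b i) :=
    (LinearIndependent.iff_fractionRing ℤ ℚ).1 (h1.map' T hT)
  have h3 : Submodule.span ℤ (Set.range fun i => (b i : ι → ℤ)) = L := by
    have h := congrArg (Submodule.map L.subtype) b.span_eq
    rwa [Submodule.map_span, Submodule.map_top, Submodule.range_subtype, ← Set.range_comp] at h
  have h4 : ∀ {μ : Type _} (w : μ → ι → ℤ), Submodule.span ℤ (Set.range w) = L →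
      Submodule.span ℚ (Set.range fun j => T (w j)) = Submodule.span ℚ (T '' L) := by
    intro μ w hw
    rw [← hw, ← Submodule.map_coe, Submodule.map_span, Submodule.span_span_of_tower,
      ← Set.range_comp]
    rfl
  have h5 : Submodule.span ℚ (Set.range fun j i => (v j i : ℚ)) =
      Submodule.span ℚ (Set.range fun i => T (b i)) := by
    rw [h4 _ h3]
    have h := congrArg (fun M : Submodule ℤ (ι → ℤ) => Submodule.span ℚ (T '' M)) hv
    rw [← h, ← Submodule.map_coe, Submodule.map_span, Submodule.span_span_of_tower,
      ← Set.range_comp]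
    rfl
  rw [h5, finrank_span_eq_card h2, Module.finrank_eq_card_basis b]

section Rank

open Classical

variable {F : Type*} [Field F] [Fintype F] {f : F[X]} (hf : f.Monic)

/-- The constants, as units modulo `f`. -/
def constUnits (f : F[X]) : Fˣ →* (AdjoinRoot f)ˣ := Units.map (AdjoinRoot.of f).toMonoidHom

omit [Fintype F] in
theorem coe_constUnits (θ : Fˣ) :
    (constUnits f θ : AdjoinRoot f) = AdjoinRoot.mk f (C (θ : F)) := rfl

variable [Fintype (AdjoinRoot f)]

-- A linear relation among dilates of the monic indicator, projected to the `χ`-component: either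
-- the character sum of the coefficients vanishes or the `χ`-component of the indicator does.
omit [Fintype F] in
theorem sum_twist (lam : (AdjoinRoot f)ˣ → ℂ) (χ : MulChar (AdjoinRoot f) ℂ) (x : AdjoinRoot f)
    (h : ∀ y, ∑ u, lam u * monicInd hf ((u : AdjoinRoot f) * y) = 0) :
    (∑ u, lam u * χ (u : AdjoinRoot f)) * twist χ (monicInd hf) x = 0 := by
  have h1 : ∀ u : (AdjoinRoot f)ˣ, χ (u : AdjoinRoot f) * twist χ (monicInd hf) x =
      ∑ w : (AdjoinRoot f)ˣ, χ ((w⁻¹ : (AdjoinRoot f)ˣ) : AdjoinRoot f) *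
        monicInd hf ((u : AdjoinRoot f) * ((w : AdjoinRoot f) * x)) := by
    intro u
    rw [← twist_mul, twist]
    exact Finset.sum_congr rfl fun w _ => by rw [mul_left_comm]
  simp only [Finset.sum_mul, mul_assoc, h1, Finset.mul_sum]
  rw [Finset.sum_comm]
  refine Finset.sum_eq_zero fun w _ => ?_
  have h2 := h ((w : AdjoinRoot f) * x)
  calc _ = χ ((w⁻¹ : (AdjoinRoot f)ˣ) : AdjoinRoot f) *
        ∑ u, lam u * monicInd hf ((u : AdjoinRoot f) * ((w : AdjoinRoot f) * x)) := by
        rw [Finset.mul_sum]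
        exact Finset.sum_congr rfl fun u _ => by ring
    _ = 0 := by rw [h2, mul_zero]

theorem sum_eq_zero_of_forall_sum_monicInd (hdeg : 0 < f.natDegree) {lam : (AdjoinRoot f)ˣ → ℂ}
    (h : ∀ y, ∑ u, lam u * monicInd hf ((u : AdjoinRoot f) * y) = 0) : ∑ u, lam u = 0 := by
  have : Nontrivial (AdjoinRoot f) :=
    AdjoinRoot.nontrivial f (by rw [degree_eq_natDegree hf.ne_zero]; exact_mod_cast hdeg.ne')
  have h1 : ∑ θ : Fˣ, ∑ u, lam u * monicInd hf ((u : AdjoinRoot f) * AdjoinRoot.mk f (C (θ : F))) =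
      0 := Finset.sum_eq_zero fun θ _ => h _
  rw [Finset.sum_comm] at h1
  rw [← h1]
  refine Finset.sum_congr rfl fun u _ => ?_
  rw [← Finset.mul_sum]
  simp only [mul_comm (u : AdjoinRoot f)]
  rw [sum_units_monicInd hf u.ne_zero, mul_one]

/-- For `χ` nontrivial on constants the twisted indicator is nonzero, so `∑ lam u * χ u = 0`. Only
characters trivial on constants remain in the expansion of `lam`, and character orthogonality gives
the invariance. -/
theorem even_of_forall_sum_monicInd (hdeg : 0 < f.natDegree) {lam : (AdjoinRoot f)ˣ → ℂ}
    (h : ∀ y, ∑ u, lam u * monicInd hf ((u : AdjoinRoot f) * y) = 0) (θ : Fˣ)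
    (v : (AdjoinRoot f)ˣ) : lam (constUnits f θ * v) = lam v := by
  have : Fintype (MulChar (AdjoinRoot f) ℂ) := Fintype.ofFinite _
  have h1 : ∀ χ : MulChar (AdjoinRoot f) ℂ,
      ∑ u, (lam (constUnits f θ * u) - lam u) * χ (u : AdjoinRoot f) = 0 := by
    intro χ
    have h2 : ∑ u, lam (constUnits f θ * u) * χ (u : AdjoinRoot f) =
        χ ((constUnits f θ)⁻¹ : (AdjoinRoot f)ˣ) * ∑ u, lam u * χ (u : AdjoinRoot f) := by
      rw [Finset.mul_sum]
      refine Fintype.sum_equiv (Equiv.mulLeft (constUnits f θ)) _ _ fun u => ?_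
      rw [Equiv.coe_mulLeft, mul_left_comm, ← map_mul, ← Units.val_mul, inv_mul_cancel_left]
    simp only [sub_mul, Finset.sum_sub_distrib]
    rw [h2]
    by_cases hχ : constChar χ = 1
    · rw [← map_inv, coe_constUnits, ← constChar_apply, hχ, MulChar.one_apply_coe, one_mul,
        sub_self]
    · have h3 : ∑ u, lam u * χ (u : AdjoinRoot f) = 0 := by
        by_contra h4
        refine fourier_twist_monicInd_ne_zero hf hdeg hχ ?_
        rw [fourier]
        exact Finset.sum_eq_zero fun x _ => by
          rw [(mul_eq_zero.1 (sum_twist hf lam χ x h)).resolve_left h4, zero_mul]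
      rw [h3, mul_zero, sub_zero]
  have h5 : ∑ χ : MulChar (AdjoinRoot f) ℂ, χ ((v⁻¹ : (AdjoinRoot f)ˣ) : AdjoinRoot f) *
      ∑ u, (lam (constUnits f θ * u) - lam u) * χ (u : AdjoinRoot f) =
      Fintype.card (MulChar (AdjoinRoot f) ℂ) * (lam (constUnits f θ * v) - lam v) := by
    simp only [Finset.mul_sum]
    rw [Finset.sum_comm, Finset.sum_eq_single v]
    · rw [Finset.sum_congr rfl fun χ _ => by
        rw [mul_left_comm, ← map_mul, Units.inv_mul, map_one, mul_one]]
      rw [Finset.sum_const, Finset.card_univ, nsmul_eq_mul]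
    · intro u _ hu
      rw [Finset.sum_congr rfl fun χ _ => by rw [mul_left_comm, ← map_mul, ← Units.val_mul],
        ← Finset.mul_sum, sum_mulChar_eq_zero, mul_zero]
      rw [Ne, Units.val_eq_one, inv_mul_eq_one]
      exact fun h => hu h.symm
    · exact fun h => absurd (Finset.mem_univ _) h
  simp only [h1, mul_zero, Finset.sum_const_zero] at h5
  have h6 : (Fintype.card (MulChar (AdjoinRoot f) ℂ) : ℂ) ≠ 0 := by
    exact_mod_cast Fintype.card_ne_zero
  exact sub_eq_zero.1 ((mul_eq_zero.1 h5.symm).resolve_left h6)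

omit [Fintype (AdjoinRoot f)] in
theorem natCast_card_units : (Fintype.card Fˣ : ℂ) ≠ 0 := by exact_mod_cast Fintype.card_ne_zero

/-- The converse: by invariance the sum may be averaged over constants, and reflection replaces the
indicator by the constant `1`. -/
theorem sum_monicInd_eq_zero {lam : (AdjoinRoot f)ˣ → ℂ} (h0 : ∑ u, lam u = 0)
    (h1 : ∀ θ v, lam (constUnits f θ * v) = lam v) (y : AdjoinRoot f) :
    ∑ u, lam u * monicInd hf ((u : AdjoinRoot f) * y) = 0 := by
  rcases eq_or_ne y 0 with rfl | hy
  · simp [monicInd_zero]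
  have h2 : ∀ θ : Fˣ, ∑ u, lam u * monicInd hf ((u : AdjoinRoot f) * y) =
      ∑ u, lam u * monicInd hf (AdjoinRoot.mk f (C (θ : F)) * ((u : AdjoinRoot f) * y)) := by
    intro θ
    refine (Fintype.sum_equiv (Equiv.mulLeft (constUnits f θ)) _ _ fun u => ?_).symm
    rw [Equiv.coe_mulLeft, h1, Units.val_mul, coe_constUnits, mul_assoc]
  have h3 : Fintype.card Fˣ * ∑ u, lam u * monicInd hf ((u : AdjoinRoot f) * y) = 0 := by
    rw [← nsmul_eq_mul, ← Finset.card_univ, ← Finset.sum_const, Finset.sum_congr rfl fun θ _ => h2 θ,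
      Finset.sum_comm, ← h0]
    refine Finset.sum_congr rfl fun u _ => ?_
    rw [← Finset.mul_sum, sum_units_monicInd hf ((Units.mul_right_eq_zero u).not.2 hy), mul_one]
  exact (mul_eq_zero.1 h3).resolve_left (natCast_card_units (F := F))

/-- The matrix of the brackets of the translates of the symbols. -/
def bracketMatrix : Matrix (AdjoinRoot f) (AdjoinRoot f)ˣ ℚ :=
  Matrix.of fun x u => (monicIndInt hf ((u : AdjoinRoot f) * x) : ℚ)

theorem mem_ker_bracketMatrix_iff (hdeg : 0 < f.natDegree) (lam : (AdjoinRoot f)ˣ → ℚ) :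
    lam ∈ LinearMap.ker (bracketMatrix hf).mulVecLin ↔
      ∑ u, lam u = 0 ∧ ∀ θ v, lam (constUnits f θ * v) = lam v := by
  have h1 : lam ∈ LinearMap.ker (bracketMatrix hf).mulVecLin ↔
      ∀ y, ∑ u, (lam u : ℂ) * monicInd hf ((u : AdjoinRoot f) * y) = 0 := by
    rw [LinearMap.mem_ker, Matrix.mulVecLin_apply, funext_iff]
    refine forall_congr' fun y => ?_
    rw [Matrix.mulVec, dotProduct, Pi.zero_apply, ← Rat.cast_inj (α := ℂ), Rat.cast_sum,
      Rat.cast_zero]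
    have h : ∀ u : (AdjoinRoot f)ˣ, ((bracketMatrix hf y u * lam u : ℚ) : ℂ) =
        (lam u : ℂ) * monicInd hf ((u : AdjoinRoot f) * y) := by
      intro u
      rw [bracketMatrix, Matrix.of_apply, Rat.cast_mul, Rat.cast_intCast, monicIndInt_cast,
        mul_comm]
    simp only [h]
  rw [h1]
  constructor
  · intro h
    refine ⟨?_, fun θ v => ?_⟩
    · exact_mod_cast sum_eq_zero_of_forall_sum_monicInd hf hdeg h
    · exact_mod_cast even_of_forall_sum_monicInd hf hdeg h θ v
  · rintro ⟨h2, h3⟩ y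
    refine sum_monicInd_eq_zero (lam := fun u => (lam u : ℂ)) hf ?_ ?_ y
    · exact_mod_cast h2
    · exact fun θ v => by rw [h3]

end Rank

/-- The functions with sum zero on a finite group that are invariant under a subgroup. -/
theorem finrank_ker_sum_inter {G : Type*} [CommGroup G] [Fintype G] (H : Subgroup G)
    (E : Submodule ℚ (G → ℚ))
    (hE : ∀ lam, lam ∈ E ↔ ∑ u, lam u = 0 ∧ ∀ θ ∈ H, ∀ v, lam (θ * v) = lam v) :
    Module.finrank ℚ E + 1 = Nat.card (G ⧸ H) := by
  classical
  have : Fintype (G ⧸ H) := Fintype.ofFinite _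
  let σ : (G ⧸ H → ℚ) →ₗ[ℚ] ℚ := ∑ c, LinearMap.proj c
  have hσ : ∀ g, σ g = ∑ c, g c := fun g => by simp [σ]
  let ι : (G ⧸ H → ℚ) →ₗ[ℚ] (G → ℚ) := LinearMap.funLeft ℚ ℚ (QuotientGroup.mk : G → G ⧸ H)
  have hι : Function.Injective ι :=
    LinearMap.funLeft_injective_of_surjective _ _ _ QuotientGroup.mk_surjective
  have hsum : ∀ g : G ⧸ H → ℚ, ∑ u : G, g (u : G ⧸ H) = Nat.card H * ∑ c, g c := by
    intro g
    rw [← Fintype.sum_fiberwise (fun u : G => (u : G ⧸ H)), Finset.mul_sum]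
    refine Finset.sum_congr rfl fun c _ => ?_
    rw [Finset.sum_congr rfl (g := fun _ => g c) fun u _ => by rw [u.2], Finset.sum_const,
      nsmul_eq_mul, Finset.card_univ, ← Nat.card_eq_fintype_card]
    congr 2
    obtain ⟨u, rfl⟩ := QuotientGroup.mk_surjective c
    refine Nat.card_congr ⟨fun w => ⟨u⁻¹ * w.1, QuotientGroup.eq.1 w.2.symm⟩,
      fun w => ⟨u * w.1, by simp⟩, fun w => by simp, fun w => by simp⟩
  -- Invariant functions are pullbacks from `G ⧸ H`; all fibres have size `#H`, so the sum-zero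
  -- condition descends.
  have hEmap : E = (LinearMap.ker σ).map ι := by
    ext lam
    rw [hE, Submodule.mem_map]
    constructor
    · rintro ⟨h1, h2⟩
      have h3 : ∀ a b : G, (QuotientGroup.leftRel H) a b → lam a = lam b := by
        intro a b hab
        rw [QuotientGroup.leftRel_apply] at hab
        rw [← h2 _ hab a, mul_comm, mul_inv_cancel_left]
      refine ⟨fun c => Quotient.lift lam h3 c, ?_, rfl⟩
      have h4 := hsum fun c => Quotient.lift lam h3 c
      rw [LinearMap.mem_ker, hσ]
      have h5 : ∑ u : G, lam u = Nat.card H * ∑ c, Quotient.lift lam h3 c := h4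
      rw [h1] at h5
      exact (mul_eq_zero.1 h5.symm).resolve_left (by exact_mod_cast Nat.card_pos.ne')
    · rintro ⟨g, hg, rfl⟩
      rw [LinearMap.mem_ker, hσ] at hg
      refine ⟨?_, fun θ hθ v => ?_⟩
      · exact (hsum g).trans (by rw [hg, mul_zero])
      · change g ((θ * v : G) : G ⧸ H) = g (v : G ⧸ H)
        rw [mul_comm, QuotientGroup.mk_mul_of_mem v hθ]
  have h1 := LinearMap.finrank_range_add_finrank_ker σ
  have h2 : LinearMap.range σ = ⊤ := by
    rw [LinearMap.range_eq_top]
    intro r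
    exact ⟨Pi.single (1 : G ⧸ H) r, by rw [hσ, Finset.sum_pi_single']; simp⟩
  rw [h2, finrank_top, Module.finrank_self, Module.finrank_fintype_fun_eq_card] at h1
  rw [hEmap, ← (Submodule.equivMapOfInjective ι hι _).finrank_eq, Nat.card_eq_fintype_card]
  omega

section Rank

variable {F : Type*} [Field F] [Fintype F] {f : F[X]} (hf : f.Monic)

/-- The lattice of all bracket vectors has rank `ν_f`. -/
theorem finrank_range_bracketVec (hdeg : 0 < f.natDegree) :
    (Module.finrank ℤ (LinearMap.range (bracketVec hf)) : ℚ) = nu f := by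
  classical
  have := finite_adjoinRoot hf
  have : Fintype (AdjoinRoot f) := Fintype.ofFinite _
  have : Nontrivial (AdjoinRoot f) :=
    AdjoinRoot.nontrivial f (by rw [degree_eq_natDegree hf.ne_zero]; exact_mod_cast hdeg.ne')
  set H : Subgroup (AdjoinRoot f)ˣ := (constUnits f).range with hH
  have h1 : Module.finrank ℤ (LinearMap.range (bracketVec hf)) = (bracketMatrix hf).rank := by
    rw [Matrix.rank_eq_finrank_span_row]
    exact finrank_span_intCast _ _ (Finsupp.range_linearCombination ℤ).symm
  -- The kernel has dimension `#(A/f)ˣ / (q - 1) - 1`; rank-nullity then gives `ν_f`.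
  have h2 := finrank_ker_sum_inter H (LinearMap.ker (bracketMatrix hf).mulVecLin) fun lam => by
    rw [mem_ker_bracketMatrix_iff hf hdeg, hH]
    simp
  have h3 := LinearMap.finrank_range_add_finrank_ker (bracketMatrix hf).mulVecLin
  rw [Module.finrank_fintype_fun_eq_card, ← Nat.card_eq_fintype_card] at h3
  have h4 : Nat.card H = Fintype.card F - 1 := by
    rw [hH, ← Nat.card_congr (MonoidHom.ofInjective (f := constUnits f) ?_).toEquiv, Nat.card_units,
      Nat.card_eq_fintype_card]
    exact Units.map_injective (AdjoinRoot.of f).injective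
  have h5 := Subgroup.card_eq_card_quotient_mul_card_subgroup H
  have h6 : 1 < Fintype.card F := Fintype.one_lt_card
  have h7 : (Nat.card (AdjoinRoot f)ˣ : ℚ) =
      Nat.card ((AdjoinRoot f)ˣ ⧸ H) * (Fintype.card F - 1) := by
    rw [h5, h4, Nat.cast_mul, Nat.cast_sub h6.le, Nat.cast_one]
  have h8 : ((bracketMatrix hf).rank : ℚ) + (Nat.card ((AdjoinRoot f)ˣ ⧸ H) - 1) =
      Nat.card (AdjoinRoot f)ˣ := by
    rw [← h2, ← h3]
    push_cast
    rw [Matrix.rank]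
    ring
  have h9 : (Fintype.card F : ℚ) - 1 ≠ 0 := by
    have : (1 : ℚ) < Fintype.card F := by exact_mod_cast h6
    linarith
  rw [h1, nu, h7, mul_comm _ ((Fintype.card F : ℚ) - 1), ← mul_assoc, div_mul_cancel₀ _ h9]
  rw [h7] at h8
  linear_combination h8

end Rank

/-! ### Generators, transcendence degree and Laurent monomials over a general field -/

section TranscendenceDegree

variable {K E ι : Type*} [Field K] [Field E] [Algebra K E]

theorem isAlgebraic_of_adjoin_range_eq_top {y : ι → E}
    (hy : IntermediateField.adjoin K (Set.range y) = ⊤) :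
    Algebra.IsAlgebraic (Algebra.adjoin K (Set.range y)) E := by
  rw [← IntermediateField.isAlgebraic_adjoin_iff_top, hy]
  exact ⟨fun x => isAlgebraic_algebraMap (⟨x, trivial⟩ : (⊤ : IntermediateField K E))⟩

theorem trdeg_of_adjoin_range_eq_top [Fintype ι] {y : ι → E}
    (hy : IntermediateField.adjoin K (Set.range y) = ⊤) :
    Algebra.trdeg K E < Cardinal.aleph0 ∧
      Cardinal.toNat (Algebra.trdeg K E) ≤ Fintype.card ι ∧
      (Cardinal.toNat (Algebra.trdeg K E) = Fintype.card ι ↔ AlgebraicIndependent K y) := by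
  have := isAlgebraic_of_adjoin_range_eq_top hy
  have h1 : Algebra.trdeg K E ≤ Cardinal.mk (Set.range y) := Algebra.IsAlgebraic.trdeg_le_cardinalMk K _
  have h2 : Algebra.trdeg K E < Cardinal.aleph0 := h1.trans_lt (Cardinal.mk_lt_aleph0)
  have h3 : Cardinal.toNat (Algebra.trdeg K E) ≤ Fintype.card ι := by
    refine (Cardinal.toNat_le_toNat h1 Cardinal.mk_lt_aleph0).trans ?_
    rw [← Nat.card, ← Nat.card_eq_fintype_card]
    exact Finite.card_range_le y
  refine ⟨h2, h3, fun h => ?_, fun h => ?_⟩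
  · refine (Algebra.IsAlgebraic.isTranscendenceBasis_of_lift_le_trdeg_of_finite K y ?_).1
    rw [← Cardinal.cast_toNat_of_lt_aleph0 h2, h]
    simp
  · refine le_antisymm h3 ?_
    have h4 := Cardinal.toNat_le_toNat h.lift_cardinalMk_le_trdeg (by simpa using h2)
    simpa using h4

theorem linearIndependent_prod_zpow [Fintype ι] {y : ι → E}
    (hy : AlgebraicIndependent K y) (hy0 : ∀ i, y i ≠ 0) :
    LinearIndependent K fun m : ι → ℤ => ∏ i, y i ^ m i := by
  classical
  rw [linearIndependent_iff']
  intro s g hg m hm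
  -- Multiplying the relation by `∏ y i ^ M i` makes all exponents nonnegative, so it becomes a
  -- polynomial relation with distinct monomials.
  set M : ι → ℤ := fun i => ∑ m ∈ s, |m i| with hM
  have hpos : ∀ m ∈ s, ∀ i, 0 ≤ m i + M i := by
    intro m hm i
    have h1 : |m i| ≤ M i := Finset.single_le_sum (f := fun m : ι → ℤ => |m i|)
      (fun m _ => abs_nonneg _) hm
    linarith [neg_abs_le (m i)]
  let ex : (ι → ℤ) → (ι →₀ ℕ) := fun m => Finsupp.equivFunOnFinite.symm fun i => (m i + M i).toNat
  have hex : ∀ m ∈ s, ∀ m' ∈ s, ex m = ex m' → m = m' := by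
    intro m hm m' hm' h
    funext i
    have h1 : (m i + M i).toNat = (m' i + M i).toNat := DFunLike.congr_fun h i
    have h2 := hpos m hm i
    have h3 := hpos m' hm' i
    omega
  have h1 : ∀ m ∈ s, MvPolynomial.aeval y (MvPolynomial.monomial (ex m) (g m)) =
      (∏ i, y i ^ M i) * (g m • ∏ i, y i ^ m i) := by
    intro m hm
    rw [MvPolynomial.aeval_monomial, Finsupp.prod_fintype _ _ fun i => pow_zero _, Algebra.smul_def,
      mul_left_comm, ← Finset.prod_mul_distrib]
    congr 1
    refine Finset.prod_congr rfl fun i _ => ?_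
    rw [← zpow_add₀ (hy0 i), ← zpow_natCast]
    congr 1
    change (((m i + M i).toNat : ℕ) : ℤ) = _
    rw [Int.toNat_of_nonneg (hpos m hm i), add_comm]
  have h2 : ∑ m ∈ s, MvPolynomial.monomial (ex m) (g m) = 0 := by
    refine algebraicIndependent_iff.1 hy _ ?_
    rw [map_sum, Finset.sum_congr rfl h1, ← Finset.mul_sum, hg, mul_zero]
  have h3 := congrArg (MvPolynomial.coeff (ex m)) h2
  rw [MvPolynomial.coeff_sum, Finset.sum_eq_single m, MvPolynomial.coeff_monomial, if_pos rfl,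
    MvPolynomial.coeff_zero] at h3
  · exact h3
  · intro m' hm' hne
    rw [MvPolynomial.coeff_monomial, if_neg fun h => hne (hex _ hm' _ hm h)]
  · exact fun h => absurd hm h

theorem exists_sum_eq_zero_of_not_algebraicIndependent [Fintype ι] {y : ι → E}
    (hy : ¬AlgebraicIndependent K y) (hy0 : ∀ i, y i ≠ 0) :
    ∃ N : ℕ, 2 ≤ N ∧ ∃ (m : Fin N → ι →₀ ℕ) (c : Fin N → K), Function.Injective m ∧
      (∀ i, c i ≠ 0) ∧ ∑ i, algebraMap K E (c i) * ∏ j, y j ^ m i j = 0 := by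
  rw [algebraicIndependent_iff] at hy
  push Not at hy
  obtain ⟨p, hp, hp0⟩ := hy
  rw [MvPolynomial.aeval_def, MvPolynomial.eval₂_eq'] at hp
  have h1 : ∀ i : Fin p.support.card, p.coeff (p.support.equivFin.symm i) ≠ 0 := fun i =>
    MvPolynomial.mem_support_iff.1 (p.support.equivFin.symm i).2
  refine ⟨p.support.card, ?_, fun i => p.support.equivFin.symm i,
    fun i => p.coeff (p.support.equivFin.symm i),
    Subtype.val_injective.comp p.support.equivFin.symm.injective, h1, ?_⟩
  -- A polynomial with a single term cannot vanish at a point with nonzero coordinates, so at least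
  -- two monomials occur.
  · by_contra h
    have h2 : p.support.card ≠ 0 := by
      rwa [Ne, Finset.card_eq_zero, MvPolynomial.support_eq_empty]
    obtain ⟨m, hm⟩ := Finset.card_eq_one.1 (show p.support.card = 1 by omega)
    have h3 : p.coeff m ≠ 0 := MvPolynomial.mem_support_iff.1 (by rw [hm]; simp)
    rw [hm, Finset.sum_singleton, mul_eq_zero, FaithfulSMul.algebraMap_eq_zero_iff] at hp
    exact hp.elim h3 (Finset.prod_ne_zero_iff.2 fun i _ => pow_ne_zero _ (hy0 i))
  · let g : (ι →₀ ℕ) → E := fun m => algebraMap K E (p.coeff m) * ∏ j, y j ^ m j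
    exact (Equiv.sum_comp p.support.equivFin.symm fun m : p.support => g m).trans
      ((Finset.sum_coe_sort p.support g).trans hp)

end TranscendenceDegree

/-! ### From bracket vectors to relations among `Π`-monomials -/

section Relations

variable {F : Type*} [Field F] [Fintype F] {f : F[X]} (hf : f.Monic)

theorem exists_PiMonomial_eq_mul (hdeg : 0 < f.natDegree) {a b : AGroup f}
    (h : bracketVec hf a = bracketVec hf b) :
    ∃ k : (KBar F)ˣ, PiMonomial hf a = (k : KBar F) • PiMonomial hf b := by
  have h1 : a - b ∈ algebraicMonomials hf :=
    mem_algebraicMonomials_of_bracketVec hf hdeg (by rw [map_sub, h, sub_self])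
  rw [mem_algebraicMonomials] at h1
  refine ⟨Units.mk0 ⟨_, h1⟩ fun h0 => PiMonomial_ne_zero hf (a - b) (congrArg Subtype.val h0), ?_⟩
  rw [Units.val_mk0, IntermediateField.smul_def, smul_eq_mul, ← PiMonomial_add, sub_add_cancel]

/-- The rank of the lattice of bracket vectors. -/
abbrev bracketRank : ℕ := Module.finrank ℤ (LinearMap.range (bracketVec hf))

variable {hf} {e : Fin (bracketRank hf) → AGroup f}
  {b : Module.Basis (Fin (bracketRank hf)) ℤ (LinearMap.range (bracketVec hf))}
  (he : ∀ i, bracketVec hf (e i) = b i)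

include he

omit [Fintype F] in
theorem bracketVec_sum_smul (m : Fin (bracketRank hf) → ℤ) :
    bracketVec hf (∑ i, m i • e i) = (∑ i, m i • b i : LinearMap.range (bracketVec hf)) := by
  rw [map_sum, Submodule.coe_sum]
  exact Finset.sum_congr rfl fun i _ => by rw [map_smul, he, Submodule.coe_smul]

theorem exists_PiMonomial_eq_mul_prod (hdeg : 0 < f.natDegree) (a : AGroup f) :
    ∃ k : (KBar F)ˣ, PiMonomial hf a =
      (k : KBar F) • ∏ i, PiMonomial hf (e i) ^ b.repr ⟨bracketVec hf a, a, rfl⟩ i := by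
  set m := b.repr ⟨bracketVec hf a, a, rfl⟩ with hm
  have h1 : bracketVec hf a = bracketVec hf (∑ i, m i • e i) := by
    rw [bracketVec_sum_smul he, hm, b.sum_repr]
  obtain ⟨k, hk⟩ := exists_PiMonomial_eq_mul hf hdeg h1
  refine ⟨k, ?_⟩
  rw [hk, PiMonomial_sum]
  congr 1
  exact Finset.prod_congr rfl fun i _ => PiMonomial_zsmul hf _ _

/-- `E_f` is generated by only as many elements as the rank of the lattice, which is the source of
the upper bound `ν_f`. -/
theorem adjoin_range_PiMonomial (hdeg : 0 < f.natDegree) :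
    IntermediateField.adjoin (KBar F) (Set.range fun i => PiMonomial hf (e i)) = EField f := by
  refine le_antisymm ?_ ?_
  · rw [IntermediateField.adjoin_le_iff]
    rintro _ ⟨i, rfl⟩
    refine prod_mem fun c _ => zpow_mem ?_ _
    obtain ⟨a, ha, -, -, h⟩ := exists_rep_eq hf c
    rw [h]
    rw [← degree_eq_natDegree hf.ne_zero] at ha
    exact IntermediateField.subset_adjoin _ _ ⟨a, ha, rfl⟩
  · rw [EField, IntermediateField.adjoin_le_iff]
    rintro _ ⟨a, ha, rfl⟩
    rw [← PiMonomial_symb hf ha]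
    obtain ⟨k, hk⟩ := exists_PiMonomial_eq_mul_prod he hdeg (symb f a)
    rw [hk]
    exact IntermediateField.smul_mem _ (prod_mem fun i _ => zpow_mem
      (IntermediateField.subset_adjoin _ _ (Set.mem_range_self i)) _)

theorem trdeg_EField (hdeg : 0 < f.natDegree) :
    Algebra.trdeg (KBar F) (EField f) < Cardinal.aleph0 ∧
      Cardinal.toNat (Algebra.trdeg (KBar F) (EField f)) ≤ bracketRank hf ∧
      (Cardinal.toNat (Algebra.trdeg (KBar F) (EField f)) = bracketRank hf ↔
        AlgebraicIndependent (KBar F) fun i => PiMonomial hf (e i)) := by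
  have h1 := adjoin_range_PiMonomial he hdeg
  have h2 : ∀ i, PiMonomial hf (e i) ∈ EField f := fun i => by
    rw [← h1]
    exact IntermediateField.subset_adjoin _ _ (Set.mem_range_self i)
  let y : Fin (bracketRank hf) → EField f := fun i => ⟨PiMonomial hf (e i), h2 i⟩
  have h3 : IntermediateField.adjoin (KBar F) (Set.range y) = ⊤ := by
    refine IntermediateField.map_injective (EField f).val ?_
    rw [IntermediateField.adjoin_map, ← Set.range_comp, ← AlgHom.fieldRange_eq_map,
      IntermediateField.fieldRange_val]
    exact h1
  have h4 := trdeg_of_adjoin_range_eq_top h3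
  rw [Fintype.card_fin] at h4
  refine ⟨h4.1, h4.2.1, h4.2.2.trans ?_⟩
  exact (AlgHom.algebraicIndependent_iff (x := y) (EField f).val (EField f).val.injective).symm

/-- Inequivalent elements have different coordinates in the basis `b`, so up to nonzero algebraic
factors their monomials are distinct Laurent monomials in the `Π(e_i)`. -/
theorem linearIndependent_PiMonomial (hdeg : 0 < f.natDegree)
    (hy : AlgebraicIndependent (KBar F) fun i => PiMonomial hf (e i)) {N : ℕ}
    {a : Fin N → AGroup f} (ha : ∀ i j, i < j → ¬Sim hf (a i) (a j)) :
    LinearIndependent (KBar F) fun i => PiMonomial hf (a i) := by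
  choose k hk using fun i => exists_PiMonomial_eq_mul_prod he hdeg (a i)
  have h1 := linearIndependent_prod_zpow hy fun i => PiMonomial_ne_zero hf _
  have h2 : Function.Injective fun i =>
      (b.repr ⟨bracketVec hf (a i), a i, rfl⟩ : Fin (bracketRank hf) → ℤ) := by
    intro i j hij
    have h3 := congrArg Subtype.val (b.repr.injective (DFunLike.coe_injective hij))
    rcases lt_trichotomy i j with h | h | h
    · exact absurd ((sim_iff hf _ _).2 h3) (ha i j h)
    · exact h
    · exact absurd ((sim_iff hf _ _).2 h3.symm) (ha j i h)
  have h3 := (h1.comp _ h2).units_smul k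
  have h4 : (fun i => PiMonomial hf (a i)) = k • ((fun m : Fin (bracketRank hf) → ℤ =>
      ∏ i, PiMonomial hf (e i) ^ m i) ∘ fun i => b.repr ⟨bracketVec hf (a i), a i, rfl⟩) :=
    funext hk
  rw [h4]
  exact h3

/-- The terms of a polynomial relation between the `Π(e_i)` are themselves monomials of level `f`;
different exponents give different bracket vectors since the vectors of the `e_i` form a basis. -/
theorem exists_relation
    (hy : ¬AlgebraicIndependent (KBar F) fun i => PiMonomial hf (e i)) :
    ∃ N : ℕ, 2 ≤ N ∧ ∃ (a : Fin N → AGroup f) (c : Fin N → KBar F),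
      (∀ i, c i ≠ 0) ∧ (∀ i j, i < j → ¬Sim hf (a i) (a j)) ∧
        ∑ i, (c i : CInfty F) * PiMonomial hf (a i) = 0 := by
  obtain ⟨N, hN, m, c, hm, hc, h⟩ := exists_sum_eq_zero_of_not_algebraicIndependent hy
    fun i => PiMonomial_ne_zero hf _
  refine ⟨N, hN, fun j => ∑ i, (m j i : ℤ) • e i, c, hc, fun j j' hj hsim => hj.ne (hm ?_), ?_⟩
  · rw [sim_iff, bracketVec_sum_smul he, bracketVec_sum_smul he] at hsim
    have h1 := congrArg b.repr (Subtype.val_injective hsim)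
    ext i
    have h2 := DFunLike.congr_fun h1 i
    rw [b.repr_sum_self, b.repr_sum_self] at h2
    exact Int.ofNat_inj.1 h2
  · rw [← h]
    refine Finset.sum_congr rfl fun j _ => ?_
    have h1 : PiMonomial hf (∑ i, (m j i : ℤ) • e i) = ∏ i, PiMonomial hf (e i) ^ m j i := by
      rw [PiMonomial_sum]
      exact Finset.prod_congr rfl fun i _ => by rw [PiMonomial_zsmul, zpow_natCast]
    rw [h1]
    rfl

end Relations

end GeomGamma

end

theorem proposition5p2p3 {F : Type*} [Field F] [Fintype F]
    (f : F[X]) (hf : f.Monic) (hdeg : 0 < f.natDegree) :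
    -- the transcendence degree of `E_f` over `k̄` is finite and at most `ν_f`
    (Algebra.trdeg (GeomGamma.KBar F) (GeomGamma.EField f) < Cardinal.aleph0 ∧
      (Cardinal.toNat (Algebra.trdeg (GeomGamma.KBar F) (GeomGamma.EField f)) : ℚ)
        ≤ GeomGamma.nu f) ∧
    -- it is `< ν_f` iff a linear relation holds among pairwise inequivalent `Π`-monomials
    ((Cardinal.toNat (Algebra.trdeg (GeomGamma.KBar F) (GeomGamma.EField f)) : ℚ)
        < GeomGamma.nu f ↔
      ∃ N : ℕ, 2 ≤ N ∧ ∃ (a : Fin N → GeomGamma.AGroup f) (c : Fin N → GeomGamma.KBar F),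
        (∀ i, c i ≠ 0) ∧
        (∀ i j, i < j → ¬ GeomGamma.Sim hf (a i) (a j)) ∧
        ∑ i, (c i : GeomGamma.CInfty F) * GeomGamma.PiMonomial hf (a i) = 0) ∧
    -- equality holds iff linear independence of `Π`-monomials is decided by pairwise inequivalence
    ((Cardinal.toNat (Algebra.trdeg (GeomGamma.KBar F) (GeomGamma.EField f)) : ℚ)
        = GeomGamma.nu f ↔
      ∀ (N : ℕ) (a : Fin N → GeomGamma.AGroup f),
        LinearIndependent (GeomGamma.KBar F) (fun i => GeomGamma.PiMonomial hf (a i)) ↔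
          ∀ i j, i < j → ¬ GeomGamma.Sim hf (a i) (a j)) := by
  have := GeomGamma.finite_adjoinRoot hf
  have b := Module.finBasis ℤ (LinearMap.range (GeomGamma.bracketVec hf))
  choose e he using fun i => (b i).2
  obtain ⟨h1, h2, h3⟩ := GeomGamma.trdeg_EField he hdeg
  rw [← GeomGamma.finrank_range_bracketVec hf hdeg]
  simp only [Nat.cast_le, Nat.cast_lt, Nat.cast_inj]
  have hrel : ∀ {N : ℕ} {a : Fin N → GeomGamma.AGroup f} {c : Fin N → GeomGamma.KBar F},
      2 ≤ N → (∀ i, c i ≠ 0) →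
      ∑ i, (c i : GeomGamma.CInfty F) * GeomGamma.PiMonomial hf (a i) = 0 →
      ¬LinearIndependent (GeomGamma.KBar F) fun i => GeomGamma.PiMonomial hf (a i) := by
    intro N a c hN hc h0 hli
    exact hc ⟨0, by omega⟩ (Fintype.linearIndependent_iff.1 hli c h0 _)
  refine ⟨⟨h1, h2⟩, ⟨fun h => ?_, ?_⟩, fun h N a => ⟨fun hli i j hij hsim => ?_, fun ha => ?_⟩,
    fun h => ?_⟩
  · exact GeomGamma.exists_relation he fun hy => h.ne (h3.2 hy)
  · rintro ⟨N, hN, a, c, hc, ha, h0⟩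
    refine lt_of_le_of_ne h2 fun h => ?_
    exact hrel hN hc h0 (GeomGamma.linearIndependent_PiMonomial he hdeg (h3.1 h) ha)
  -- Equivalent elements have `k̄`-proportional monomials, so `Π(a_i) - k Π(a_j) = 0` contradicts
  -- independence.
  · obtain ⟨k, hk⟩ := GeomGamma.exists_PiMonomial_eq_mul hf hdeg ((GeomGamma.sim_iff hf _ _).1 hsim)
    have h4 : Function.Injective ![i, j] := by
      intro x y
      fin_cases x <;> fin_cases y <;> simp [hij.ne, hij.ne']
    have h5 := Fintype.linearIndependent_iff.1 (hli.comp _ h4) ![1, -(k : GeomGamma.KBar F)]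
      (by simp [Fin.sum_univ_two, hk]) 0
    exact one_ne_zero h5
  · exact GeomGamma.linearIndependent_PiMonomial he hdeg (h3.1 h) ha
  · by_contra hne
    obtain ⟨N, hN, a, c, hc, ha, h0⟩ := GeomGamma.exists_relation he fun hy => hne (h3.2 hy)
    exact hrel hN hc h0 ((h N a).2 ha)
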